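/- **Setting.** Let $\mathcal A_2$ be the set of $\sigma\in C^1([0,\infty))$ such that $r\mapsto\sigma'(r)/r$ ($r>0$) is negative, bounded below and monotone (non-strictly) increasing, and $\int_0^\infty r^2\sigma(r)\,d(r^2)<\infty$ (the integral converges absolutely). Let $\sigma\in\mathcal A_2$, $V>0$, $\rho(v)=\sigma(|v+Ve_2|)$ for $v\in\mathbb R^2$, and for a unit vector $n$ let $\pi(n)=-2\int_{\mathbb R^2}(v|n)_-^2\,\rho(v)\,dv\cdot n$ with $z_-=\max\{-z,0\}$. For $u\ge0$ put $$p_+(u)=\Bigl|\pi\Bigl(\tfrac{(u,1)}{\sqrt{u^2+1}}\Bigr)\Bigr|,\qquad p_-(u)=-\Bigl|\pi\Bigl(\tfrac{(u,-1)}{\sqrt{u^2+1}}\Bigr)\Bigr| .$$ For a function $p$ on $[0,\infty)$ let $\bar p$ be the maximal convex function on $[0,\infty)$ not exceeding $p$, and $\mathcal O_p=\{u\ge0:\ p(u)>\bar p(u)\}$. A *body of length $h$* is a compact convex set $K\subset\mathbb R^2$, symmetric in the second coordinate axis, whose maximal cross section orthogonal to that axis is $[-1,1]$ and which cuts a segment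 of length $h$ out of the axis. The force on $K$ is $\int_{\partial K}\pi(n_x)\,ds$ ($n_x$ the outer unit normal, $s$ arc length). It is directed along $-e_2$; the *resistance* of $K$ is its magnitude divided by the width $2$. (If $\{f_-(|x|)\le y\le -f_+(|x|),\ |x|\le 1\}$ is a vertical translate of $K$, this is $\int_0^1p_+(f_+'(t))\,dt+\int_0^1p_-(f_-'(t))\,dt$.) A body of length $h$ is *optimal* if its resistance is minimal among all bodies of length $h$; the minimum is denoted $\mathrm R(h)$. All figures below are understood up to translation along the second axis; "the base" is the horizontal segment $[-1,1]\times\{c\}$. **Theorem.** **(I)** For all $\sigma\in\mathcal A_2$, $V>0$ there are numbers $u_+^0,B_+,u_-^0,B_-,u_*>0$ with the following properties. $\frac{p_+(u_+^0)-p_+(0)}{u_+^0}=p_+'(u_+^0)=-B_+$; $\bar p_+(u)=p_+(0)-B_+u$ on $[0,u_+^0]$ and $\bar p_+=p_+$ on $[u_+^0,\infty)$; $\mathcal O_{p_+}=(0,u_+^0)$; $(0,u_-^0)$ is a connected component of $\mathcal O_{p_-}$; $\bar p_-'(0)=-B_-$; $p_-(u_-^0)=p_-(0)-B_-u_-^0$;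 $u_*$ is the unique point of $(u_+^0,\infty)$ with $p_+'(u_*)=-B_-$. Moreover $B_-<B_+$, $0<u_+^0<u_*<u_*+u_-^0$, and for every $h>0$ the minimum $\mathrm R(h)$ is attained, as follows. 1. If $0<h<u_+^0$, the optimal bodies are exactly the isosceles trapezia with lower side the base, upper side $[-t_0,t_0]\times\{c+h\}$, $t_0=1-h/u_+^0$ (lateral slope $u_+^0$), and $\mathrm R(h)=p_+(0)-B_+h+p_-(0)$. 2. If $u_+^0\le h\le u_*$, the optimal bodies are exactly the isosceles triangles on the base with height $h$, pointing up, and $\mathrm R(h)=p_+(h)+p_-(0)$. 3. If $u_*<h<u_*+u_-^0$, put $h_+=u_*$, $h_-=h-u_*$. The union of the upward isosceles triangle of height $h_+$ on the base and the isosceles trapezium of height $h_-$ below the base, with lateral slope $u_-^0$ in absolute value, is optimal, and $\mathrm R(h)=p_+(u_*)+p_-(0)-B_-(h-u_*)$. 4. If $h\ge u_*+u_-^0$, there is exactly one pair $(h_+,h_-)$ with $h_++h_-=h$, $p_+'(h_+)=\bar p_-'(h_-)$, $h_+\ge u_+^0$, $h_-\ge u_-^0$, and $\mathrm R(h)=p_+(h_+)+\bar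 p_-(h_-)$. Furthermore, either 4a. $h_-\notin\mathcal O_{p_-}$, and the union of the upward and the downward isosceles triangles on the common base, of heights $h_+$ and $h_-$, is optimal; or 4b. $h_-$ lies in a component $(u_i^-,u_i^+)$ of $\mathcal O_{p_-}$ with $u_i^-\ge u_-^0$ (i.e. not the first one). Then with $t_i=\frac{u_i^+-h_-}{u_i^+-u_i^-}$ the following union is optimal: the upward isosceles triangle of height $h_+$ on the base, the isosceles trapezium below the base with lateral slope $u_i^+$ and lower side $[-t_i,t_i]\times\{c-h_-+u_i^-t_i\}$, and the downward isosceles triangle on that lower side with lateral slope $u_i^-$ and apex $(0,c-h_-)$. In cases 3 and 4 a body $K$ of length $h$ is optimal if and only if, for some $c$, its part $\{y\ge c\}$ is the isosceles triangle of height $h_+$ with base $[-1,1]\times\{c\}$, and its lower boundary $y=g(|x|)$ satisfies $g(1)=c$, $g(0)=c-h_-$ and, for almost every $t\in(0,1)$, $u=g'(t)$ is a contact slope, i.e. $u\ge0$ and $p_-(u)=\bar p_-(h_-)+p_+'(h_+)(u-h_-)$. In particular, if there are no contact slopes other than $0,u_-^0$ in case 3, $h_-$ in case 4a, $u_i^-,u_i^+$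 in case 4b, then the indicated body is, up to translation, the only optimal one. The set of $h\ge u_*+u_-^0$ for which 4b holds is open (possibly empty) and contained in $(u_*+u_-^0,\infty)$, and its complement in $(u_*+u_-^0,\infty)$ is non-empty. **(II)** Case 4b does occur for some distributions. Indeed, if $\sigma\in\mathcal A_2$, $V>0$, and for every integer $n>0$ the function $r^n\sigma(r)$ is monotone decreasing for large $r$, then there are $\alpha\ge0$, $\beta>0$ such that $\sigma^{\alpha,\beta}(r)=\sigma(r)+\alpha\sigma(\beta r)$ belongs to $\mathcal A_2$ and, for $\sigma^{\alpha,\beta}$ and $V$, case 4b holds for some $h$; and there exist $\sigma\in\mathcal A_2$ and $V>0$ for which case 4b holds for some $h$. -/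

import Mathlib

open Set MeasureTheory

noncomputable section

/-- The class of radial profiles: `σ` is `C¹` on `[0, ∞)`, the function `σ'(r) / r` on `(0, ∞)` is
negative, bounded below and monotone increasing, and `∫₀^∞ r² σ(r) d(r²) < ∞`. -/
structure ClassA2 (σ : ℝ → ℝ) : Prop where
  contDiffOn : ContDiffOn ℝ 1 σ (Ici 0)
  neg : ∀ r : ℝ, 0 < r → deriv σ r / r < 0
  bddBelow : BddBelow ((fun r : ℝ => deriv σ r / r) '' Ioi 0)
  monotoneOn : MonotoneOn (fun r : ℝ => deriv σ r / r) (Ioi 0)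
  integrableOn : IntegrableOn (fun r : ℝ => r ^ 2 * σ r * (2 * r)) (Ioi 0)

/-- Euclidean length of a vector of the plane `ℝ × ℝ` (whose own norm is the sup norm). -/
def euclLength (q : ℝ × ℝ) : ℝ := Real.sqrt (q.1 ^ 2 + q.2 ^ 2)

/-- The density `ρ(v) = σ(|v + V e₂|)` of the flux. -/
def fluxDensity (σ : ℝ → ℝ) (V : ℝ) (v : ℝ × ℝ) : ℝ := σ (euclLength (v + (0, V)))

/-- The pressure `π(n) = -2 ∫ (v | n)₋² ρ(v) dv · n` at a boundary point with outer unit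
normal `n`, where `z₋ = max (-z) 0`. -/
def pressure (σ : ℝ → ℝ) (V : ℝ) (n : ℝ × ℝ) : ℝ × ℝ :=
  (-2 * ∫ v : ℝ × ℝ, (max (-(v.1 * n.1 + v.2 * n.2)) 0) ^ 2 * fluxDensity σ V v) • n

/-- Outer unit normal of the region below a graph, at a point where the slope is `s`. -/
def upperNormal (s : ℝ) : ℝ × ℝ := (1 / Real.sqrt (s ^ 2 + 1)) • ((-s, 1) : ℝ × ℝ)

/-- Outer unit normal of the region above a graph, at a point where the slope is `s`. -/
def lowerNormal (s : ℝ) : ℝ × ℝ := (1 / Real.sqrt (s ^ 2 + 1)) • ((s, -1) : ℝ × ℝ)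

/-- `p₊(u) = |π((u, 1) / √(u² + 1))|`. -/
def pPlus (σ : ℝ → ℝ) (V u : ℝ) : ℝ :=
  euclLength (pressure σ V ((1 / Real.sqrt (u ^ 2 + 1)) • ((u, 1) : ℝ × ℝ)))

/-- `p₋(u) = -|π((u, -1) / √(u² + 1))|`. -/
def pMinus (σ : ℝ → ℝ) (V u : ℝ) : ℝ :=
  -euclLength (pressure σ V ((1 / Real.sqrt (u ^ 2 + 1)) • ((u, -1) : ℝ × ℝ)))

/-- The maximal convex function on `[0, ∞)` that does not exceed `p` there. -/
def convexEnvelope (p : ℝ → ℝ) (u : ℝ) : ℝ :=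
  sSup {y : ℝ | ∃ g : ℝ → ℝ, ConvexOn ℝ (Ici 0) g ∧ (∀ x ∈ Ici (0 : ℝ), g x ≤ p x) ∧ y = g u}

/-- The set `{u ≥ 0 : p(u) > p̄(u)}`, where `p̄` is the convex envelope of `p`. -/
def gapSet (p : ℝ → ℝ) : Set ℝ := {u : ℝ | 0 ≤ u ∧ convexEnvelope p u < p u}

/-- `(a, b)` is a (bounded) connected component of the open set `gapSet p`. -/
def IsGap (p : ℝ → ℝ) (a b : ℝ) : Prop :=
  0 ≤ a ∧ a < b ∧ Ioo a b ⊆ gapSet p ∧ a ∉ gapSet p ∧ b ∉ gapSet p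

/-- Admissible bodies of length `h`: compact convex plane sets, symmetric with respect to the second
coordinate axis, whose maximal cross section orthogonal to that axis is `[-1, 1]`, and which cut
a segment of length `h` out of the axis. -/
structure IsBody (h : ℝ) (K : Set (ℝ × ℝ)) : Prop where
  convex : Convex ℝ K
  isCompact : IsCompact K
  symmetric : ∀ x y : ℝ, (x, y) ∈ K → (-x, y) ∈ K
  section_subset : ∀ y : ℝ, {x : ℝ | (x, y) ∈ K} ⊆ Icc (-1) 1
  exists_section : ∃ y : ℝ, {x : ℝ | (x, y) ∈ K} = Icc (-1) 1
  length_eq : ∃ a : ℝ, {y : ℝ | (0, y) ∈ K} = Icc a (a + h)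

/-- The function whose graph over `[-1, 1]` is the upper part of the boundary of a body. -/
def upperBoundary (K : Set (ℝ × ℝ)) (x : ℝ) : ℝ := sSup {y : ℝ | (x, y) ∈ K}

/-- The function whose graph over `[-1, 1]` is the lower part of the boundary of a body. -/
def lowerBoundary (K : Set (ℝ × ℝ)) (x : ℝ) : ℝ := sInf {y : ℝ | (x, y) ∈ K}

/-- Resistance of a body: the pressure force on the body is the integral of the pressure over its
boundary with respect to arc length. The force is directed along `-e₂`, and the resistance is
its magnitude divided by the width `2` of the body. On the upper and on the lower part of the
boundary arc length is `√(1 + s²) dx`, `s` being the slope; possible vertical segments of the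
boundary have horizontal normals and contribute nothing to the component along `e₂`. -/
def resistance (σ : ℝ → ℝ) (V : ℝ) (K : Set (ℝ × ℝ)) : ℝ :=
  -((∫ x in (-1 : ℝ)..1, Real.sqrt (1 + deriv (upperBoundary K) x ^ 2) *
        (pressure σ V (upperNormal (deriv (upperBoundary K) x))).2) +
      ∫ x in (-1 : ℝ)..1, Real.sqrt (1 + deriv (lowerBoundary K) x ^ 2) *
        (pressure σ V (lowerNormal (deriv (lowerBoundary K) x))).2) / 2

/-- `K` is a body of least resistance among the bodies of length `h`. -/
def IsOptimal (σ : ℝ → ℝ) (V h : ℝ) (K : Set (ℝ × ℝ)) : Prop :=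
  IsBody h K ∧ ∀ K' : Set (ℝ × ℝ), IsBody h K' → resistance σ V K ≤ resistance σ V K'

/-- The minimal resistance of bodies of length `h` is attained and equals `R`. -/
def IsMinResistance (σ : ℝ → ℝ) (V h R : ℝ) : Prop :=
  IsLeast {r : ℝ | ∃ K : Set (ℝ × ℝ), IsBody h K ∧ r = resistance σ V K} R

/-- Isosceles triangle with base `[-w, w] × {c}` and apex `(0, c + a)`; it points down if `a < 0`. -/
def isoTriangle (c w a : ℝ) : Set (ℝ × ℝ) :=
  convexHull ℝ {((-w, c) : ℝ × ℝ), (w, c), (0, c + a)}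

/-- Isosceles trapezium with parallel sides `[-w, w] × {c}` and `[-w', w'] × {c'}`. -/
def isoTrapezium (c w c' w' : ℝ) : Set (ℝ × ℝ) :=
  convexHull ℝ {((-w, c) : ℝ × ℝ), (w, c), (-w', c'), (w', c')}

/-- Union of a triangle of height `hP` and a trapezium below it, of height `hM` and with lateral
sides of slope `u` in absolute value, on the common base `[-1, 1] × {c}`. -/
def triangleTrapezium (c hP hM u : ℝ) : Set (ℝ × ℝ) :=
  isoTriangle c 1 hP ∪ isoTrapezium c 1 (c - hM) (1 - hM / u)

/-- Union of two triangles of heights `hP` and `hM` on the common base `[-1, 1] × {c}`. -/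
def twoTriangles (c hP hM : ℝ) : Set (ℝ × ℝ) :=
  isoTriangle c 1 hP ∪ isoTriangle c 1 (-hM)

/-- Union of a triangle of height `hP` above the base `[-1, 1] × {c}`, a trapezium below that base
with lateral sides of slope `b`, and a triangle below the trapezium with lateral sides of slope `a`;
the trapezium and the lower triangle have total height `hM`. -/
def twoTrianglesTrapezium (c hP hM a b : ℝ) : Set (ℝ × ℝ) :=
  isoTriangle c 1 hP ∪
    isoTrapezium c 1 (c - hM + a * ((b - hM) / (b - a))) ((b - hM) / (b - a)) ∪
    isoTriangle (c - hM + a * ((b - hM) / (b - a))) ((b - hM) / (b - a))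
      (-(a * ((b - hM) / (b - a))))

/-- The defining relations of `u₊⁰, B₊, u₋⁰, B₋, u_*`. -/
structure IsThresholds (σ : ℝ → ℝ) (V uP BP uM BM uS : ℝ) : Prop where
  uP_pos : 0 < uP
  BP_pos : 0 < BP
  chord_plus : (pPlus σ V uP - pPlus σ V 0) / uP = -BP
  tangent_plus : HasDerivAt (pPlus σ V) (-BP) uP
  envelope_plus_left : ∀ u : ℝ, 0 ≤ u → u ≤ uP →
    convexEnvelope (pPlus σ V) u = pPlus σ V 0 - BP * u
  envelope_plus_right : ∀ u : ℝ, uP ≤ u → convexEnvelope (pPlus σ V) u = pPlus σ V u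
  gapSet_plus : gapSet (pPlus σ V) = Ioo 0 uP
  gap_minus : IsGap (pMinus σ V) 0 uM
  BM_pos : 0 < BM
  slope_minus : HasDerivWithinAt (convexEnvelope (pMinus σ V)) (-BM) (Ici 0) 0
  chord_minus : pMinus σ V uM = pMinus σ V 0 - BM * uM
  uP_lt_uS : uP < uS
  tangent_star : HasDerivAt (pPlus σ V) (-BM) uS
  unique_star : ∀ u : ℝ, uP < u → HasDerivAt (pPlus σ V) (-BM) u → u = uS

/-- The system of relations for the heights `hP = h₊` and `hM = h₋` of the two parts of a long
body: `h₊ + h₋ = h`, `p₊'(h₊) = p̄₋'(h₋)`, `h₊ ≥ u₊⁰`, `h₋ ≥ u₋⁰`. -/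
def IsSplit (σ : ℝ → ℝ) (V uP uM h hP hM : ℝ) : Prop :=
  hP + hM = h ∧ uP ≤ hP ∧ uM ≤ hM ∧
    ∃ s : ℝ, HasDerivAt (pPlus σ V) s hP ∧
      HasDerivWithinAt (convexEnvelope (pMinus σ V)) s (Ici 0) hM

/-- `u` is the abscissa of a point that the graph of `p₋` shares with the line of slope
`p₊'(hP)` through `(hM, p̄₋(hM))`. -/
def IsContact (σ : ℝ → ℝ) (V hP hM u : ℝ) : Prop :=
  0 ≤ u ∧
    pMinus σ V u = convexEnvelope (pMinus σ V) hM + deriv (pPlus σ V) hP * (u - hM)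

/-- The part of `K` above some level `c` is the isosceles triangle of height `hP` with base
`[-1, 1] × {c}`, and the part below is bounded by a curve that starts in the ends of the base, has
its lowest point `hM` below the base, and has almost everywhere a contact slope. -/
def HasOptimalParts (σ : ℝ → ℝ) (V hP hM : ℝ) (K : Set (ℝ × ℝ)) : Prop :=
  ∃ c : ℝ, K ∩ {q : ℝ × ℝ | c ≤ q.2} = isoTriangle c 1 hP ∧
    lowerBoundary K 1 = c ∧ lowerBoundary K 0 = c - hM ∧
    ∀ᵐ t : ℝ ∂(volume.restrict (Ioo 0 1)),
      IsContact σ V hP hM (deriv (lowerBoundary K) t)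

/-- The lengths `h ≥ u_* + u₋⁰` for which `h₋` lies in a component of `{p₋ > p̄₋}` other than
the first component `(0, u₋⁰)`. -/
def fifthKindLengths (σ : ℝ → ℝ) (V uP uM uS : ℝ) : Set ℝ :=
  {h : ℝ | uS + uM ≤ h ∧ ∃ hP hM a b : ℝ, IsSplit σ V uP uM h hP hM ∧
    IsGap (pMinus σ V) a b ∧ uM ≤ a ∧ hM ∈ Ioo a b}

end

open Filter Topology

noncomputable section

/-! ### The convex envelope -/

/-! Translating the velocities by `V e₂` and rotating `n` to `e₂` makes the pressure
one-dimensional. With `m` the marginal of `σ(|v|)` and `Φ(s) = 2 ∫ (s - y)₊² m(y) dy`, one gets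
`|π(n)| = Φ(V n₂)`, hence `p₊(u) = Φ(V z)` and `p₋(u) = -Φ(-V z)` with `z = 1/√(u² + 1)`
(`integral_max_sq`, `pPlus_eq`, `pMinus_eq`). The function `Φ` is positive, strictly increasing and
strictly convex.

Optimality is a calibration argument (`resistance_calibration`). Let `A + s u ≤ p₊` and `B + s u ≤
p₋` on `[0, ∞)` with one common `s < 0`. The rises of the two boundary curves add up to `h` minus
the height of the vertical sides, so integration gives resistance at least `A + B + s h`. Equality
holds exactly if there are no vertical sides and almost all slopes are contact slopes of the two
lines. A single body with equality therefore yields both the minimum and the description of all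
optimal bodies. The cases of the theorem are choices of `s`: `-B₊` for trapezia, `p₊'(h)` for
triangles, `-B₋` for a triangle with a trapezium, and the common value `p₊'(h₊) = p̄₋'(h₋)` for long
bodies.

The supporting lines come from the shapes of `p₊` and `p₋`. Both are bounded below and flat at `0`,
so their envelopes begin with a chord (`exists_first_chord`). As `m` decreases on `[0, ∞)`, `p₊` is
first concave and then convex (`exists_inflection`), so beyond its chord every tangent touches it
only once. Strict convexity of `Φ` makes `p₋` drop less than `p₊`, whence `B₋ < B₊`. Nothing
comparable is known of `p₋`, but its envelope is differentiable on `(0, ∞)` and is a line touching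
`p₋` at both ends of each gap (`exists_hasDerivAt_convexEnvelope`, `exists_isGap`). Darboux's
theorem then splits a long body, and monotonicity of the slopes makes the split unique.

For the mixtures take `α = κ β³`. On the scale `u = β V w` the function `β (p₋ + Φ(0))` tends to
`Φ'(0)/w - κ Φ(-1/w)` as `β → ∞`. Rapid decay gives `Φ(-1/w) = O(w²)`, so this term fails to be
concave near `0`, and a large `κ` lifts the limit above one of its chords. The resulting gap of `p₋`
moves to infinity with `β` while `u₋⁰` stays bounded, so it is not the first gap. -/

lemma le_convexEnvelope {p g : ℝ → ℝ} (hg : ConvexOn ℝ (Ici 0) g)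
    (hgp : ∀ x, 0 ≤ x → g x ≤ p x) {u : ℝ} (hu : 0 ≤ u) : g u ≤ convexEnvelope p u :=
  le_csSup ⟨p u, by rintro _ ⟨k, -, hk, rfl⟩; exact hk u hu⟩ ⟨g, hg, hgp, rfl⟩

lemma convexOn_affine (A s : ℝ) (S : Set ℝ) (hS : Convex ℝ S) :
    ConvexOn ℝ S (fun x => A + s * x) := by
  refine ⟨hS, fun x _ y _ a b _ _ hab => le_of_eq ?_⟩
  simp only [smul_eq_mul]
  linear_combination (-A) * hab

lemma affine_le_convexEnvelope {p : ℝ → ℝ} {A s : ℝ} (h : ∀ x, 0 ≤ x → A + s * x ≤ p x) {u : ℝ}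
    (hu : 0 ≤ u) : A + s * u ≤ convexEnvelope p u :=
  le_convexEnvelope (convexOn_affine A s _ (convex_Ici 0)) h hu

lemma convexEnvelope_le {p : ℝ → ℝ} {m : ℝ} (hm : ∀ x, 0 ≤ x → m ≤ p x) {u : ℝ} (hu : 0 ≤ u) :
    convexEnvelope p u ≤ p u := by
  refine csSup_le ⟨m, fun _ => m, convexOn_const m (convex_Ici 0), fun x hx => hm x hx, rfl⟩ ?_
  rintro _ ⟨k, -, hk, rfl⟩
  exact hk u hu

lemma convexOn_convexEnvelope {p : ℝ → ℝ} {m : ℝ} (hm : ∀ x, 0 ≤ x → m ≤ p x) :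
    ConvexOn ℝ (Ici 0) (convexEnvelope p) := by
  refine ⟨convex_Ici 0, fun x hx y hy a b ha hb hab => ?_⟩
  refine csSup_le ⟨m, fun _ => m, convexOn_const m (convex_Ici 0), fun x hx => hm x hx, rfl⟩ ?_
  rintro _ ⟨k, hk, hkp, rfl⟩
  refine (hk.2 hx hy ha hb hab).trans ?_
  simp only [smul_eq_mul]
  gcongr
  · exact le_convexEnvelope hk hkp hx
  · exact le_convexEnvelope hk hkp hy

lemma exists_subgradient {f : ℝ → ℝ} (hf : ConvexOn ℝ (Ici 0) f) {x : ℝ} (hx : 0 < x) :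
    ∃ s, ∀ u, 0 ≤ u → f x + s * (u - x) ≤ f u := by
  have hxi : x ∈ interior (Ici (0 : ℝ)) := by simpa using hx
  refine ⟨derivWithin f (Ioi x) x, fun u hu => ?_⟩
  rcases lt_trichotomy u x with h | h | h
  · have h1 := hf.slope_le_leftDeriv_of_mem_interior (x := u) hu hxi h
    have h2 := hf.leftDeriv_le_rightDeriv_of_mem_interior hxi
    have h3 := h1.trans h2
    rw [slope_def_field, div_le_iff₀ (by linarith)] at h3
    linarith
  · simp [h]
  · have h1 := hf.rightDeriv_le_slope_of_mem_interior hxi hu h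
    rw [slope_def_field, le_div_iff₀ (by linarith)] at h1
    linarith

lemma subgradient_of_hasDerivWithinAt {f : ℝ → ℝ} (hf : ConvexOn ℝ (Ici 0) f) {x s : ℝ}
    (hx : 0 ≤ x) (hd : HasDerivWithinAt f s (Ici 0) x) {u : ℝ} (hu : 0 ≤ u) :
    f x + s * (u - x) ≤ f u := by
  rcases lt_trichotomy u x with h | h | h
  · have h1 := hf.slope_le_of_hasDerivWithinAt (x := u) hu hx h hd
    rw [slope_def_field, div_le_iff₀ (by linarith)] at h1
    linarith
  · simp [h]
  · have h1 := hf.le_slope_of_hasDerivWithinAt hx hu h hd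
    rw [slope_def_field, le_div_iff₀ (by linarith)] at h1
    linarith

lemma subgradient_mono {f : ℝ → ℝ} {x y s t : ℝ} (hx : 0 ≤ x) (hxy : x < y)
    (hs : ∀ u, 0 ≤ u → f x + s * (u - x) ≤ f u) (ht : ∀ u, 0 ≤ u → f y + t * (u - y) ≤ f u) :
    s ≤ t := by
  have h1 := hs y (by linarith)
  have h2 := ht x hx
  by_contra! h
  nlinarith

lemma HasDerivAt.squeeze {f g k : ℝ → ℝ} {x s : ℝ} (hf : HasDerivAt f s x) (hk : HasDerivAt k s x)
    (hfg : f x = g x) (hgk : g x = k x) (h1 : ∀ᶠ y in 𝓝 x, f y ≤ g y) (h2 : ∀ᶠ y in 𝓝 x, g y ≤ k y) :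
    HasDerivAt g s x := by
  rw [hasDerivAt_iff_isLittleO, Asymptotics.isLittleO_iff] at *
  intro c hc
  filter_upwards [hf hc, hk hc, h1, h2] with y a1 a2 a3 a4
  rw [Real.norm_eq_abs, abs_le] at *
  constructor <;> linarith [a1.1, a2.2]

/-- A line that lies below `p` and touches the convex envelope at `x` touches `p` to the right of
`x`, or at `x`. -/
lemma exists_contact_right {p : ℝ → ℝ} {m A s x : ℝ} (hp : Continuous p)
    (hm : ∀ x, 0 ≤ x → m ≤ p x) (hx : 0 < x) (hs : s < 0) (hl : ∀ u, 0 ≤ u → A + s * u ≤ p u)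
    (he : convexEnvelope p x = A + s * x) : ∃ b, x ≤ b ∧ p b = A + s * b := by
  by_contra! hne
  have hpos : ∀ u, x ≤ u → 0 < p u - (A + s * u) := fun u hu =>
    sub_pos.2 (lt_of_le_of_ne (hl u (by linarith)) (hne u hu).symm)
  have hq : Continuous (fun u => p u - (A + s * u)) := by fun_prop
  obtain ⟨r', hr', hball⟩ := Metric.eventually_nhds_iff.1
    ((hq.tendsto x).eventually (lt_mem_nhds (hpos x le_rfl)))
  obtain ⟨r, hr0, hrx, hr⟩ : ∃ r, 0 < r ∧ r ≤ x ∧ ∀ u, x - r ≤ u → 0 < p u - (A + s * u) := by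
    refine ⟨min (r' / 2) x, by positivity, min_le_right _ _, fun u hu => ?_⟩
    rcases le_or_gt x u with h | h
    · exact hpos u h
    · refine hball ?_
      have := min_le_left (r' / 2) x
      rw [Real.dist_eq, abs_lt]
      constructor <;> linarith
  -- Beyond `M` even the line of slope `s / 2` through `(0, A)` is below the lower bound `m`.
  set M := max x (2 * (A - m) / (-s)) with hM
  have hMx : x ≤ M := le_max_left _ _
  have hM2 : 2 * (A - m) ≤ M * (-s) := by
    rw [← div_le_iff₀ (by linarith)]; exact le_max_right _ _
  obtain ⟨y, hy, hymin⟩ := (isCompact_Icc (a := x - r) (b := M)).exists_isMinOn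
    ⟨x, by constructor <;> linarith⟩ hq.continuousOn
  have hδ := hr y hy.1
  set δ := p y - (A + s * y) with hδd
  have hM0 : 0 < M := by linarith
  set ε := min (-s / 2) (δ / M) with hε
  have hε0 : 0 < ε := lt_min (by linarith) (by positivity)
  have hε1 : ε ≤ -s / 2 := min_le_left _ _
  have hε2 : ε * M ≤ δ := by rw [← le_div_iff₀ hM0]; exact min_le_right _ _
  -- The line is turned upwards about its point over `x - r`. It still lies below `p`, since the
  -- gain `ε (u - (x - r))` is negative to the left, at most `δ` up to `M`, and harmless beyond `M`.
  -- At `x` it is above the envelope.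
  have key := affine_le_convexEnvelope (p := p) (A := A - ε * (x - r)) (s := s + ε) (fun u hu => by
    rcases le_total u (x - r) with h1 | h1
    · nlinarith [hl u hu]
    rcases le_total u M with h2 | h2
    · have h3 : δ ≤ p u - (A + s * u) := hymin ⟨h1, h2⟩
      nlinarith
    · have h3 := hm u hu
      have h4 : 0 ≤ ε * (x - r) := mul_nonneg hε0.le (by linarith)
      nlinarith) hx.le
  rw [he] at key
  nlinarith

/-- The mirror image of the previous argument: the line is turned about its point over `x + r`. To
the right it only sinks, so no lower bound on `p` is needed. -/
lemma exists_contact_left {p : ℝ → ℝ} {A s x : ℝ} (hp : Continuous p)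
    (hx : 0 ≤ x) (hl : ∀ u, 0 ≤ u → A + s * u ≤ p u)
    (he : convexEnvelope p x = A + s * x) : ∃ a, 0 ≤ a ∧ a ≤ x ∧ p a = A + s * a := by
  by_contra! hne
  have hpos : ∀ u, 0 ≤ u → u ≤ x → 0 < p u - (A + s * u) := fun u hu hux =>
    sub_pos.2 (lt_of_le_of_ne (hl u hu) (hne u hu hux).symm)
  have hq : Continuous (fun u => p u - (A + s * u)) := by fun_prop
  obtain ⟨r', hr', hball⟩ := Metric.eventually_nhds_iff.1
    ((hq.tendsto x).eventually (lt_mem_nhds (hpos x hx le_rfl)))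
  obtain ⟨r, hr0, hr⟩ : ∃ r, 0 < r ∧ ∀ u, 0 ≤ u → u ≤ x + r → 0 < p u - (A + s * u) := by
    refine ⟨r' / 2, by positivity, fun u hu0 hu => ?_⟩
    rcases le_or_gt u x with h | h
    · exact hpos u hu0 h
    · refine hball ?_
      rw [Real.dist_eq, abs_lt]
      constructor <;> linarith
  obtain ⟨y, hy, hymin⟩ := (isCompact_Icc (a := 0) (b := x + r)).exists_isMinOn
    ⟨x, by constructor <;> linarith⟩ hq.continuousOn
  have hδ := hr y hy.1 hy.2
  set δ := p y - (A + s * y) with hδd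
  have hxr : 0 < x + r := by linarith
  set ε := δ / (x + r) with hε
  have hε0 : 0 < ε := by positivity
  have hε2 : ε * (x + r) = δ := by rw [hε]; field_simp
  have key := affine_le_convexEnvelope (p := p) (A := A + ε * (x + r)) (s := s - ε) (fun u hu => by
    rcases le_total u (x + r) with h1 | h1
    · have h3 : δ ≤ p u - (A + s * u) := hymin ⟨hu, h1⟩
      nlinarith
    · nlinarith [hl u hu]) hx
  rw [he] at key
  nlinarith

lemma convexEnvelope_eq_of_contact {p : ℝ → ℝ} {m A s x : ℝ} (hm : ∀ x, 0 ≤ x → m ≤ p x)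
    (hx : 0 ≤ x) (hl : ∀ u, 0 ≤ u → A + s * u ≤ p u) (hc : p x = A + s * x) :
    convexEnvelope p x = p x :=
  le_antisymm (convexEnvelope_le hm hx) (hc ▸ affine_le_convexEnvelope hl hx)

/-- The line is a competitor from below, and convexity of the envelope bounds it from above by the
chord between the two contact points. -/
lemma convexEnvelope_eq_line {p : ℝ → ℝ} {m A s a b : ℝ} (hm : ∀ x, 0 ≤ x → m ≤ p x)
    (ha : 0 ≤ a) (hl : ∀ u, 0 ≤ u → A + s * u ≤ p u) (hca : p a = A + s * a)
    (hcb : p b = A + s * b) {u : ℝ} (hu : u ∈ Icc a b) : convexEnvelope p u = A + s * u := by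
  refine le_antisymm ?_ (affine_le_convexEnvelope hl (ha.trans hu.1))
  rcases hu.1.eq_or_lt with rfl | h1
  · exact hca ▸ convexEnvelope_le hm ha
  have hab : a < b := h1.trans_le hu.2
  have hba : 0 < b - a := sub_pos.2 hab
  have h := (convexOn_convexEnvelope hm).2 (mem_Ici.2 ha) (mem_Ici.2 (ha.trans hab.le))
    (div_nonneg (by linarith [hu.2] : 0 ≤ b - u) hba.le)
    (div_nonneg (by linarith : 0 ≤ u - a) hba.le)
    (by rw [← add_div, div_eq_one_iff_eq hba.ne']; ring)
  have e : ((b - u) / (b - a)) • a + ((u - a) / (b - a)) • b = u := by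
    simp only [smul_eq_mul]; field_simp; ring
  rw [e] at h
  refine h.trans ?_
  simp only [smul_eq_mul]
  have h2 := mul_le_mul_of_nonneg_left (hca ▸ convexEnvelope_le hm ha)
    (div_nonneg (by linarith [hu.2] : 0 ≤ b - u) hba.le)
  have h3 := mul_le_mul_of_nonneg_left (hcb ▸ convexEnvelope_le hm (ha.trans hab.le))
    (div_nonneg (by linarith : 0 ≤ u - a) hba.le)
  refine (add_le_add h2 h3).trans (le_of_eq ?_)
  field_simp; ring

/-- The ends of the gap are the contact points nearest to `x` on either side, which exist because
the contact set is closed. -/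
lemma exists_isGap {p : ℝ → ℝ} {m A s x : ℝ} (hp : Continuous p)
    (hm : ∀ x, 0 ≤ x → m ≤ p x) (hx : 0 < x) (hs : s < 0) (hl : ∀ u, 0 ≤ u → A + s * u ≤ p u)
    (he : convexEnvelope p x = A + s * x) (hg : x ∈ gapSet p) :
    ∃ a b, IsGap p a b ∧ x ∈ Ioo a b ∧ p a = A + s * a ∧ p b = A + s * b := by
  have hC : IsClosed {u : ℝ | p u = A + s * u} := isClosed_eq hp (by fun_prop)
  obtain ⟨a', ha0', hax', hca'⟩ := exists_contact_left hp hx.le hl he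
  obtain ⟨b', hb', hcb'⟩ := exists_contact_right hp hm hx hs hl he
  obtain ⟨a, ⟨⟨ha0, hax⟩, hca⟩, hamax⟩ := ((isCompact_Icc (a := 0) (b := x)).inter_right
    hC).exists_isGreatest ⟨a', ⟨ha0', hax'⟩, hca'⟩
  obtain ⟨b, ⟨⟨hbx, hbb⟩, hcb⟩, hbmin⟩ := ((isCompact_Icc (a := x) (b := b')).inter_right
    hC).exists_isLeast ⟨b', ⟨hb', le_rfl⟩, hcb'⟩
  have hnx : p x ≠ A + s * x := fun h => absurd hg.2 (by rw [he, h]; exact lt_irrefl _)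
  have hax2 : a < x := lt_of_le_of_ne hax (by rintro rfl; exact hnx hca)
  have hxb2 : x < b := lt_of_le_of_ne hbx (by rintro rfl; exact hnx hcb)
  refine ⟨a, b, ⟨ha0, hax2.trans hxb2, fun u hu => ?_, ?_, ?_⟩, ⟨hax2, hxb2⟩, hca, hcb⟩
  · have hu0 : 0 ≤ u := ha0.trans hu.1.le
    refine ⟨hu0, ?_⟩
    rw [convexEnvelope_eq_line hm ha0 hl hca hcb ⟨hu.1.le, hu.2.le⟩]
    refine lt_of_le_of_ne (hl u hu0) fun h => ?_
    rcases le_total u x with h1 | h1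
    · exact absurd (hamax ⟨⟨hu0, h1⟩, h.symm⟩) (not_le.2 hu.1)
    · exact absurd (hbmin ⟨⟨h1, (hu.2.le).trans hbb⟩, h.symm⟩) (not_le.2 hu.2)
  · exact fun h => h.2.ne (convexEnvelope_eq_of_contact hm ha0 hl hca)
  · exact fun h => h.2.ne (convexEnvelope_eq_of_contact hm (hx.le.trans hbx) hl hcb)

lemma IsGap.unique {p : ℝ → ℝ} {a b a' b' x : ℝ} (h : IsGap p a b) (h' : IsGap p a' b')
    (hx : x ∈ Ioo a b) (hx' : x ∈ Ioo a' b') : a = a' ∧ b = b' := by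
  obtain ⟨-, -, h3, h4, h5⟩ := h
  obtain ⟨-, -, h3', h4', h5'⟩ := h'
  refine ⟨le_antisymm ?_ ?_, le_antisymm ?_ ?_⟩ <;> by_contra! hlt
  · exact h4 (h3' ⟨hlt, hx.1.trans hx'.2⟩)
  · exact h4' (h3 ⟨hlt, hx'.1.trans hx.2⟩)
  · exact h5' (h3 ⟨hx.1.trans hx'.2, hlt⟩)
  · exact h5 (h3' ⟨hx'.1.trans hx.2, hlt⟩)

/-- If `p > ℓ` and `p → ℓ` at infinity, then all lines that lie below `p` and touch the envelope
are decreasing. -/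
lemma subgradient_neg {p : ℝ → ℝ} {l x s : ℝ} (hp : Continuous p) (hl : ∀ u, 0 ≤ u → l < p u)
    (ht : Tendsto p atTop (𝓝 l)) (hx : 0 ≤ x)
    (hs : ∀ u, 0 ≤ u → convexEnvelope p x + s * (u - x) ≤ p u) : s < 0 := by
  by_contra! hs0
  have hle : convexEnvelope p x ≤ l := by
    refine ge_of_tendsto ht ?_
    filter_upwards [eventually_ge_atTop x] with u hu
    have := hs u (hx.trans hu)
    nlinarith
  obtain ⟨y, hy, hymin⟩ := (isCompact_Icc (a := 0) (b := x + 1)).exists_isMinOn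
    ⟨x, by constructor <;> linarith⟩ hp.continuousOn
  set δ := p y - l with hδ
  have hδ0 : 0 < δ := sub_pos.2 (hl y hy.1)
  have hx1 : 0 < x + 1 := by linarith
  have hd : δ / (x + 1) * (x + 1) = δ := by field_simp
  have hd0 : 0 < δ / (x + 1) := by positivity
  -- The line from `(0, l + δ)` to `(x + 1, l)` stays below `p` and exceeds `l` at `x`, against the
  -- bound on the envelope just found.
  have key := affine_le_convexEnvelope (p := p) (A := l + δ) (s := -(δ / (x + 1))) (fun u hu => by
    rcases le_total u (x + 1) with h1 | h1
    · have h3 : p y ≤ p u := hymin ⟨hu, h1⟩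
      nlinarith
    · nlinarith [hl u hu]) hx
  nlinarith

/-- In a gap the envelope is locally a line. At a contact point it is squeezed between a supporting
line and the differentiable `p`, which have the same slope there. -/
lemma exists_hasDerivAt_convexEnvelope {p : ℝ → ℝ} {l x : ℝ} (hp : Differentiable ℝ p)
    (hl : ∀ u, 0 ≤ u → l < p u) (ht : Tendsto p atTop (𝓝 l)) (hx : 0 < x) :
    ∃ s, s < 0 ∧ HasDerivAt (convexEnvelope p) s x ∧
      ∀ u, 0 ≤ u → convexEnvelope p x + s * (u - x) ≤ p u := by
  have hm : ∀ x, 0 ≤ x → l ≤ p x := fun x hx => (hl x hx).le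
  obtain ⟨s, hs⟩ := exists_subgradient (convexOn_convexEnvelope hm) hx
  have hsp : ∀ u, 0 ≤ u → convexEnvelope p x + s * (u - x) ≤ p u := fun u hu =>
    (hs u hu).trans (convexEnvelope_le hm hu)
  have hs0 := subgradient_neg hp.continuous hl ht hx.le hsp
  refine ⟨s, hs0, ?_, hsp⟩
  have hline : HasDerivAt (fun u => convexEnvelope p x + s * (u - x)) s x := by
    simpa using (((hasDerivAt_id x).sub_const x).const_mul s).const_add (convexEnvelope p x)
  have hev : ∀ᶠ u in 𝓝 x, 0 < u := lt_mem_nhds hx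
  by_cases hg : x ∈ gapSet p
  · obtain ⟨a, b, hab, hxab, hca, hcb⟩ := exists_isGap (A := convexEnvelope p x - s * x)
      hp.continuous hm hx hs0 (fun u hu => by linarith [hsp u hu]) (by ring) hg
    refine hline.congr_of_eventuallyEq ?_
    filter_upwards [Ioo_mem_nhds hxab.1 hxab.2] with u hu
    rw [convexEnvelope_eq_line (A := convexEnvelope p x - s * x) hm hab.1
      (fun u hu => by linarith [hsp u hu]) hca hcb ⟨hu.1.le, hu.2.le⟩]
    ring
  · have hc : convexEnvelope p x = p x := by
      by_contra hne
      exact hg ⟨hx.le, lt_of_le_of_ne (convexEnvelope_le hm hx.le) hne⟩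
    have hd := (hp x).hasDerivAt
    have hds : deriv p x = s := by
      have hmin : IsLocalMin (fun u => p u - (convexEnvelope p x + s * (u - x))) x := by
        filter_upwards [hev] with u hu
        have := hsp u hu.le
        simp only [sub_self, mul_zero, add_zero, hc] at this ⊢
        linarith
      have := hmin.hasDerivAt_eq_zero (hd.sub hline)
      linarith
    rw [hds] at hd
    refine hline.squeeze hd (by simp) hc ?_ ?_
    · filter_upwards [hev] with u hu using hs u hu.le
    · filter_upwards [hev] with u hu using convexEnvelope_le hm hu.le

/-! ### The first chord of the convex envelope -/

lemma deriv_eq_of_contact {p : ℝ → ℝ} {A s x d : ℝ} (hx : 0 < x) (hd : HasDerivAt p d x)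
    (hl : ∀ u, 0 ≤ u → A + s * u ≤ p u) (hc : p x = A + s * x) : d = s := by
  have hmin : IsLocalMin (fun u => p u - (A + s * u)) x := by
    filter_upwards [lt_mem_nhds hx] with u hu
    have := hl u hu.le
    simp only [hc]
    linarith
  have hline : HasDerivAt (fun u => A + s * u) s x := by
    simpa using ((hasDerivAt_id x).const_mul s).const_add A
  have := hmin.hasDerivAt_eq_zero (hd.sub hline)
  linarith

/-- `B` is the maximum of the descent rate `(p 0 - p u) / u`. The maximum exists because the rate is
small near `0`, where `p` is flat, and near infinity, where `p` is bounded below. `u₀` is the first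
point where it is attained. -/
lemma exists_first_chord {p dp : ℝ → ℝ} {m : ℝ} (hd : ∀ u, HasDerivAt p (dp u) u) (h0 : dp 0 = 0)
    (hm : ∀ u, 0 ≤ u → m ≤ p u) (hdrop : p 1 < p 0) :
    ∃ u₀ B, 0 < u₀ ∧ 0 < B ∧ (∀ u, 0 ≤ u → p 0 + -B * u ≤ p u) ∧ p u₀ = p 0 + -B * u₀ ∧
      (∀ u, 0 < u → u < u₀ → p 0 + -B * u < p u) ∧ dp u₀ = -B := by
  have hp : Continuous p := continuous_iff_continuousAt.2 fun u => (hd u).continuousAt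
  set c := p 0 - p 1 with hc
  have hc0 : 0 < c := sub_pos.2 hdrop
  obtain ⟨r, hr0, hr⟩ : ∃ r, 0 < r ∧ ∀ u, 0 < u → u < r → p 0 - p u < c * u := by
    have h := hd 0
    rw [h0, hasDerivAt_iff_isLittleO, Asymptotics.isLittleO_iff] at h
    obtain ⟨r, hr0, hr⟩ := Metric.eventually_nhds_iff.1 (h (half_pos hc0))
    refine ⟨r, hr0, fun u hu hur => ?_⟩
    have := hr (y := u) (by rw [Real.dist_eq, sub_zero, abs_of_pos hu]; exact hur)
    simp only [sub_zero, smul_zero, Real.norm_eq_abs, abs_of_pos hu] at this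
    nlinarith [neg_abs_le (p u - p 0)]
  set a := min (r / 2) 1 with ha
  have ha0 : 0 < a := lt_min (by linarith) one_pos
  have har : a < r := (min_le_left _ _).trans_lt (by linarith)
  -- Outside `[a, M]` the descent rate is smaller than `c`, its value at `u = 1`.
  set M := max 1 ((p 0 - m) / c) + 1 with hM
  have hM1 : 1 < M := by have := le_max_left 1 ((p 0 - m) / c); linarith
  have hMr : ∀ u, M ≤ u → p 0 - p u < c * u := fun u hu => by
    have h1 : (p 0 - m) / c < u := by have := le_max_right 1 ((p 0 - m) / c); linarith
    rw [div_lt_iff₀ hc0] at h1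
    linarith [hm u (by linarith)]
  have hcont : ContinuousOn (fun u => (p 0 - p u) / u) (Icc a M) := by
    refine ContinuousOn.div (by fun_prop) continuousOn_id fun u hu => (ha0.trans_le hu.1).ne'
  have h1mem : (1 : ℝ) ∈ Icc a M := ⟨min_le_right _ _, hM1.le⟩
  obtain ⟨w, hw, hwmax⟩ := isCompact_Icc.exists_isMaxOn ⟨1, h1mem⟩ hcont
  set B := (p 0 - p w) / w with hB
  have hw0 : 0 < w := ha0.trans_le hw.1
  have hBc : c ≤ B := (div_one c).symm.le.trans (isMaxOn_iff.1 hwmax 1 h1mem)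
  have hB0 : 0 < B := hc0.trans_le hBc
  have hin : ∀ u ∈ Icc a M, p 0 + -B * u ≤ p u := fun u hu => by
    have h := isMaxOn_iff.1 hwmax u hu
    rw [← hB, div_le_iff₀ (ha0.trans_le hu.1)] at h
    linarith
  have hsmall : ∀ u, 0 < u → u < r → p 0 + -B * u < p u := fun u hu hur => by
    nlinarith [hr u hu hur]
  have hall : ∀ u, 0 ≤ u → p 0 + -B * u ≤ p u := fun u hu => by
    rcases hu.eq_or_lt with rfl | hu
    · simp
    rcases lt_or_ge u r with h | h
    · exact (hsmall u hu h).le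
    rcases le_total u M with h2 | h2
    · exact hin u ⟨by linarith, h2⟩
    · nlinarith [hMr u h2]
  have hC : IsClosed {u : ℝ | p u = p 0 + -B * u} := isClosed_eq hp (by fun_prop)
  obtain ⟨u₀, ⟨⟨hau, huM⟩, hu₀⟩, hmin⟩ := ((isCompact_Icc (a := a) (b := M)).inter_right
    hC).exists_isLeast ⟨w, hw, by
      have : B * w = p 0 - p w := by rw [hB]; field_simp
      change p w = p 0 + -B * w
      linarith⟩
  have hu0 : 0 < u₀ := ha0.trans_le hau
  refine ⟨u₀, B, hu0, hB0, hall, hu₀, fun u hu huu => ?_, deriv_eq_of_contact hu0 (hd u₀) hall hu₀⟩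
  rcases lt_or_ge u r with h | h
  · exact hsmall u hu h
  · refine lt_of_le_of_ne (hall u hu.le) fun he => ?_
    exact absurd (hmin ⟨⟨by linarith, by linarith⟩, he.symm⟩) (not_le.2 huu)

/-! ### Functions that are first concave and then convex -/

lemma mvt_lt {p dp : ℝ → ℝ} (hd : ∀ u, HasDerivAt p (dp u) u) {a b s : ℝ} (hab : a < b)
    (h : ∀ u ∈ Ioo a b, dp u < s) : p b < p a + s * (b - a) := by
  obtain ⟨c, hc, he⟩ := exists_hasDerivAt_eq_slope p dp hab
    (fun x _ => (hd x).continuousAt.continuousWithinAt) (fun x _ => hd x)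
  have := h c hc
  rw [he, div_lt_iff₀ (by linarith)] at this
  linarith

lemma lt_mvt {p dp : ℝ → ℝ} (hd : ∀ u, HasDerivAt p (dp u) u) {a b s : ℝ} (hab : a < b)
    (h : ∀ u ∈ Ioo a b, s < dp u) : p a + s * (b - a) < p b := by
  obtain ⟨c, hc, he⟩ := exists_hasDerivAt_eq_slope p dp hab
    (fun x _ => (hd x).continuousAt.continuousWithinAt) (fun x _ => hd x)
  have := h c hc
  rw [he, lt_div_iff₀ (by linarith)] at this
  linarith

/-- A chord that supports `p` is tangent at `u₀`. Inside a strictly concave range the graph would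
fall below this tangent further to the right. -/
lemma le_of_touching_chord {p dp : ℝ → ℝ} (hd : ∀ u, HasDerivAt p (dp u) u) {A s c u₀ : ℝ}
    (hanti : StrictAntiOn dp (Icc 0 c)) (hu₀ : 0 < u₀) (hl : ∀ u, 0 ≤ u → A + s * u ≤ p u)
    (hc : p u₀ = A + s * u₀) : c ≤ u₀ := by
  by_contra! hlt
  have hds := deriv_eq_of_contact hu₀ (hd u₀) hl hc
  have h1 := mvt_lt hd hlt (s := s) fun u hu => hds ▸ hanti ⟨hu₀.le, hlt.le⟩
    ⟨hu₀.le.trans hu.1.le, hu.2.le⟩ hu.1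
  have h2 := hl c (hu₀.le.trans hlt.le)
  nlinarith

/-- Beyond the tangency point the tangents of a convex branch lie below the whole graph. -/
lemma tangent_lt {p dp : ℝ → ℝ} (hd : ∀ u, HasDerivAt p (dp u) u) {B u₀ : ℝ}
    (hmono : StrictMonoOn dp (Ici u₀)) (hB : dp u₀ = -B)
    (hl : ∀ u, 0 ≤ u → p 0 + -B * u ≤ p u) (hc : p u₀ = p 0 + -B * u₀) {v u : ℝ} (hv : u₀ < v)
    (hu : 0 ≤ u) (hne : u ≠ v) : p v + dp v * (u - v) < p u := by
  have key : ∀ w, u₀ ≤ w → w ≠ v → p v + dp v * (w - v) < p w := fun w hw hwv => by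
    rcases lt_or_gt_of_ne hwv with h | h
    · have := mvt_lt hd h (s := dp v) fun x hx => hmono (hw.trans hx.1.le) hv.le hx.2
      linarith
    · have := lt_mvt hd h (s := dp v) fun x hx => hmono hv.le (hv.le.trans hx.1.le) hx.1
      linarith
  rcases le_or_gt u₀ u with h | h
  · exact key u h hne
  -- To the left of `u₀` the comparison goes through the chord: the tangent at `v` is below it at
  -- `u₀` and has the larger slope.
  · have h1 := key u₀ le_rfl hv.ne
    have h2 : -B < dp v := hB ▸ hmono self_mem_Ici hv.le hv
    have h3 := hl u hu
    nlinarith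

lemma lt_after_chord {p dp : ℝ → ℝ} (hd : ∀ u, HasDerivAt p (dp u) u) {B u₀ : ℝ}
    (hmono : StrictMonoOn dp (Ici u₀)) (hB : dp u₀ = -B)
    (hc : p u₀ = p 0 + -B * u₀) {u : ℝ} (hu : u₀ < u) : p 0 + -B * u < p u := by
  have := lt_mvt hd hu (s := -B) fun x hx => hB ▸ hmono self_mem_Ici hx.1.le hx.1
  linarith

/-! ### Potentials of a one-dimensional velocity distribution -/

/-- The properties of the marginal of a radially decreasing planar density that are used below. -/
structure IsMarginal (m : ℝ → ℝ) : Prop where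
  pos : ∀ y, 0 < m y
  antitoneOn : AntitoneOn m (Ici 0)
  integrable : Integrable m
  integrable_sq : Integrable fun y => y ^ 2 * m y

/-- Twice the second moment of the distances to `s` over the half-line below `s`. -/
def fluxPotential (m : ℝ → ℝ) (s : ℝ) : ℝ := 2 * ∫ y, max (s - y) 0 ^ 2 * m y

/-- The derivative of `fluxPotential`. -/
def fluxSlope (m : ℝ → ℝ) (s : ℝ) : ℝ := 4 * ∫ y, max (s - y) 0 * m y

/-- The second derivative of `fluxPotential`. -/
def fluxMass (m : ℝ → ℝ) (s : ℝ) : ℝ := 4 * ∫ y in Iic s, m y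

lemma hasDerivAt_max_sq (t : ℝ) : HasDerivAt (fun t : ℝ => max t 0 ^ 2) (2 * max t 0) t := by
  rcases lt_trichotomy t 0 with h | rfl | h
  · rw [max_eq_right h.le, mul_zero]
    refine (hasDerivAt_const t (0 : ℝ)).congr_of_eventuallyEq ?_
    filter_upwards [gt_mem_nhds h] with x hx
    simp [max_eq_right hx.le]
  · rw [max_self, mul_zero]
    refine (hasDerivAt_const (0 : ℝ) (0 : ℝ)).squeeze (by simpa using hasDerivAt_pow 2 (0 : ℝ))
      (by simp) (by simp) (.of_forall fun x => by positivity) (.of_forall fun x => ?_)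
    rcases le_total x 0 with h | h
    · rw [max_eq_right h]; nlinarith [sq_nonneg x]
    · rw [max_eq_left h]
  · rw [max_eq_left h.le]
    refine (by simpa using hasDerivAt_pow 2 t : HasDerivAt (fun t : ℝ => t ^ 2) (2 * t) t
      ).congr_of_eventuallyEq ?_
    filter_upwards [lt_mem_nhds h] with x hx
    simp [max_eq_left hx.le]

namespace IsMarginal

variable {m : ℝ → ℝ}

lemma integrable_dist (hm : IsMarginal m) (c : ℝ) : Integrable fun y => (c + |y|) * m y := by
  refine ((hm.integrable.const_mul (|c| + 1)).add hm.integrable_sq).mono'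
    ((by fun_prop : Continuous fun y : ℝ => c + |y|).aestronglyMeasurable.mul hm.integrable.1)
    (.of_forall fun y => ?_)
  have h := hm.pos y
  rw [Real.norm_eq_abs, abs_mul, abs_of_pos h, Pi.add_apply, ← add_mul]
  gcongr
  rw [abs_le]
  constructor <;> nlinarith [le_abs_self c, neg_abs_le c, sq_abs y, sq_nonneg (|y| - 1), abs_nonneg y]

lemma integrable_max (hm : IsMarginal m) (s : ℝ) : Integrable fun y => max (s - y) 0 * m y := by
  refine (hm.integrable_dist |s|).mono'
    ((by fun_prop : Continuous fun y : ℝ => max (s - y) 0).aestronglyMeasurable.mul hm.integrable.1)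
    (.of_forall fun y => ?_)
  have h := hm.pos y
  rw [Real.norm_eq_abs, abs_mul, abs_of_pos h, abs_of_nonneg (le_max_right _ _)]
  gcongr
  refine max_le ?_ (by positivity)
  linarith [le_abs_self s, neg_abs_le y]

lemma integrable_max_sq (hm : IsMarginal m) (s : ℝ) :
    Integrable fun y => max (s - y) 0 ^ 2 * m y := by
  refine ((hm.integrable.const_mul (2 * s ^ 2)).add (hm.integrable_sq.const_mul 2)).mono'
    ((by fun_prop : Continuous fun y : ℝ => max (s - y) 0 ^ 2).aestronglyMeasurable.mul
      hm.integrable.1) (.of_forall fun y => ?_)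
  have h := hm.pos y
  rw [Real.norm_of_nonneg (mul_nonneg (sq_nonneg _) h.le), Pi.add_apply, ← mul_assoc, ← add_mul]
  gcongr
  rcases le_total (s - y) 0 with h | h
  · rw [max_eq_right h]; nlinarith [sq_nonneg s, sq_nonneg y]
  · rw [max_eq_left h]; nlinarith [sq_nonneg (s + y)]

lemma hasDerivAt_fluxPotential (hm : IsMarginal m) (s : ℝ) :
    HasDerivAt (fluxPotential m) (fluxSlope m s) s := by
  have h := (hasDerivAt_integral_of_dominated_loc_of_deriv_le (μ := volume)
    (F := fun s y => max (s - y) 0 ^ 2 * m y) (F' := fun s y => 2 * max (s - y) 0 * m y)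
    (bound := fun y => 2 * ((|s| + 1 + |y|) * m y)) (x₀ := s) (Metric.ball_mem_nhds s one_pos)
    (.of_forall fun s => (hm.integrable_max_sq s).1) (hm.integrable_max_sq s)
    (((hm.integrable_max s).const_mul 2).congr (.of_forall fun y => by ring)).1
    (.of_forall fun y x hx => ?_) ((hm.integrable_dist _).const_mul 2)
    (.of_forall fun y x _ => ?_)).2
  · have e : fluxSlope m s = 2 * ∫ y, 2 * max (s - y) 0 * m y := by
      rw [fluxSlope, ← integral_const_mul, ← integral_const_mul]
      congr 1 with y
      ring
    rw [e]
    exact h.const_mul 2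
  · have h := hm.pos y
    rw [Real.norm_of_nonneg (mul_nonneg (by positivity) h.le), ← mul_assoc]
    gcongr
    rw [Metric.mem_ball, Real.dist_eq] at hx
    refine max_le ?_ (by positivity)
    linarith [le_abs_self s, neg_abs_le y, le_abs_self (x - s)]
  · have h1 := (hasDerivAt_max_sq (x - y)).comp x ((hasDerivAt_id x).sub_const y)
    simpa [Function.comp_def] using h1.mul_const (m y)

/-- The integrand is Lipschitz in `s` with constant `m y` and differentiable except at `y = s`. A
null set is harmless, so `m` need not be continuous. -/
lemma hasDerivAt_fluxSlope (hm : IsMarginal m) (s : ℝ) :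
    HasDerivAt (fluxSlope m) (fluxMass m s) s := by
  have h := (hasDerivAt_integral_of_dominated_loc_of_lip (μ := volume)
    (F := fun s y => max (s - y) 0 * m y) (F' := (Iic s).indicator m)
    (bound := m) (x₀ := s) (s := univ) univ_mem
    (.of_forall fun s => (hm.integrable_max s).1) (hm.integrable_max s)
    (hm.integrable.indicator measurableSet_Iic).1
    (.of_forall fun y => ?_) hm.integrable ?_).2
  · rw [fluxMass, ← integral_indicator measurableSet_Iic]
    exact h.const_mul 4
  · have h := hm.pos y
    refine LipschitzOnWith.of_dist_le_mul fun a _ b _ => ?_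
    rw [Real.dist_eq, Real.dist_eq, Real.coe_nnabs, abs_of_pos h, ← sub_mul, abs_mul, abs_of_pos h,
      mul_comm]
    have h1 := abs_max_sub_max_le_abs (a - y) (b - y) 0
    rw [sub_sub_sub_cancel_right] at h1
    exact mul_le_mul_of_nonneg_left h1 h.le
  · filter_upwards [compl_mem_ae_iff.2 (measure_singleton (μ := volume) s)] with y hy
    rcases lt_or_gt_of_ne (show y ≠ s from hy) with h | h
    · rw [indicator_of_mem (show y ∈ Iic s from h.le)]
      have h1 : HasDerivAt (fun x => (x - y) * m y) (m y) s := by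
        simpa using ((hasDerivAt_id s).sub_const y).mul_const (m y)
      refine h1.congr_of_eventuallyEq ?_
      filter_upwards [lt_mem_nhds h] with x hx
      rw [max_eq_left (by linarith)]
    · rw [indicator_of_notMem (show y ∉ Iic s from not_le.2 h)]
      refine (hasDerivAt_const s (0 : ℝ)).congr_of_eventuallyEq ?_
      filter_upwards [gt_mem_nhds h] with x hx
      rw [max_eq_right (by linarith), zero_mul]

lemma fluxPotential_nonneg (hm : IsMarginal m) (s : ℝ) : 0 ≤ fluxPotential m s :=
  mul_nonneg two_pos.le (integral_nonneg fun y => mul_nonneg (by positivity) (hm.pos y).le)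

lemma fluxSlope_pos (hm : IsMarginal m) (s : ℝ) : 0 < fluxSlope m s := by
  refine mul_pos four_pos ((integral_pos_iff_support_of_nonneg
    (fun y => mul_nonneg (le_max_right _ _) (hm.pos y).le) (hm.integrable_max s)).2 ?_)
  refine lt_of_lt_of_le (b := volume (Iio s)) (by simp) (measure_mono fun y (hy : y < s) => ?_)
  have : 0 < s - y := sub_pos.2 hy
  exact (mul_pos (lt_max_of_lt_left this) (hm.pos y)).ne'

lemma fluxMass_pos (hm : IsMarginal m) (s : ℝ) : 0 < fluxMass m s := by
  refine mul_pos four_pos ((integral_pos_iff_support_of_nonneg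
    (fun y => (hm.pos y).le) hm.integrable.integrableOn).2 ?_)
  have : Function.support m = univ := by
    ext y; simpa using (hm.pos y).ne'
  simp [this]

lemma strictMono_fluxSlope (hm : IsMarginal m) : StrictMono (fluxSlope m) :=
  strictMono_of_hasDerivAt_pos (hm.hasDerivAt_fluxSlope) fun s => hm.fluxMass_pos s

lemma strictMono_fluxPotential (hm : IsMarginal m) : StrictMono (fluxPotential m) :=
  strictMono_of_hasDerivAt_pos (hm.hasDerivAt_fluxPotential) fun s => hm.fluxSlope_pos s

lemma fluxPotential_pos (hm : IsMarginal m) (s : ℝ) : 0 < fluxPotential m s :=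
  (hm.fluxPotential_nonneg (s - 1)).trans_lt (hm.strictMono_fluxPotential (by linarith))

/-- This says that `fluxMass m t / t` decreases for `t > 0`. The mean of the decreasing `m` over
`[0, s]` is at least `m s`, its mean over `[s, t]` at most `m s`, and the mass of the negative
half-line only helps. It is the sole use of the monotonicity of `m`. -/
lemma fluxMass_mul_le (hm : IsMarginal m) {s t : ℝ} (hs : 0 < s) (hst : s ≤ t) :
    fluxMass m t * s ≤ fluxMass m s * t := by
  have hi : ∀ a b, IntervalIntegrable m volume a b := fun a b => hm.integrable.intervalIntegrable
  have e : ∀ s : ℝ, 0 ≤ s →  ∫ y in Iic s, m y = (∫ y in Iic 0, m y) + ∫ y in (0 : ℝ)..s, m y :=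
    fun s hs => by
      rw [← intervalIntegral.integral_Iic_sub_Iic hm.integrable.integrableOn
        hm.integrable.integrableOn]; ring
  have h0 : 0 ≤ ∫ y in Iic 0, m y := integral_nonneg fun y => (hm.pos y).le
  have h1 : s * m s ≤ ∫ y in (0 : ℝ)..s, m y := by
    have := intervalIntegral.integral_mono_on hs.le (intervalIntegrable_const (c := m s)) (hi 0 s)
      fun y hy => hm.antitoneOn (mem_Ici.2 hy.1) (mem_Ici.2 hs.le) hy.2
    simpa using this
  have h2 : ∫ y in s..t, m y ≤ (t - s) * m s := by
    have := intervalIntegral.integral_mono_on hst (hi s t) (intervalIntegrable_const (c := m s))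
      fun y hy => hm.antitoneOn (mem_Ici.2 hs.le) (mem_Ici.2 (hs.le.trans hy.1)) hy.1
    simpa using this
  have h3 := intervalIntegral.integral_add_adjacent_intervals (hi 0 s) (hi s t)
  have h4 := mul_le_mul_of_nonneg_left h2 hs.le
  have h5 := mul_le_mul_of_nonneg_left h1 (sub_nonneg.2 hst)
  rw [fluxMass, fluxMass, e s hs.le, e t (hs.le.trans hst), ← h3]
  nlinarith

end IsMarginal

/-! ### Radial densities in the plane -/

lemma continuous_euclLength : Continuous euclLength := by
  unfold euclLength; fun_prop

lemma euclLength_nonneg (q : ℝ × ℝ) : 0 ≤ euclLength q := Real.sqrt_nonneg _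

lemma euclLength_equiv (z : ℂ) : euclLength (Complex.measurableEquivRealProd z) = ‖z‖ := by
  rw [Complex.norm_eq_sqrt_sq_add_sq, euclLength, Complex.measurableEquivRealProd_apply]

/-- The product carries the sup norm, so polar coordinates are applied in `ℂ`, whose norm is
Euclidean. -/
lemma integrable_comp_euclLength {f : ℝ → ℝ} (hf : IntegrableOn (fun r => r * f r) (Ioi 0)) :
    Integrable fun q : ℝ × ℝ => f (euclLength q) := by
  have h := (integrable_fun_norm_addHaar (volume : Measure ℂ) (f := f)).2 (by
    simpa [Complex.finrank_real_complex] using hf)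
  rw [← Complex.volume_preserving_equiv_real_prod.integrable_comp_emb
    Complex.measurableEquivRealProd.measurableEmbedding]
  refine h.congr (.of_forall fun z => ?_)
  simp only [Function.comp, euclLength_equiv]

namespace ClassA2

variable {σ : ℝ → ℝ}

lemma deriv_neg (hσ : ClassA2 σ) {r : ℝ} (hr : 0 < r) : deriv σ r < 0 := by
  have := hσ.neg r hr
  rwa [div_lt_iff₀ hr, zero_mul] at this

lemma strictAntiOn (hσ : ClassA2 σ) : StrictAntiOn σ (Ici 0) :=
  strictAntiOn_of_deriv_neg (convex_Ici 0) hσ.contDiffOn.continuousOn fun r hr =>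
    hσ.deriv_neg (by simpa using hr)

/-- A nonpositive value would keep the decreasing `σ` below a negative constant near infinity,
against the moment condition. -/
lemma pos (hσ : ClassA2 σ) {r : ℝ} (hr : 0 ≤ r) : 0 < σ r := by
  by_contra! h
  have h1 : σ (r + 1) < 0 := (hσ.strictAntiOn (mem_Ici.2 hr) (mem_Ici.2 (by linarith))
    (by linarith)).trans_le h
  have hi : IntegrableOn (fun _ : ℝ => σ (r + 1)) (Ioi (r + 1)) := by
    refine Integrable.mono' (hσ.integrableOn.mono_set (Ioi_subset_Ioi (by linarith))).norm
      aestronglyMeasurable_const ?_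
    filter_upwards [ae_restrict_mem measurableSet_Ioi] with x (hx : r + 1 < x)
    have h2 : σ x < σ (r + 1) := hσ.strictAntiOn (mem_Ici.2 (by linarith))
      (mem_Ici.2 (by linarith)) hx
    have h3 : 1 ≤ x ^ 2 := by nlinarith
    rw [Real.norm_eq_abs, Real.norm_eq_abs, abs_mul, abs_mul, abs_of_neg h1,
      abs_of_neg (h2.trans h1), abs_of_nonneg (sq_nonneg x), abs_of_pos (by linarith : 0 < 2 * x)]
    nlinarith [mul_le_mul_of_nonneg_right h3 (by linarith : 0 ≤ -σ x),
      mul_le_mul_of_nonneg_right (by nlinarith : 1 ≤ x ^ 2 * (2 * x)) (by linarith : 0 ≤ -σ x)]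
  rw [integrableOn_const_iff] at hi
  rcases hi with h2 | h2
  · exact h1.ne (enorm_eq_zero.1 h2)
  · simp at h2

lemma continuousOn (hσ : ClassA2 σ) : ContinuousOn σ (Ici 0) := hσ.contDiffOn.continuousOn

lemma continuous_comp (hσ : ClassA2 σ) {X : Type*} [TopologicalSpace X] {f : X → ℝ}
    (hf : Continuous f) (h0 : ∀ x, 0 ≤ f x) : Continuous fun x => σ (f x) :=
  hσ.continuousOn.comp_continuous hf h0

lemma antitone_comp (hσ : ClassA2 σ) {a b : ℝ} (ha : 0 ≤ a) (hab : a ≤ b) : σ b ≤ σ a :=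
  hσ.strictAntiOn.antitoneOn (mem_Ici.2 ha) (mem_Ici.2 (ha.trans hab)) hab

lemma integrableOn_pow (hσ : ClassA2 σ) {k : ℕ} (hk : k ≤ 3) :
    IntegrableOn (fun r => r ^ k * σ r) (Ioi 0) := by
  have hc : ContinuousOn (fun r => r ^ k * σ r) (Ici 0) :=
    (continuous_pow k).continuousOn.mul hσ.continuousOn
  rw [← Ioc_union_Ioi_eq_Ioi (zero_le_one' ℝ)]
  refine IntegrableOn.union ?_ ?_
  · exact ((hc.mono Icc_subset_Ici_self).integrableOn_compact isCompact_Icc).mono_set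
      Ioc_subset_Icc_self
  · refine Integrable.mono' (hσ.integrableOn.mono_set (Ioi_subset_Ioi zero_le_one))
      ((hc.mono fun x (hx : (1 : ℝ) < x) => mem_Ici.2 (by linarith)).aestronglyMeasurable
        measurableSet_Ioi) ?_
    filter_upwards [ae_restrict_mem measurableSet_Ioi] with x (hx : 1 < x)
    have hx0 : 0 < x := by linarith
    have hs := hσ.pos hx0.le
    rw [Real.norm_of_nonneg (by positivity)]
    have h1 : x ^ k ≤ x ^ 3 := pow_le_pow_right₀ hx.le hk
    nlinarith [mul_le_mul_of_nonneg_right h1 hs.le, pow_pos hx0 3, mul_pos (pow_pos hx0 3) hs]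

lemma integrable_abs (hσ : ClassA2 σ) : Integrable fun x : ℝ => σ |x| := by
  have := (integrable_fun_norm_addHaar (volume : Measure ℝ) (f := σ)).2 (by
    simpa using hσ.integrableOn_pow (k := 0) (by norm_num))
  simpa [Real.norm_eq_abs] using this

lemma integrable_plane (hσ : ClassA2 σ) :
    Integrable fun q : ℝ × ℝ => (1 + euclLength q ^ 2) * σ (euclLength q) := by
  refine integrable_comp_euclLength (f := fun r => (1 + r ^ 2) * σ r)
    (((hσ.integrableOn_pow (k := 1) (by norm_num)).add
      (hσ.integrableOn_pow (k := 3) le_rfl)).congr (.of_forall fun r => ?_))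
  simp only [Pi.add_apply]
  ring

end ClassA2

/-- The marginal of the radial density `σ (|v|)` with respect to one coordinate. -/
def radialMarginal (σ : ℝ → ℝ) (y : ℝ) : ℝ := ∫ x : ℝ, σ (euclLength (x, y))

namespace ClassA2

variable {σ : ℝ → ℝ}

lemma integrable_section (hσ : ClassA2 σ) (y : ℝ) :
    Integrable fun x : ℝ => σ (euclLength (x, y)) := by
  refine hσ.integrable_abs.mono' (hσ.continuous_comp (continuous_euclLength.comp (by fun_prop))
    fun x => euclLength_nonneg _).aestronglyMeasurable (.of_forall fun x => ?_)
  rw [Real.norm_of_nonneg (hσ.pos (euclLength_nonneg _)).le]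
  refine hσ.antitone_comp (abs_nonneg x) ?_
  rw [← Real.sqrt_sq_eq_abs]
  exact Real.sqrt_le_sqrt (by simp only; nlinarith [sq_nonneg y])

lemma integrable_mul (hσ : ClassA2 σ) {f : ℝ × ℝ → ℝ} (hf : Continuous f) {C : ℝ}
    (hb : ∀ q, |f q| ≤ C * (1 + euclLength q ^ 2)) :
    Integrable fun q : ℝ × ℝ => f q * σ (euclLength q) := by
  refine (hσ.integrable_plane.const_mul C).mono' (hf.mul (hσ.continuous_comp continuous_euclLength
    euclLength_nonneg)).aestronglyMeasurable (.of_forall fun q => ?_)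
  have hs := hσ.pos (euclLength_nonneg q)
  rw [norm_mul, Real.norm_eq_abs, Real.norm_of_nonneg hs.le, ← mul_assoc]
  exact mul_le_mul_of_nonneg_right (hb q) hs.le

lemma euclLength_sq (q : ℝ × ℝ) : euclLength q ^ 2 = q.1 ^ 2 + q.2 ^ 2 :=
  Real.sq_sqrt (by positivity)

lemma isMarginal (hσ : ClassA2 σ) : IsMarginal (radialMarginal σ) where
  pos y := by
    refine (integral_pos_iff_support_of_nonneg (fun x => (hσ.pos (euclLength_nonneg _)).le)
      (hσ.integrable_section y)).2 ?_
    have : (Function.support fun x : ℝ => σ (euclLength (x, y))) = univ := by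
      ext x; simpa using (hσ.pos (euclLength_nonneg (x, y))).ne'
    simp [this]
  antitoneOn y hy z hz hyz := by
    refine integral_mono (hσ.integrable_section z) (hσ.integrable_section y) fun x => ?_
    refine hσ.antitone_comp (euclLength_nonneg _) (Real.sqrt_le_sqrt ?_)
    have := pow_le_pow_left₀ hy hyz 2
    simp only
    linarith
  integrable := by
    have h := (hσ.integrable_mul (f := fun _ => 1) continuous_const (C := 1) fun q => by
      simpa using sq_nonneg (euclLength q))
    rw [Measure.volume_eq_prod] at h
    simpa using! h.integral_prod_right
  integrable_sq := by
    have h := (hσ.integrable_mul (f := fun q => q.2 ^ 2) (by fun_prop) (C := 1) fun q => by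
      rw [abs_of_nonneg (sq_nonneg _), one_mul, euclLength_sq]
      nlinarith [sq_nonneg q.1])
    rw [Measure.volume_eq_prod] at h
    refine h.integral_prod_right.congr (.of_forall fun y => ?_)
    simp only [integral_const_mul, radialMarginal]

/-- A shift by `V e₂` makes the density radial and replaces `-(v | n)` by `V n₂ - (w | n)`. A
rotation turns `(w | n)` into the second coordinate, and Fubini leaves the marginal. -/
lemma integral_max_sq (hσ : ClassA2 σ) (V : ℝ) {n : ℝ × ℝ} (hn : n.1 ^ 2 + n.2 ^ 2 = 1) :
    2 * ∫ v : ℝ × ℝ, (max (-(v.1 * n.1 + v.2 * n.2)) 0) ^ 2 * fluxDensity σ V v =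
      fluxPotential (radialMarginal σ) (V * n.2) := by
  have h1 : ∫ v : ℝ × ℝ, (max (-(v.1 * n.1 + v.2 * n.2)) 0) ^ 2 * fluxDensity σ V v =
      ∫ w : ℝ × ℝ, (max (V * n.2 - (w.1 * n.1 + w.2 * n.2)) 0) ^ 2 * σ (euclLength w) := by
    rw [← integral_add_right_eq_self (fun w : ℝ × ℝ =>
      (max (V * n.2 - (w.1 * n.1 + w.2 * n.2)) 0) ^ 2 * σ (euclLength w)) ((0, V) : ℝ × ℝ)]
    congr 1 with v
    simp only [fluxDensity, Prod.fst_add, Prod.snd_add, add_zero]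
    congr 4
    ring
  have hnorm : ‖(⟨n.2, -n.1⟩ : ℂ)‖ = 1 := by
    rw [Complex.norm_eq_sqrt_sq_add_sq, Real.sqrt_eq_one]
    simp only
    linarith
  -- Multiplication by `n₂ - i n₁` carries `i` to `n₁ + i n₂`, that is, `e₂` to `n`.
  obtain ⟨a, ha⟩ : ∃ a : Circle, (a : ℂ) = ⟨n.2, -n.1⟩ :=
    ⟨⟨⟨n.2, -n.1⟩, mem_sphere_zero_iff_norm.2 hnorm⟩, rfl⟩
  have h2 : ∫ w : ℝ × ℝ, (max (V * n.2 - (w.1 * n.1 + w.2 * n.2)) 0) ^ 2 * σ (euclLength w) =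
      ∫ w : ℝ × ℝ, (max (V * n.2 - w.2) 0) ^ 2 * σ (euclLength w) := by
    rw [← Complex.volume_preserving_equiv_real_prod.integral_comp',
      ← Complex.volume_preserving_equiv_real_prod.integral_comp',
      ← (rotation a).measurePreserving.integral_comp
        (rotation a).toHomeomorph.measurableEmbedding]
    congr 1 with z
    rw [euclLength_equiv, euclLength_equiv, LinearIsometryEquiv.norm_map, rotation_apply, ha]
    simp only [Complex.measurableEquivRealProd_apply, Complex.mul_re, Complex.mul_im]
    congr 4
    linear_combination z.im * hn
  rw [h1, h2, fluxPotential, Measure.volume_eq_prod, integral_prod_symm]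
  · simp only [integral_const_mul, radialMarginal]
  · rw [← Measure.volume_eq_prod]
    refine hσ.integrable_mul (by fun_prop) (C := 2 * (V * n.2) ^ 2 + 2) fun q => ?_
    rw [abs_of_nonneg (sq_nonneg _), euclLength_sq]
    rcases le_total (V * n.2 - q.2) 0 with h | h
    · rw [max_eq_right h, zero_pow two_ne_zero]; positivity
    · rw [max_eq_left h]
      nlinarith [sq_nonneg (V * n.2 + q.2), sq_nonneg (V * n.2 * q.1), sq_nonneg (V * n.2 * q.2),
        sq_nonneg q.1, sq_nonneg q.2, sq_nonneg (V * n.2)]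

end ClassA2

/-! ### The pressure as a function of the slope -/

/-- The vertical component of the unit normal of a line of slope `u`. -/
def cosSlope (u : ℝ) : ℝ := 1 / Real.sqrt (u ^ 2 + 1)

lemma cosSlope_pos (u : ℝ) : 0 < cosSlope u := by unfold cosSlope; positivity

lemma cosSlope_sq (u : ℝ) : cosSlope u ^ 2 * (u ^ 2 + 1) = 1 := by
  rw [cosSlope, div_pow, Real.sq_sqrt (by positivity)]
  field_simp

lemma cosSlope_zero : cosSlope 0 = 1 := by simp [cosSlope]

lemma cosSlope_le_one (u : ℝ) : cosSlope u ≤ 1 := by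
  nlinarith [cosSlope_sq u, cosSlope_pos u, sq_nonneg (cosSlope u * u)]

lemma cosSlope_neg (u : ℝ) : cosSlope (-u) = cosSlope u := by simp [cosSlope]

lemma cosSlope_lt {u v : ℝ} (hu : 0 ≤ u) (huv : u < v) : cosSlope v < cosSlope u := by
  have h1 := cosSlope_sq u
  have h2 := cosSlope_sq v
  have h3 : u ^ 2 < v ^ 2 := pow_lt_pow_left₀ huv hu two_ne_zero
  refine lt_of_pow_lt_pow_left₀ 2 (cosSlope_pos u).le ?_
  have h4 := pow_pos (cosSlope_pos v) 2
  nlinarith [pow_pos (cosSlope_pos u) 2, sq_nonneg u]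

lemma sqrt_mul_cosSlope (s : ℝ) : Real.sqrt (1 + s ^ 2) * cosSlope s = 1 := by
  rw [cosSlope, add_comm, mul_one_div, div_self]
  positivity

lemma hasDerivAt_cosSlope (u : ℝ) : HasDerivAt cosSlope (-(u * cosSlope u ^ 3)) u := by
  have h0 : 0 < u ^ 2 + 1 := by positivity
  have h1 : HasDerivAt (fun u : ℝ => u ^ 2 + 1) (2 * u) u := by
    simpa using (hasDerivAt_pow 2 u).add_const 1
  have h2 := (h1.sqrt h0.ne').fun_inv (Real.sqrt_pos.2 h0).ne'
  have e : cosSlope = fun u => (Real.sqrt (u ^ 2 + 1))⁻¹ := by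
    ext u; rw [cosSlope, one_div]
  rw [e]
  refine h2.congr_deriv ?_
  have h3 := (Real.sqrt_pos.2 h0).ne'
  field_simp

lemma cosSlope_le_inv {u : ℝ} (hu : 0 < u) : cosSlope u ≤ 1 / u := by
  rw [le_div_iff₀ hu]
  nlinarith [cosSlope_sq u, cosSlope_pos u, sq_nonneg (cosSlope u * u - 1)]

lemma tendsto_cosSlope : Tendsto cosSlope atTop (𝓝 0) := by
  refine squeeze_zero' (.of_forall fun u => (cosSlope_pos u).le) ?_ tendsto_inv_atTop_zero
  filter_upwards [eventually_gt_atTop 0] with u hu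
  simpa using cosSlope_le_inv hu

/-! ### The two pressure functions for an arbitrary marginal -/

namespace IsMarginal

variable {m : ℝ → ℝ} {V : ℝ}

lemma hasDerivAt_plus (hm : IsMarginal m) (V u : ℝ) :
    HasDerivAt (fun u => fluxPotential m (V * cosSlope u))
      (-(V * u * cosSlope u ^ 3 * fluxSlope m (V * cosSlope u))) u := by
  have := (hm.hasDerivAt_fluxPotential (V * cosSlope u)).comp u
    ((hasDerivAt_cosSlope u).const_mul V)
  refine this.congr_deriv ?_
  ring

lemma hasDerivAt_minus (hm : IsMarginal m) (V u : ℝ) :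
    HasDerivAt (fun u => -fluxPotential m (-(V * cosSlope u)))
      (-(V * u * cosSlope u ^ 3 * fluxSlope m (-(V * cosSlope u)))) u := by
  have := ((hm.hasDerivAt_fluxPotential (-(V * cosSlope u))).comp u
    ((hasDerivAt_cosSlope u).const_mul V).fun_neg).fun_neg
  refine this.congr_deriv ?_
  ring

/-- The second derivative of the pressure on the upper side, up to a positive factor. -/
lemma hasDerivAt_deriv_plus (hm : IsMarginal m) (V u : ℝ) :
    HasDerivAt (fun u => -(V * u * cosSlope u ^ 3 * fluxSlope m (V * cosSlope u)))
      (V * cosSlope u ^ 3 * ((2 - 3 * cosSlope u ^ 2) * fluxSlope m (V * cosSlope u) +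
        V * cosSlope u * (1 - cosSlope u ^ 2) * fluxMass m (V * cosSlope u))) u := by
  have h1 := (hm.hasDerivAt_fluxSlope (V * cosSlope u)).comp u
    ((hasDerivAt_cosSlope u).const_mul V)
  have h2 := ((((hasDerivAt_id u).const_mul V).mul ((hasDerivAt_cosSlope u).pow 3)).mul h1).fun_neg
  refine h2.congr_deriv ?_
  simp only [Function.comp, id, Pi.mul_apply, Pi.pow_apply]
  have e := cosSlope_sq u
  push_cast
  linear_combination (3 * V * cosSlope u ^ 3 * fluxSlope m (V * cosSlope u) +
    V ^ 2 * cosSlope u ^ 4 * fluxMass m (V * cosSlope u)) * e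

/-- The second derivative has the sign of `e`. It is negative at `0`, positive once `z² ≤ 2/3` (`z =
cosSlope u`), and strictly increasing while `z² ≥ 2/3`, so it changes sign once. -/
lemma exists_inflection (hm : IsMarginal m) (hV : 0 < V) : ∃ c : ℝ, 0 ≤ c ∧
    StrictAntiOn (fun u => -(V * u * cosSlope u ^ 3 * fluxSlope m (V * cosSlope u))) (Icc 0 c) ∧
    StrictMonoOn (fun u => -(V * u * cosSlope u ^ 3 * fluxSlope m (V * cosSlope u))) (Ici c) := by
  set e : ℝ → ℝ := fun u => (2 - 3 * cosSlope u ^ 2) * fluxSlope m (V * cosSlope u) +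
        V * cosSlope u * (1 - cosSlope u ^ 2) * fluxMass m (V * cosSlope u) with he
  have hz : ∀ u, 0 < u → cosSlope u < 1 := fun u hu => cosSlope_zero ▸ cosSlope_lt le_rfl hu
  have hpos : ∀ u, 0 < u → cosSlope u ^ 2 ≤ 2 / 3 → 0 < e u := fun u hu h => by
    have h1 := hm.fluxSlope_pos (V * cosSlope u)
    have h2 := hm.fluxMass_pos (V * cosSlope u)
    have h3 := cosSlope_pos u
    have h4 : 0 < 1 - cosSlope u ^ 2 := by nlinarith
    have h5 : 0 ≤ 2 - 3 * cosSlope u ^ 2 := by linarith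
    simp only [he]
    positivity
  -- As `z` decreases, `(3 z² - 2) Φ'(V z)` decreases, both factors being nonnegative at the smaller
  -- `z`. The other term is `z² (1 - z²)` times `fluxMass m (V z) / z`, up to the factor `V`; the
  -- first factor grows because `z² ≥ 1/2`, the second by `fluxMass_mul_le`.
  have hmono : ∀ u v, 0 ≤ u → u < v → 2 / 3 ≤ cosSlope v ^ 2 → e u < e v := fun u v hu huv hv => by
    have hzw := cosSlope_lt hu huv
    have hz0 := cosSlope_pos v
    have hw1 := cosSlope_le_one u
    simp only [he]
    set z := cosSlope v
    set w := cosSlope u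
    have hsq : z ^ 2 < w ^ 2 := pow_lt_pow_left₀ hzw hz0.le two_ne_zero
    have h1 := hm.fluxSlope_pos (V * z)
    have h2 : fluxSlope m (V * z) < fluxSlope m (V * w) :=
      hm.strictMono_fluxSlope (by nlinarith)
    have h3 : fluxMass m (V * w) * z ≤ fluxMass m (V * z) * w := by
      have := hm.fluxMass_mul_le (mul_pos hV hz0) (mul_le_mul_of_nonneg_left hzw.le hV.le)
      nlinarith
    have h4 : 0 ≤ 1 - w ^ 2 := by nlinarith
    have h5 : w ^ 2 * (1 - w ^ 2) ≤ z ^ 2 * (1 - z ^ 2) := by nlinarith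
    have h6 := hm.fluxMass_pos (V * z)
    have h7 : w * (1 - w ^ 2) * fluxMass m (V * w) ≤ z * (1 - z ^ 2) * fluxMass m (V * z) := by
      refine le_of_mul_le_mul_right ?_ hz0
      have a1 := mul_le_mul_of_nonneg_left h3 (mul_nonneg (hz0.le.trans hzw.le) h4)
      have a2 := mul_le_mul_of_nonneg_right h5 h6.le
      linarith
    have h8 : (3 * z ^ 2 - 2) * fluxSlope m (V * z) < (3 * w ^ 2 - 2) * fluxSlope m (V * w) := by
      nlinarith
    nlinarith
  have hsign : ∀ u v, 0 ≤ u → u < v → e v ≤ 0 → e u < 0 := fun u v hu huv hv => by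
    refine (hmono u v hu huv ?_).trans_le hv
    by_contra! h
    exact absurd (hpos v (hu.trans_lt huv) h.le) (not_lt.2 hv)
  -- By `hsign` this set contains everything between `0` and any of its points. Its supremum is the
  -- inflection point.
  set S : Set ℝ := {u | 0 ≤ u ∧ e u ≤ 0} with hS
  have h0S : (0 : ℝ) ∈ S := ⟨le_rfl, by
    have := hm.fluxSlope_pos V
    simp only [he, cosSlope_zero]
    norm_num; linarith⟩
  have hbdd : BddAbove S := ⟨1, fun u hu => by
    by_contra! h
    refine absurd (hpos u (by linarith) ?_) (not_lt.2 hu.2)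
    have := cosSlope_sq u
    nlinarith [sq_nonneg (cosSlope u)]⟩
  refine ⟨sSup S, le_csSup hbdd h0S, ?_, ?_⟩
  · refine strictAntiOn_of_deriv_neg (convex_Icc _ _)
      (fun u _ => (hm.hasDerivAt_deriv_plus V u).continuousAt.continuousWithinAt) fun u hu => ?_
    rw [interior_Icc] at hu
    rw [(hm.hasDerivAt_deriv_plus V u).deriv]
    obtain ⟨v, hv, huv⟩ := exists_lt_of_lt_csSup ⟨0, h0S⟩ hu.2
    have h1 := cosSlope_pos u
    exact mul_neg_of_pos_of_neg (by positivity) (hsign u v hu.1.le huv hv.2)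
  · refine strictMonoOn_of_deriv_pos (convex_Ici _)
      (fun u _ => (hm.hasDerivAt_deriv_plus V u).continuousAt.continuousWithinAt) fun u hu => ?_
    rw [interior_Ici] at hu
    rw [(hm.hasDerivAt_deriv_plus V u).deriv]
    have h1 := cosSlope_pos u
    refine mul_pos (by positivity) ?_
    by_contra! h
    exact absurd (le_csSup hbdd ⟨(le_csSup hbdd h0S).trans hu.le, h⟩) (not_le.2 hu)

lemma tendsto_deriv_plus (hm : IsMarginal m) (hV : 0 < V) :
    Tendsto (fun u => -(V * u * cosSlope u ^ 3 * fluxSlope m (V * cosSlope u))) atTop (𝓝 0) := by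
  have h := (tendsto_cosSlope.pow 2).const_mul (V * fluxSlope m V)
  rw [zero_pow two_ne_zero, mul_zero] at h
  rw [← neg_zero]
  refine (squeeze_zero' ?_ ?_ h).neg
  · filter_upwards [eventually_gt_atTop 0] with u hu
    have := cosSlope_pos u
    have := hm.fluxSlope_pos (V * cosSlope u)
    positivity
  · filter_upwards [eventually_gt_atTop 0] with u hu
    have h1 := cosSlope_pos u
    have h2 : u * cosSlope u ≤ 1 := by
      have := cosSlope_le_inv hu
      rw [le_div_iff₀ hu] at this
      linarith
    have h3 : fluxSlope m (V * cosSlope u) ≤ fluxSlope m V :=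
      hm.strictMono_fluxSlope.monotone (by nlinarith [cosSlope_le_one u])
    have h4 := hm.fluxSlope_pos (V * cosSlope u)
    calc V * u * cosSlope u ^ 3 * fluxSlope m (V * cosSlope u)
        = (V * cosSlope u ^ 2) * ((u * cosSlope u) * fluxSlope m (V * cosSlope u)) := by ring
      _ ≤ (V * cosSlope u ^ 2) * (1 * fluxSlope m V) := by gcongr
      _ = _ := by ring

/-- The pressure drop on the upper side exceeds that on the lower side. -/
lemma drop_lt (hm : IsMarginal m) (hV : 0 < V) {z : ℝ} (hz0 : 0 < z) (hz1 : z < 1) :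
    fluxPotential m (-(V * z)) - fluxPotential m (-V) < fluxPotential m V - fluxPotential m (V * z)
    := by
  have hd := hm.hasDerivAt_fluxPotential
  have hVz : 0 < V * z := by positivity
  have hVz1 : V * z < V := by nlinarith
  -- The intervals `[-V, -V z]` and `[V z, V]` have equal length, and `Φ'` is below `Φ' 0` on the
  -- first and above it on the second.
  have h1 := mvt_lt hd (a := -V) (b := -(V * z)) (s := fluxSlope m 0) (by linarith)
    fun u hu => hm.strictMono_fluxSlope (by linarith [hu.2])
  have h2 := lt_mvt hd (a := V * z) (b := V) (s := fluxSlope m 0) (by linarith)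
    fun u hu => hm.strictMono_fluxSlope (by linarith [hu.1])
  linarith

end IsMarginal

/-! ### From the planar pressure to the potential -/

namespace ClassA2

variable {σ : ℝ → ℝ} {V : ℝ}

lemma pressure_eq (hσ : ClassA2 σ) (V : ℝ) {n : ℝ × ℝ} (hn : n.1 ^ 2 + n.2 ^ 2 = 1) :
    pressure σ V n = (-fluxPotential (radialMarginal σ) (V * n.2)) • n := by
  rw [pressure, neg_mul, hσ.integral_max_sq V hn]

lemma euclLength_pressure (hσ : ClassA2 σ) (V : ℝ) {n : ℝ × ℝ} (hn : n.1 ^ 2 + n.2 ^ 2 = 1) :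
    euclLength (pressure σ V n) = fluxPotential (radialMarginal σ) (V * n.2) := by
  have h := hσ.isMarginal.fluxPotential_nonneg (V * n.2)
  rw [hσ.pressure_eq V hn, euclLength, Real.sqrt_eq_iff_mul_self_eq (by positivity) h]
  simp only [Prod.smul_fst, Prod.smul_snd, smul_eq_mul]
  linear_combination (fluxPotential (radialMarginal σ) (V * n.2)) ^ 2 * hn

lemma pPlus_eq (hσ : ClassA2 σ) (V : ℝ) :
    pPlus σ V = fun u => fluxPotential (radialMarginal σ) (V * cosSlope u) := by
  ext u
  have := cosSlope_sq u
  rw [pPlus, ← cosSlope, hσ.euclLength_pressure V (by simp; linarith)]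
  simp

lemma pMinus_eq (hσ : ClassA2 σ) (V : ℝ) :
    pMinus σ V = fun u => -fluxPotential (radialMarginal σ) (-(V * cosSlope u)) := by
  ext u
  have := cosSlope_sq u
  rw [pMinus, ← cosSlope, hσ.euclLength_pressure V (by simp; linarith)]
  simp

lemma upper_force (hσ : ClassA2 σ) (V s : ℝ) :
    Real.sqrt (1 + s ^ 2) * (pressure σ V (upperNormal s)).2 = -pPlus σ V s := by
  have := cosSlope_sq s
  rw [upperNormal, ← cosSlope, hσ.pressure_eq V (by simp; linarith), hσ.pPlus_eq]
  simp only [Prod.smul_snd, smul_eq_mul, mul_one]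
  linear_combination (-(fluxPotential (radialMarginal σ) (V * cosSlope s))) * sqrt_mul_cosSlope s

lemma lower_force (hσ : ClassA2 σ) (V s : ℝ) :
    Real.sqrt (1 + s ^ 2) * (pressure σ V (lowerNormal s)).2 = -pMinus σ V s := by
  have := cosSlope_sq s
  rw [lowerNormal, ← cosSlope, hσ.pressure_eq V (by simp; linarith), hσ.pMinus_eq]
  simp only [Prod.smul_snd, smul_eq_mul, mul_neg, mul_one]
  linear_combination (fluxPotential (radialMarginal σ) (-(V * cosSlope s))) * sqrt_mul_cosSlope s

end ClassA2

/-! ### The thresholds -/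

namespace ClassA2

variable {σ : ℝ → ℝ} {V : ℝ}

lemma hasDerivAt_pPlus (hσ : ClassA2 σ) (V u : ℝ) :
    HasDerivAt (pPlus σ V) (deriv (pPlus σ V) u) u := by
  have h := hσ.isMarginal.hasDerivAt_plus V u
  rw [← hσ.pPlus_eq V] at h
  exact h.differentiableAt.hasDerivAt

lemma hasDerivAt_pMinus (hσ : ClassA2 σ) (V u : ℝ) :
    HasDerivAt (pMinus σ V) (deriv (pMinus σ V) u) u := by
  have h := hσ.isMarginal.hasDerivAt_minus V u
  rw [← hσ.pMinus_eq V] at h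
  exact h.differentiableAt.hasDerivAt

lemma deriv_pPlus (hσ : ClassA2 σ) (V : ℝ) : deriv (pPlus σ V) = fun u =>
    -(V * u * cosSlope u ^ 3 * fluxSlope (radialMarginal σ) (V * cosSlope u)) := by
  ext u
  rw [hσ.pPlus_eq V, (hσ.isMarginal.hasDerivAt_plus V u).deriv]

lemma deriv_pMinus (hσ : ClassA2 σ) (V : ℝ) : deriv (pMinus σ V) = fun u =>
    -(V * u * cosSlope u ^ 3 * fluxSlope (radialMarginal σ) (-(V * cosSlope u))) := by
  ext u
  rw [hσ.pMinus_eq V, (hσ.isMarginal.hasDerivAt_minus V u).deriv]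

lemma differentiable_pPlus (hσ : ClassA2 σ) (V : ℝ) : Differentiable ℝ (pPlus σ V) :=
  fun u => (hσ.hasDerivAt_pPlus V u).differentiableAt

lemma differentiable_pMinus (hσ : ClassA2 σ) (V : ℝ) : Differentiable ℝ (pMinus σ V) :=
  fun u => (hσ.hasDerivAt_pMinus V u).differentiableAt

lemma pPlus_nonneg (σ : ℝ → ℝ) (V u : ℝ) : 0 ≤ pPlus σ V u := euclLength_nonneg _

lemma pPlus_neg (hσ : ClassA2 σ) (V u : ℝ) : pPlus σ V (-u) = pPlus σ V u := by
  rw [hσ.pPlus_eq]; simp [cosSlope_neg]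

lemma pMinus_neg (hσ : ClassA2 σ) (V u : ℝ) : pMinus σ V (-u) = pMinus σ V u := by
  rw [hσ.pMinus_eq]; simp [cosSlope_neg]

lemma pPlus_le (hσ : ClassA2 σ) (hV : 0 < V) (u : ℝ) : pPlus σ V u ≤ pPlus σ V 0 := by
  rw [hσ.pPlus_eq]
  refine hσ.isMarginal.strictMono_fluxPotential.monotone ?_
  rw [cosSlope_zero]
  nlinarith [cosSlope_le_one u]

lemma pMinus_nonpos (hσ : ClassA2 σ) (V u : ℝ) : pMinus σ V u ≤ 0 := by
  rw [hσ.pMinus_eq]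
  exact neg_nonpos.2 (hσ.isMarginal.fluxPotential_nonneg _)

lemma lt_pMinus (hσ : ClassA2 σ) (hV : 0 < V) (u : ℝ) :
    -fluxPotential (radialMarginal σ) 0 < pMinus σ V u := by
  rw [hσ.pMinus_eq]
  refine neg_lt_neg (hσ.isMarginal.strictMono_fluxPotential ?_)
  exact neg_neg_of_pos (mul_pos hV (cosSlope_pos u))

lemma tendsto_pMinus (hσ : ClassA2 σ) (V : ℝ) :
    Tendsto (pMinus σ V) atTop (𝓝 (-fluxPotential (radialMarginal σ) 0)) := by
  rw [hσ.pMinus_eq]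
  refine Tendsto.neg ?_
  have h1 : Tendsto (fun u => -(V * cosSlope u)) atTop (𝓝 0) := by
    simpa using (tendsto_cosSlope.const_mul V).neg
  exact (hσ.isMarginal.hasDerivAt_fluxPotential 0).continuousAt.tendsto.comp h1

lemma pPlus_drop (hσ : ClassA2 σ) (hV : 0 < V) {u : ℝ} (hu : 0 < u) :
    pPlus σ V u < pPlus σ V 0 := by
  rw [hσ.pPlus_eq]
  exact hσ.isMarginal.strictMono_fluxPotential (mul_lt_mul_of_pos_left (cosSlope_lt le_rfl hu) hV)

lemma pMinus_drop (hσ : ClassA2 σ) (hV : 0 < V) {u : ℝ} (hu : 0 < u) :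
    pMinus σ V u < pMinus σ V 0 := by
  rw [hσ.pMinus_eq]
  exact neg_lt_neg (hσ.isMarginal.strictMono_fluxPotential
    (neg_lt_neg (mul_lt_mul_of_pos_left (cosSlope_lt le_rfl hu) hV)))

lemma drop_lt (hσ : ClassA2 σ) (hV : 0 < V) {u : ℝ} (hu : 0 < u) :
    pMinus σ V 0 - pMinus σ V u < pPlus σ V 0 - pPlus σ V u := by
  have h1 : cosSlope u < 1 := cosSlope_zero ▸ cosSlope_lt le_rfl hu
  have := hσ.isMarginal.drop_lt hV (cosSlope_pos u) h1
  rw [hσ.pMinus_eq, hσ.pPlus_eq]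
  simp only [cosSlope_zero, mul_one]
  linarith

end ClassA2

/-- The defining relations of the thresholds together with their immediate consequences. -/
structure ThresholdFacts (σ : ℝ → ℝ) (V uP BP uM BM uS : ℝ) : Prop where
  isThresholds : IsThresholds σ V uP BP uM BM uS
  BM_lt : BM < BP
  plus_line : ∀ u, 0 ≤ u → pPlus σ V 0 + -BP * u ≤ pPlus σ V u
  plus_contact : ∀ u, 0 ≤ u → pPlus σ V u = pPlus σ V 0 + -BP * u → u = 0 ∨ u = uP
  plus_tangent : ∀ v u, uP < v → 0 ≤ u → u ≠ v →
    pPlus σ V v + deriv (pPlus σ V) v * (u - v) < pPlus σ V u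
  plus_mono : StrictMonoOn (deriv (pPlus σ V)) (Ici uP)
  plus_surj : ∀ s, -BP < s → s < 0 → ∃ v, uP < v ∧ deriv (pPlus σ V) v = s
  minus_line : ∀ u, 0 ≤ u → pMinus σ V 0 + -BM * u ≤ pMinus σ V u

/-- Both first chords come from `exists_first_chord`. The chord of `p₊` ends beyond the inflection
point, so from there on `p₊` coincides with its envelope. `u_*` is then the place where the
increasing slope of `p₊` reaches `-B₋`. -/
theorem exists_thresholdFacts {σ : ℝ → ℝ} {V : ℝ} (hσ : ClassA2 σ) (hV : 0 < V) :
    ∃ uP BP uM BM uS, ThresholdFacts σ V uP BP uM BM uS := by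
  have hdp := hσ.hasDerivAt_pPlus V
  have hdq := hσ.hasDerivAt_pMinus V
  have hpm : ∀ u, 0 ≤ u → 0 ≤ pPlus σ V u := fun u _ => ClassA2.pPlus_nonneg σ V u
  have hqm : ∀ u, 0 ≤ u → -fluxPotential (radialMarginal σ) 0 ≤ pMinus σ V u :=
    fun u _ => (hσ.lt_pMinus hV u).le
  obtain ⟨uP, BP, huP, hBP, hline, hcont, hstrict, hder⟩ := exists_first_chord hdp
    (by rw [hσ.deriv_pPlus]; simp) hpm (hσ.pPlus_drop hV one_pos)
  obtain ⟨uM, BM, huM, hBM, hline', hcont', hstrict', hder'⟩ := exists_first_chord hdq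
    (by rw [hσ.deriv_pMinus]; simp) hqm (hσ.pMinus_drop hV one_pos)
  obtain ⟨c, -, hanti, hmono⟩ := hσ.isMarginal.exists_inflection hV
  rw [← hσ.deriv_pPlus V] at hanti hmono
  have hcu : c ≤ uP := le_of_touching_chord hdp hanti huP hline hcont
  replace hmono := hmono.mono (Ici_subset_Ici.2 hcu)
  have htan : ∀ v u, uP < v → 0 ≤ u → u ≠ v →
      pPlus σ V v + deriv (pPlus σ V) v * (u - v) < pPlus σ V u := fun v u hv hu hne =>
    tangent_lt hdp hmono hder hline hcont hv hu hne
  -- The chord of `p₋` measures its drop at `uM`. The drop of `p₊` there is larger, yet at most `BP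
  -- * uM`.
  have hBB : BM < BP := by
    have h1 := hσ.drop_lt hV huM
    have h2 := hline uM huM.le
    nlinarith
  -- Beyond `uP` the derivative is continuous, starts at `-BP` and tends to `0`.
  have hsurj : ∀ s, -BP < s → s < 0 → ∃ v, uP < v ∧ deriv (pPlus σ V) v = s := fun s hs hs0 => by
    have ht := hσ.isMarginal.tendsto_deriv_plus hV
    rw [← hσ.deriv_pPlus V] at ht
    obtain ⟨M, hM, hMu⟩ := ((ht.eventually (lt_mem_nhds hs0)).and (eventually_gt_atTop uP)).exists
    have hc : Continuous (deriv (pPlus σ V)) := continuous_iff_continuousAt.2 fun u => by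
      rw [hσ.deriv_pPlus V]
      exact (hσ.isMarginal.hasDerivAt_deriv_plus V u).continuousAt
    obtain ⟨v, hv, hvs⟩ := intermediate_value_Ioo hMu.le hc.continuousOn
      (show s ∈ Ioo _ _ from ⟨hder.trans_lt hs, hM⟩)
    exact ⟨v, hv.1, hvs⟩
  obtain ⟨uS, huS, hdS⟩ := hsurj (-BM) (by linarith) (by linarith)
  have hleft : ∀ u : ℝ, 0 ≤ u → u ≤ uP →
      convexEnvelope (pPlus σ V) u = pPlus σ V 0 + -BP * u := fun u h1 h2 =>
    convexEnvelope_eq_line hpm le_rfl hline (by simp) hcont ⟨h1, h2⟩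
  have hright : ∀ u : ℝ, uP ≤ u → convexEnvelope (pPlus σ V) u = pPlus σ V u := fun u hu => by
    rcases hu.eq_or_lt with rfl | hu
    · exact convexEnvelope_eq_of_contact hpm huP.le hline hcont
    · refine convexEnvelope_eq_of_contact (A := pPlus σ V u - deriv (pPlus σ V) u * u)
        (s := deriv (pPlus σ V) u) hpm (huP.trans hu).le (fun w hw => ?_) (by ring)
      rcases eq_or_ne w u with rfl | hne
      · linarith
      · linarith [htan u w hu hw hne]
  have hleft' : ∀ u : ℝ, 0 ≤ u → u ≤ uM →
      convexEnvelope (pMinus σ V) u = pMinus σ V 0 + -BM * u := fun u h1 h2 =>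
    convexEnvelope_eq_line hqm le_rfl hline' (by simp) hcont' ⟨h1, h2⟩
  refine ⟨uP, BP, uM, BM, uS, ⟨huP, hBP, ?_, hder ▸ hdp uP, ?_, hright, ?_, ⟨le_rfl, huM, ?_, ?_, ?_⟩,
    hBM, ?_, by linarith, huS, hdS ▸ hdp uS, ?_⟩, hBB, hline, ?_, htan, hmono, hsurj, hline'⟩
  · rw [hcont]; field_simp; ring
  · exact fun u h1 h2 => by rw [hleft u h1 h2]; ring
  · ext u
    refine ⟨fun ⟨h1, h2⟩ => ⟨lt_of_le_of_ne h1 ?_, ?_⟩, fun h => ⟨h.1.le, ?_⟩⟩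
    · rintro rfl
      rw [hleft 0 le_rfl huP.le] at h2
      simp at h2
    · by_contra! h
      exact h2.ne (hright u h)
    · rw [hleft u h.1.le h.2.le]
      exact hstrict u h.1 h.2
  · exact fun u hu => ⟨hu.1.le, by rw [hleft' u hu.1.le hu.2.le]; exact hstrict' u hu.1 hu.2⟩
  · rintro ⟨-, h2⟩
    rw [hleft' 0 le_rfl huM.le] at h2
    simp at h2
  · rintro ⟨-, h2⟩
    rw [hleft' uM huM.le le_rfl, hcont'] at h2
    exact lt_irrefl _ h2
  · have h1 : HasDerivAt (fun u => pMinus σ V 0 + -BM * u) (-BM) 0 := by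
      simpa using ((hasDerivAt_id (0 : ℝ)).const_mul (-BM)).const_add (pMinus σ V 0)
    refine h1.hasDerivWithinAt.congr_of_eventuallyEq ?_ (hleft' 0 le_rfl huM.le)
    filter_upwards [self_mem_nhdsWithin, mem_nhdsWithin_of_mem_nhds (gt_mem_nhds huM)] with u h2 h3
    exact hleft' u h2 h3.le
  · intro u hu hd
    exact hmono.injOn hu.le huS.le (by rw [hd.deriv, hdS])
  · intro u hu he
    by_contra! hne
    rcases lt_or_gt_of_ne hne.2 with h | h
    · exact (hstrict u (lt_of_le_of_ne hu hne.1.symm) h).ne' he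
    · exact (lt_after_chord hdp hmono hder hcont h).ne' he

/-! ### Even convex functions on `[-1, 1]` -/

/-- Even convex functions on `[-1, 1]` that are continuous up to the boundary. -/
structure IsProfile (f : ℝ → ℝ) : Prop where
  convexOn : ConvexOn ℝ (Icc (-1) 1) f
  even : ∀ x ∈ Icc (-1 : ℝ) 1, f (-x) = f x
  continuousOn : ContinuousOn f (Icc 0 1)

namespace IsProfile

variable {f p : ℝ → ℝ}

/-- For `0 ≤ x ≤ y` the point `x` lies between `-y` and `y`, where the function has equal values. -/
lemma monotoneOn_of_even (hf : ConvexOn ℝ (Icc (-1) 1) f)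
    (he : ∀ x ∈ Icc (-1 : ℝ) 1, f (-x) = f x) : MonotoneOn f (Icc 0 1) := by
  intro x hx y hy hxy
  have hy1 : y ∈ Icc (-1 : ℝ) 1 := ⟨by linarith [hy.1], hy.2⟩
  have h := hf.le_max_of_mem_segment (x := -y) (y := y) (z := x)
    ⟨by linarith [hy.2], by linarith [hy.1]⟩ hy1 (by
      rw [segment_eq_Icc (by linarith [hy.1])]
      exact ⟨by linarith [hx.1, hy.1], hxy⟩)
  rwa [he y hy1, max_self] at h

lemma monotoneOn (hf : IsProfile f) : MonotoneOn f (Icc 0 1) :=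
  monotoneOn_of_even hf.convexOn hf.even

lemma ae_hasDerivAt (hf : IsProfile f) :
    ∀ᵐ t ∂(volume.restrict (Ioo (0 : ℝ) 1)), HasDerivAt f (deriv f t) t := by
  have h := (hf.monotoneOn.mono Ioo_subset_Icc_self).ae_differentiableWithinAt measurableSet_Ioo
  filter_upwards [h, ae_restrict_mem measurableSet_Ioo] with t h1 h2
  exact (h1.differentiableAt (Ioo_mem_nhds h2.1 h2.2)).hasDerivAt

lemma deriv_nonneg (hf : IsProfile f) {t : ℝ} (ht : t ∈ Ioo (0 : ℝ) 1) : 0 ≤ deriv f t := by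
  rw [← derivWithin_of_mem_nhds (Icc_mem_nhds ht.1 ht.2)]
  exact hf.monotoneOn.derivWithin_nonneg

lemma deriv_mono (hf : IsProfile f) {s t a b : ℝ} (hs : s ∈ Icc (0 : ℝ) 1) (ht : t ∈ Icc (0 : ℝ) 1)
    (hst : s < t) (hds : HasDerivAt f a s) (hdt : HasDerivAt f b t) : a ≤ b := by
  have h1 : s ∈ Icc (-1 : ℝ) 1 := ⟨by linarith [hs.1], hs.2⟩
  have h2 : t ∈ Icc (-1 : ℝ) 1 := ⟨by linarith [ht.1], ht.2⟩
  exact (hf.convexOn.le_slope_of_hasDerivAt h1 h2 hst hds).trans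
    (hf.convexOn.slope_le_of_hasDerivAt h1 h2 hst hdt)

lemma hasDerivWithinAt_right (hf : IsProfile f) {t : ℝ} (ht : t ∈ Ioo (0 : ℝ) 1) :
    HasDerivWithinAt f (derivWithin f (Ioi t) t) (Ioi t) t :=
  hf.convexOn.hasDerivWithinAt_rightDeriv_of_mem_interior (by
    rw [interior_Icc]; exact ⟨by linarith [ht.1], ht.2⟩)

lemma ae_rightDeriv (hf : IsProfile f) :
    (fun t => derivWithin f (Ioi t) t) =ᵐ[volume.restrict (Ioo (0 : ℝ) 1)] deriv f := by
  filter_upwards [hf.ae_hasDerivAt] with t ht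
  exact ht.hasDerivWithinAt.derivWithin (uniqueDiffWithinAt_Ioi t)

lemma integrableOn_rightDeriv (hf : IsProfile f) :
    IntegrableOn (fun t => derivWithin f (Ioi t) t) (Ioo 0 1) := by
  rw [← integrableOn_Ioc_iff_integrableOn_Ioo]
  refine intervalIntegral.integrableOn_deriv_right_of_nonneg hf.continuousOn
    (fun x hx => hf.hasDerivWithinAt_right hx) fun x hx => ?_
  rw [← derivWithin_inter (Iio_mem_nhds hx.2)]
  refine MonotoneOn.derivWithin_nonneg (hf.monotoneOn.mono fun y hy => ?_)
  exact ⟨hx.1.le.trans (le_of_lt hy.1), le_of_lt hy.2⟩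

lemma integrableOn_deriv (hf : IsProfile f) : IntegrableOn (deriv f) (Ioo 0 1) :=
  hf.integrableOn_rightDeriv.congr hf.ae_rightDeriv

/-- A convex function has a right derivative at every interior point, and this suffices for the
fundamental theorem. Continuity up to `1` ensures that no part of the rise is lost at the end. -/
lemma integral_deriv (hf : IsProfile f) {a b : ℝ} (ha : 0 ≤ a) (hab : a ≤ b) (hb : b ≤ 1) :
    ∫ t in Ioo a b, deriv f t = f b - f a := by
  have hsub : Ioo a b ⊆ Ioo 0 1 := Ioo_subset_Ioo ha hb
  rw [← integral_congr_ae (ae_restrict_of_ae_restrict_of_subset hsub hf.ae_rightDeriv),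
    ← integral_Ioc_eq_integral_Ioo, ← intervalIntegral.integral_of_le hab]
  refine intervalIntegral.integral_eq_sub_of_hasDeriv_right_of_le hab
    (hf.continuousOn.mono (Icc_subset_Icc ha hb))
    (fun x hx => hf.hasDerivWithinAt_right (hsub hx)) ?_
  rw [intervalIntegrable_iff_integrableOn_Ioc_of_le hab, integrableOn_Ioc_iff_integrableOn_Ioo]
  exact hf.integrableOn_rightDeriv.mono_set hsub

lemma integrableOn_comp_deriv (f : ℝ → ℝ) {C : ℝ} (hp : Continuous p) (hb : ∀ u, |p u| ≤ C)
    {s : Set ℝ} (hs : volume s ≠ ⊤) : IntegrableOn (fun t => p (deriv f t)) s := by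
  refine Measure.integrableOn_of_bounded (M := C) hs
    (hp.measurable.comp (measurable_deriv f)).aestronglyMeasurable (.of_forall fun t => ?_)
  exact hb _

/-- The integral of a function of the slope that is bounded below by a line. -/
lemma calibration (hf : IsProfile f) {A s C : ℝ} (hp : Continuous p) (hb : ∀ u, |p u| ≤ C)
    (hl : ∀ u, 0 ≤ u → A + s * u ≤ p u) :
    A + s * (f 1 - f 0) ≤ ∫ t in Ioo (0 : ℝ) 1, p (deriv f t) ∧
    (∫ t in Ioo (0 : ℝ) 1, p (deriv f t) = A + s * (f 1 - f 0) ↔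
      ∀ᵐ t ∂(volume.restrict (Ioo (0 : ℝ) 1)), p (deriv f t) = A + s * deriv f t) := by
  have hi1 : IntegrableOn (fun t => p (deriv f t)) (Ioo 0 1) :=
    integrableOn_comp_deriv f hp hb (by simp)
  have hi2 : IntegrableOn (fun t => A + s * deriv f t) (Ioo 0 1) :=
    (integrableOn_const (by simp)).add (hf.integrableOn_deriv.const_mul s)
  have e2 : ∫ t in Ioo (0 : ℝ) 1, (A + s * deriv f t) = A + s * (f 1 - f 0) := by
    rw [integral_add (integrable_const A) (hf.integrableOn_deriv.const_mul s),
      integral_const_mul, hf.integral_deriv le_rfl zero_le_one le_rfl]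
    simp
  have hnn : 0 ≤ᵐ[volume.restrict (Ioo (0 : ℝ) 1)]
      fun t => p (deriv f t) - (A + s * deriv f t) := by
    filter_upwards [ae_restrict_mem measurableSet_Ioo] with t ht
    exact sub_nonneg.2 (hl _ (hf.deriv_nonneg ht))
  have e3 := integral_sub hi1 hi2
  rw [e2] at e3
  constructor
  · have := integral_nonneg_of_ae hnn
    rw [e3] at this
    linarith
  · rw [← sub_eq_zero, ← e3, integral_eq_zero_iff_of_nonneg_ae hnn (hi1.sub hi2)]
    refine ⟨fun h => ?_, fun h => ?_⟩ <;> filter_upwards [h] with t ht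
    · exact sub_eq_zero.1 ht
    · exact sub_eq_zero.2 ht

lemma le_sub_of_ae_le (hf : IsProfile f) {a x y : ℝ} (hx : 0 ≤ x) (hxy : x ≤ y) (hy : y ≤ 1)
    (h : ∀ᵐ t ∂(volume.restrict (Ioo x y)), a ≤ deriv f t) : a * (y - x) ≤ f y - f x := by
  have := integral_mono_ae (integrable_const a)
    (hf.integrableOn_deriv.mono_set (Ioo_subset_Ioo hx hy)) h
  rw [hf.integral_deriv hx hxy hy] at this
  simpa [hxy, mul_comm] using this

lemma sub_le_of_ae_le (hf : IsProfile f) {a x y : ℝ} (hx : 0 ≤ x) (hxy : x ≤ y) (hy : y ≤ 1)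
    (h : ∀ᵐ t ∂(volume.restrict (Ioo x y)), deriv f t ≤ a) : f y - f x ≤ a * (y - x) := by
  have := integral_mono_ae (hf.integrableOn_deriv.mono_set (Ioo_subset_Ioo hx hy))
    (integrable_const a) h
  rw [hf.integral_deriv hx hxy hy] at this
  simpa [hxy, mul_comm] using this

/-- A convex function with at most two slopes is determined by its values at the ends. -/
lemma eq_of_two_slopes (hf : IsProfile f) {a b : ℝ} (hab : a ≤ b)
    (h : ∀ᵐ t ∂(volume.restrict (Ioo (0 : ℝ) 1)), deriv f t = a ∨ deriv f t = b) :
    ∀ x ∈ Icc (0 : ℝ) 1, f x = f 0 + max (a * x) (f 1 - f 0 - b * (1 - x)) := by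
  -- Both sides are continuous, so it is enough to compare them at points of differentiability with
  -- an admissible slope.
  refine Measure.eqOn_Icc_of_ae_eq volume zero_ne_one ?_ hf.continuousOn (by fun_prop)
  rw [← restrict_Ioo_eq_restrict_Icc]
  have hle := ae_restrict_mem (μ := volume) (measurableSet_Ioo (a := (0 : ℝ)) (b := 1))
  filter_upwards [h, hf.ae_hasDerivAt, hle] with x hx hdx hx01
  have hl : a * (x - 0) ≤ f x - f 0 := hf.le_sub_of_ae_le le_rfl hx01.1.le hx01.2.le (by
    filter_upwards [ae_restrict_of_ae_restrict_of_subset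
      (Ioo_subset_Ioo_right hx01.2.le) h] with t ht
    rcases ht with ht | ht <;> rw [ht]
    exact hab)
  have hr : f 1 - f x ≤ b * (1 - x) := hf.sub_le_of_ae_le hx01.1.le hx01.2.le le_rfl (by
    filter_upwards [ae_restrict_of_ae_restrict_of_subset
      (Ioo_subset_Ioo_left hx01.1.le) h] with t ht
    rcases ht with ht | ht <;> rw [ht]
    exact hab)
  rcases hx with hx | hx <;> rw [hx] at hdx
  -- Slopes increase, so slope `a` at `x` forces slope `a` all the way down to `0`. In the other
  -- case slope `b` persists up to `1`.
  · have hu : f x - f 0 ≤ a * (x - 0) := hf.sub_le_of_ae_le le_rfl hx01.1.le hx01.2.le (by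
      filter_upwards [ae_restrict_of_ae_restrict_of_subset
        (Ioo_subset_Ioo_right hx01.2.le) hf.ae_hasDerivAt, ae_restrict_mem measurableSet_Ioo]
        with t ht ht2
      exact hf.deriv_mono ⟨ht2.1.le, (ht2.2.trans hx01.2).le⟩ (Ioo_subset_Icc_self hx01) ht2.2
        ht hdx)
    rw [max_eq_left] <;> linarith
  · have hu : b * (1 - x) ≤ f 1 - f x := hf.le_sub_of_ae_le hx01.1.le hx01.2.le le_rfl (by
      filter_upwards [ae_restrict_of_ae_restrict_of_subset
        (Ioo_subset_Ioo_left hx01.1.le) hf.ae_hasDerivAt, ae_restrict_mem measurableSet_Ioo]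
        with t ht ht2
      exact hf.deriv_mono (Ioo_subset_Icc_self hx01) ⟨(hx01.1.trans ht2.1).le, ht2.2.le⟩ ht2.1
        hdx ht)
    rw [max_eq_right] <;> linarith

/-- The integral of an even function of the slope of an even function. -/
lemma integral_even (he : ∀ x ∈ Icc (-1 : ℝ) 1, f (-x) = f x) {C : ℝ} (hp : Continuous p)
    (hb : ∀ u, |p u| ≤ C) (hpe : ∀ u, p (-u) = p u) :
    ∫ x in (-1 : ℝ)..1, p (deriv f x) = 2 * ∫ t in Ioo (0 : ℝ) 1, p (deriv f t) := by
  have hi : ∀ a b : ℝ, IntervalIntegrable (fun t => p (deriv f t)) volume a b := fun a b => by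
    rw [intervalIntegrable_iff]
    exact integrableOn_comp_deriv f hp hb (by simp [uIoc])
  have h1 : ∫ x in (-1 : ℝ)..0, p (deriv f x) = ∫ x in (0 : ℝ)..1, p (deriv f x) := by
    have h2 := intervalIntegral.integral_comp_neg (a := 0) (b := 1) fun x => p (deriv f x)
    rw [neg_zero] at h2
    rw [← h2]
    refine intervalIntegral.integral_congr_uIoo fun x hx => ?_
    rw [uIoo_of_le zero_le_one] at hx
    -- Evenness is known only on `[-1, 1]`; local equality is enough for derivatives.
    have h3 : (fun x => f (-x)) =ᶠ[𝓝 x] f := by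
      filter_upwards [Ioo_mem_nhds hx.1 hx.2] with y hy
      exact he y ⟨by linarith [hy.1], hy.2.le⟩
    have h4 := deriv_comp_neg f x
    rw [h3.deriv_eq] at h4
    simp only [h4, hpe]
  rw [← intervalIntegral.integral_add_adjacent_intervals (hi (-1) 0) (hi 0 1), h1,
    intervalIntegral.integral_of_le zero_le_one, integral_Ioc_eq_integral_Ioo]
  ring

end IsProfile

/-! ### Bodies and their boundary functions -/

/-- The mirror image of a plane set with respect to the first coordinate axis. -/
def mirror (K : Set (ℝ × ℝ)) : Set (ℝ × ℝ) := {q | (q.1, -q.2) ∈ K}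

lemma lowerBoundary_mirror (K : Set (ℝ × ℝ)) (x : ℝ) :
    lowerBoundary (mirror K) x = -upperBoundary K x := by
  rw [lowerBoundary, upperBoundary, ← Real.sInf_neg]
  rfl

namespace IsBody

variable {h : ℝ} {K : Set (ℝ × ℝ)}

lemma mirror (hK : IsBody h K) : IsBody h (mirror K) where
  convex := hK.convex.linear_preimage
    ((LinearMap.fst ℝ ℝ ℝ).prod (-LinearMap.snd ℝ ℝ ℝ))
  isCompact := by
    have : _root_.mirror K = (fun q : ℝ × ℝ => (q.1, -q.2)) '' K := by
      ext ⟨x, y⟩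
      simp only [_root_.mirror, mem_image, Prod.exists, Prod.mk.injEq]
      refine ⟨fun hq => ⟨x, -y, hq, rfl, neg_neg y⟩, ?_⟩
      rintro ⟨a, b, hab, rfl, rfl⟩
      change (a, - -b) ∈ K
      rwa [neg_neg]
    rw [this]
    exact hK.isCompact.image (by fun_prop)
  symmetric x y hxy := hK.symmetric x (-y) hxy
  section_subset y := hK.section_subset (-y)
  exists_section := by
    obtain ⟨y, hy⟩ := hK.exists_section
    exact ⟨-y, by simpa [_root_.mirror] using hy⟩
  length_eq := by
    obtain ⟨a, ha⟩ := hK.length_eq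
    refine ⟨-(a + h), ?_⟩
    ext y
    have h1 : -y ∈ {y : ℝ | (0, y) ∈ K} ↔ -y ∈ Icc a (a + h) := by rw [ha]
    refine h1.trans ⟨fun h => ⟨?_, ?_⟩, fun h => ⟨?_, ?_⟩⟩ <;> linarith [h.1, h.2]

lemma isCompact_section (hK : IsBody h K) (x : ℝ) : IsCompact {y : ℝ | (x, y) ∈ K} :=
  (Topology.IsClosedEmbedding.of_continuous_injective_isClosedMap
    (f := fun y : ℝ => (x, y)) (by fun_prop) (fun a b hab => (Prod.mk.inj hab).2)
    (isClosedMap_prodMk_left x)).isCompact_preimage hK.isCompact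

lemma nonempty_section (hK : IsBody h K) {x : ℝ} (hx : x ∈ Icc (-1 : ℝ) 1) :
    {y : ℝ | (x, y) ∈ K}.Nonempty := by
  obtain ⟨y, hy⟩ := hK.exists_section
  have : x ∈ {x : ℝ | (x, y) ∈ K} := hy ▸ hx
  exact ⟨y, this⟩

lemma lower_mem (hK : IsBody h K) {x : ℝ} (hx : x ∈ Icc (-1 : ℝ) 1) :
    (x, lowerBoundary K x) ∈ K := (hK.isCompact_section x).sInf_mem (hK.nonempty_section hx)

lemma upper_mem (hK : IsBody h K) {x : ℝ} (hx : x ∈ Icc (-1 : ℝ) 1) :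
    (x, upperBoundary K x) ∈ K := (hK.isCompact_section x).sSup_mem (hK.nonempty_section hx)

lemma lower_le (hK : IsBody h K) {x y : ℝ} (hxy : (x, y) ∈ K) : lowerBoundary K x ≤ y :=
  csInf_le (hK.isCompact_section x).bddBelow hxy

lemma le_upper (hK : IsBody h K) {x y : ℝ} (hxy : (x, y) ∈ K) : y ≤ upperBoundary K x :=
  le_csSup (hK.isCompact_section x).bddAbove hxy

lemma mem_iff (hK : IsBody h K) {x y : ℝ} :
    (x, y) ∈ K ↔ x ∈ Icc (-1 : ℝ) 1 ∧ lowerBoundary K x ≤ y ∧ y ≤ upperBoundary K x := by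
  refine ⟨fun hxy => ⟨hK.section_subset y hxy, hK.lower_le hxy, hK.le_upper hxy⟩, ?_⟩
  rintro ⟨hx, h1, h2⟩
  have hc : Convex ℝ {y : ℝ | (x, y) ∈ K} := by
    intro a ha b hb s t hs ht hst
    have := hK.convex ha hb hs ht hst
    simp only [Prod.smul_mk, Prod.mk_add_mk, smul_eq_mul, ← add_mul, hst, one_mul] at this
    exact this
  exact hc.ordConnected.out (hK.lower_mem hx) (hK.upper_mem hx) ⟨h1, h2⟩

lemma even_lower (hK : IsBody h K) (x : ℝ) : lowerBoundary K (-x) = lowerBoundary K x := by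
  rw [lowerBoundary, lowerBoundary]
  congr 1
  ext y
  exact ⟨fun hy => by simpa using hK.symmetric _ _ hy, fun hy => hK.symmetric _ _ hy⟩

lemma convexOn_lower (hK : IsBody h K) : ConvexOn ℝ (Icc (-1) 1) (lowerBoundary K) := by
  refine ⟨convex_Icc _ _, fun x hx y hy a b ha hb hab => hK.lower_le ?_⟩
  have := hK.convex (hK.lower_mem hx) (hK.lower_mem hy) ha hb hab
  simpa using this

lemma isProfile_lower (hK : IsBody h K) : IsProfile (lowerBoundary K) := by
  have hmono := IsProfile.monotoneOn_of_even hK.convexOn_lower fun x _ => hK.even_lower x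
  refine ⟨hK.convexOn_lower, fun x _ => hK.even_lower x, fun x hx => ?_⟩
  rcases hx.2.lt_or_eq with h1 | rfl
  · have := hK.convexOn_lower.continuousOn_interior
    rw [interior_Icc] at this
    exact (this.continuousAt (Ioo_mem_nhds (by linarith [hx.1]) h1)).continuousWithinAt
  · refine tendsto_order.2 ⟨fun c hc => ?_, fun c hc => ?_⟩
    -- Lower semicontinuity at `1` comes from compactness: the points of `K` at height at most `c`
    -- have a closed projection, which misses `1`. The upper bound is monotonicity.
    · have hcl : IsClosed (Prod.fst '' (K ∩ {q : ℝ × ℝ | q.2 ≤ c})) :=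
        ((hK.isCompact.inter_right (isClosed_le continuous_snd continuous_const)).image
          continuous_fst).isClosed
      have h1 : (1 : ℝ) ∉ Prod.fst '' (K ∩ {q : ℝ × ℝ | q.2 ≤ c}) := by
        rintro ⟨⟨a, b⟩, ⟨hab, hb⟩, rfl⟩
        exact absurd (hK.lower_le hab) (not_le.2 (lt_of_le_of_lt hb hc))
      filter_upwards [mem_nhdsWithin_of_mem_nhds (hcl.isOpen_compl.mem_nhds h1),
        self_mem_nhdsWithin] with y hy hy1
      by_contra! hlt
      exact hy ⟨(y, lowerBoundary K y), ⟨hK.lower_mem ⟨by linarith [hy1.1], hy1.2⟩, hlt⟩, rfl⟩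
    · filter_upwards [self_mem_nhdsWithin] with y hy
      exact (hmono hy hx hy.2).trans_lt hc

lemma isProfile_upper (hK : IsBody h K) : IsProfile fun x => -upperBoundary K x := by
  have h1 := hK.mirror.isProfile_lower
  rwa [show lowerBoundary (_root_.mirror K) = _ from funext (lowerBoundary_mirror K)] at h1

lemma even_upper (hK : IsBody h K) (x : ℝ) : upperBoundary K (-x) = upperBoundary K x := by
  have := hK.mirror.even_lower x
  rw [lowerBoundary_mirror, lowerBoundary_mirror] at this
  linarith

lemma upper_sub_lower (hK : IsBody h K) : upperBoundary K 0 - lowerBoundary K 0 = h := by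
  obtain ⟨a, ha⟩ := hK.length_eq
  have hne : (Icc a (a + h)).Nonempty := ha ▸ hK.nonempty_section (x := 0) (by simp)
  have hle := nonempty_Icc.1 hne
  rw [upperBoundary, lowerBoundary, ha, csSup_Icc hle, csInf_Icc hle]
  ring

lemma lower_le_upper (hK : IsBody h K) {x : ℝ} (hx : x ∈ Icc (-1 : ℝ) 1) :
    lowerBoundary K x ≤ upperBoundary K x := hK.lower_le (hK.upper_mem hx)

variable {σ : ℝ → ℝ} {V : ℝ}

lemma resistance_eq (hK : IsBody h K) (hσ : ClassA2 σ) (hV : 0 < V) : resistance σ V K =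
    (∫ t in Ioo (0 : ℝ) 1, pPlus σ V (deriv (fun x => -upperBoundary K x) t)) +
      ∫ t in Ioo (0 : ℝ) 1, pMinus σ V (deriv (lowerBoundary K) t) := by
  have hb1 : ∀ u, |pPlus σ V u| ≤ pPlus σ V 0 := fun u => by
    rw [abs_of_nonneg (ClassA2.pPlus_nonneg σ V u)]; exact hσ.pPlus_le hV u
  have hb2 : ∀ u, |pMinus σ V u| ≤ fluxPotential (radialMarginal σ) 0 := fun u => by
    rw [abs_of_nonpos (hσ.pMinus_nonpos V u)]; linarith [hσ.lt_pMinus hV u]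
  rw [resistance]
  simp only [hσ.upper_force, hσ.lower_force, intervalIntegral.integral_neg]
  rw [IsProfile.integral_even (fun x _ => hK.even_upper x) (hσ.differentiable_pPlus V).continuous
      hb1 (hσ.pPlus_neg V),
    IsProfile.integral_even (fun x _ => hK.even_lower x) (hσ.differentiable_pMinus V).continuous
      hb2 (hσ.pMinus_neg V)]
  simp only [deriv.fun_neg, hσ.pPlus_neg]
  ring

end IsBody

/-- Both parts of the boundary have almost everywhere slopes at which the pressure functions touch
the lines `A + s u` and `B + s u`, and there are no vertical segments. -/
structure IsCalibrated (σ : ℝ → ℝ) (V A B s : ℝ) (K : Set (ℝ × ℝ)) : Prop where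
  closed : lowerBoundary K 1 = upperBoundary K 1
  upper : ∀ᵐ t ∂(volume.restrict (Ioo (0 : ℝ) 1)),
    pPlus σ V (deriv (fun x => -upperBoundary K x) t) =
      A + s * deriv (fun x => -upperBoundary K x) t
  lower : ∀ᵐ t ∂(volume.restrict (Ioo (0 : ℝ) 1)),
    pMinus σ V (deriv (lowerBoundary K) t) = B + s * deriv (lowerBoundary K) t

/-- Each boundary curve costs at least `A` or `B` plus `s` times its rise. The rises sum to `h`
minus the height of the vertical sides, and `s < 0` makes vertical sides wasteful. -/
theorem IsBody.resistance_calibration {σ : ℝ → ℝ} {V h A B s : ℝ} {K : Set (ℝ × ℝ)}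
    (hK : IsBody h K) (hσ : ClassA2 σ) (hV : 0 < V) (hs : s < 0)
    (hA : ∀ u, 0 ≤ u → A + s * u ≤ pPlus σ V u) (hB : ∀ u, 0 ≤ u → B + s * u ≤ pMinus σ V u) :
    A + B + s * h ≤ resistance σ V K ∧
      (resistance σ V K = A + B + s * h ↔ IsCalibrated σ V A B s K) := by
  have hb1 : ∀ u, |pPlus σ V u| ≤ pPlus σ V 0 := fun u => by
    rw [abs_of_nonneg (ClassA2.pPlus_nonneg σ V u)]; exact hσ.pPlus_le hV u
  have hb2 : ∀ u, |pMinus σ V u| ≤ fluxPotential (radialMarginal σ) 0 := fun u => by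
    rw [abs_of_nonpos (hσ.pMinus_nonpos V u)]; linarith [hσ.lt_pMinus hV u]
  obtain ⟨a1, a2⟩ := hK.isProfile_upper.calibration (hσ.differentiable_pPlus V).continuous hb1 hA
  obtain ⟨b1, b2⟩ := hK.isProfile_lower.calibration (hσ.differentiable_pMinus V).continuous hb2 hB
  have h1 := hK.lower_le_upper (x := 1) (by simp)
  have h2 := hK.upper_sub_lower
  have h3 : s * h ≤ s * (-upperBoundary K 1 - -upperBoundary K 0) +
      s * (lowerBoundary K 1 - lowerBoundary K 0) := by
    rw [← h2]
    nlinarith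
  rw [hK.resistance_eq hσ hV]
  refine ⟨by linarith, fun he => ⟨?_, a2.1 (by linarith), b2.1 (by linarith)⟩, fun hc => ?_⟩
  · have : s * h = s * (-upperBoundary K 1 - -upperBoundary K 0) +
      s * (lowerBoundary K 1 - lowerBoundary K 0) := by linarith
    rw [← h2] at this
    nlinarith
  · rw [a2.2 hc.upper, b2.2 hc.lower, hc.closed, ← h2]
    ring

/-- One body that attains the lower bound shows that optimal bodies are exactly those attaining it,
and equality has been characterised. -/
theorem optimal_of_calibrated {σ : ℝ → ℝ} {V h A B s : ℝ} {K₀ : Set (ℝ × ℝ)} (hσ : ClassA2 σ)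
    (hV : 0 < V) (hs : s < 0) (hA : ∀ u, 0 ≤ u → A + s * u ≤ pPlus σ V u)
    (hB : ∀ u, 0 ≤ u → B + s * u ≤ pMinus σ V u) (hK₀ : IsBody h K₀)
    (hc : IsCalibrated σ V A B s K₀) : IsMinResistance σ V h (A + B + s * h) ∧
      ∀ K, IsOptimal σ V h K ↔ IsBody h K ∧ IsCalibrated σ V A B s K := by
  have he := (hK₀.resistance_calibration hσ hV hs hA hB).2.2 hc
  refine ⟨⟨⟨K₀, hK₀, he.symm⟩, ?_⟩, fun K => ⟨fun hK => ⟨hK.1, ?_⟩, fun hK => ⟨hK.1, fun K' hK' => ?_⟩⟩⟩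
  · rintro _ ⟨K, hK, rfl⟩
    exact (hK.resistance_calibration hσ hV hs hA hB).1
  · have h1 := hK.1.resistance_calibration hσ hV hs hA hB
    exact h1.2.1 (le_antisymm (he ▸ hK.2 K₀ hK₀) h1.1)
  · rw [(hK.1.resistance_calibration hσ hV hs hA hB).2.2 hK.2]
    exact (hK'.resistance_calibration hσ hV hs hA hB).1

/-! ### Bodies bounded by polygonal profiles -/

/-- The function with slope `a` and then slope `b` on `[0, 1]` that increases from `0` to `H`. -/
def bentProfile (a b H t : ℝ) : ℝ := max (a * t) (H - b * (1 - t))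

/-- The body whose boundary, above and below the base, is given by polygonal profiles. -/
def bentBody (c a b H a' b' H' : ℝ) : Set (ℝ × ℝ) :=
  {q | |q.1| ≤ 1 ∧ c - H' + bentProfile a' b' H' |q.1| ≤ q.2 ∧
    q.2 ≤ c + H - bentProfile a b H |q.1|}

lemma mem_bentBody {c a b H a' b' H' : ℝ} {q : ℝ × ℝ} : q ∈ bentBody c a b H a' b' H' ↔
    |q.1| ≤ 1 ∧ (c - H' + a' * |q.1| ≤ q.2 ∧ c - b' * (1 - |q.1|) ≤ q.2) ∧
      q.2 ≤ c + H - a * |q.1| ∧ q.2 ≤ c + b * (1 - |q.1|) := by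
  change |q.1| ≤ 1 ∧ _ ≤ q.2 ∧ q.2 ≤ _ ↔ _
  rw [← le_sub_iff_add_le', le_sub_comm (a := q.2) (b := c + H), bentProfile, bentProfile, max_le_iff, max_le_iff]
  refine and_congr_right fun _ => and_congr (and_congr ?_ ?_) (and_congr ?_ ?_) <;>
  constructor <;> intro <;> linarith

lemma bentProfile_one {a b H : ℝ} (ha : a ≤ H) : bentProfile a b H 1 = H := by
  rw [bentProfile, max_eq_right] <;> linarith

lemma bentProfile_le {a b H t : ℝ} (h0 : 0 ≤ a) (ha : a ≤ H) (hb : H ≤ b) (ht1 : t ≤ 1) :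
    bentProfile a b H t ≤ H := max_le (by nlinarith) (by nlinarith)

/-- The inequalities `0 ≤ a ≤ H ≤ b` make the profile convex and increasing from `0` to `H`. All
figures of the theorem are bodies of this kind. -/
lemma isBody_bentBody (c : ℝ) {a b H a' b' H' : ℝ} (h0 : 0 ≤ a) (ha : a ≤ H) (hb : H ≤ b)
    (h0' : 0 ≤ a') (ha' : a' ≤ H') (hb' : H' ≤ b') :
    IsBody (H + H') (bentBody c a b H a' b' H') where
  convex := by
    intro p hp q hq s t hs ht hst
    rw [mem_bentBody] at *
    obtain ⟨p1, ⟨p2, p3⟩, p4, p5⟩ := hp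
    obtain ⟨q1, ⟨q2, q3⟩, q4, q5⟩ := hq
    have hx : |(s • p + t • q).1| ≤ s * |p.1| + t * |q.1| := by
      refine (abs_add_le _ _).trans (le_of_eq ?_)
      simp [abs_mul, abs_of_nonneg hs, abs_of_nonneg ht]
    have hy : (s • p + t • q).2 = s * p.2 + t * q.2 := rfl
    rw [hy]
    set X := |(s • p + t • q).1|
    have hbb : 0 ≤ b := by linarith
    have hbb' : 0 ≤ b' := by linarith
    have e1 := mul_le_mul_of_nonneg_left hx h0
    have e2 := mul_le_mul_of_nonneg_left hx h0'
    have e3 := mul_le_mul_of_nonneg_left hx hbb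
    have e4 := mul_le_mul_of_nonneg_left hx hbb'
    obtain rfl : t = 1 - s := by linarith
    refine ⟨?_, ⟨?_, ?_⟩, ?_, ?_⟩
    · nlinarith
    · linarith [mul_le_mul_of_nonneg_left p2 hs, mul_le_mul_of_nonneg_left q2 ht]
    · linarith [mul_le_mul_of_nonneg_left p3 hs, mul_le_mul_of_nonneg_left q3 ht]
    · linarith [mul_le_mul_of_nonneg_left p4 hs, mul_le_mul_of_nonneg_left q4 ht]
    · linarith [mul_le_mul_of_nonneg_left p5 hs, mul_le_mul_of_nonneg_left q5 ht]
  isCompact := by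
    refine (isCompact_Icc.prod isCompact_Icc : IsCompact (Icc (-1 : ℝ) 1 ×ˢ Icc (c - H') (c + H))
      ).of_isClosed_subset ?_ fun q hq => ?_
    · have e : bentBody c a b H a' b' H' = {q | |q.1| ≤ 1} ∩
          {q | c - H' + bentProfile a' b' H' |q.1| ≤ q.2} ∩
          {q | q.2 ≤ c + H - bentProfile a b H |q.1|} := by
        ext q; exact and_assoc.symm
      rw [e]
      unfold bentProfile
      exact ((isClosed_le (by fun_prop) (by fun_prop)).inter
        (isClosed_le (by fun_prop) (by fun_prop))).inter (isClosed_le (by fun_prop) (by fun_prop))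
    · rw [mem_bentBody] at hq
      obtain ⟨p1, ⟨p2, p3⟩, p4, p5⟩ := hq
      have := abs_nonneg q.1
      exact ⟨abs_le.1 p1, by nlinarith, by nlinarith⟩
  symmetric x y hxy := by
    rw [mem_bentBody] at *
    simpa only [abs_neg] using hxy
  section_subset y x hx := abs_le.1 (mem_bentBody.1 hx).1
  exists_section := by
    refine ⟨c, Subset.antisymm (fun x hx => abs_le.1 (mem_bentBody.1 hx).1) fun x hx => ?_⟩
    have h1 := abs_le.2 hx
    have h2 := abs_nonneg x
    refine mem_bentBody.2 ⟨h1, ⟨?_, ?_⟩, ?_, ?_⟩ <;> simp only <;> nlinarith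
  length_eq := by
    refine ⟨c - H', ?_⟩
    ext y
    have : ((0 : ℝ), y) ∈ bentBody c a b H a' b' H' ↔ _ := mem_bentBody
    refine this.trans ?_
    simp only [abs_zero, mul_zero, sub_zero, mul_one, add_zero, mem_Icc]
    constructor
    · rintro ⟨-, ⟨h1, -⟩, h2, -⟩
      constructor <;> linarith
    · rintro ⟨h1, h2⟩
      refine ⟨zero_le_one, ⟨?_, ?_⟩, ?_, ?_⟩ <;> linarith

lemma boundary_bentBody (c : ℝ) {a b H a' b' H' : ℝ} (h0 : 0 ≤ a) (ha : a ≤ H) (hb : H ≤ b)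
    (h0' : 0 ≤ a') (ha' : a' ≤ H') (hb' : H' ≤ b') {x : ℝ} (hx : |x| ≤ 1) :
    lowerBoundary (bentBody c a b H a' b' H') x = c - H' + bentProfile a' b' H' |x| ∧
    upperBoundary (bentBody c a b H a' b' H') x = c + H - bentProfile a b H |x| := by
  have e : {y : ℝ | (x, y) ∈ bentBody c a b H a' b' H'} =
      Icc (c - H' + bentProfile a' b' H' |x|) (c + H - bentProfile a b H |x|) := by
    ext y
    exact ⟨fun h => h.2, fun h => ⟨hx, h⟩⟩
  have h1 := bentProfile_le h0 ha hb hx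
  have h2 := bentProfile_le h0' ha' hb' hx
  rw [lowerBoundary, upperBoundary, e, csInf_Icc (by linarith), csSup_Icc (by linarith)]
  exact ⟨rfl, rfl⟩

lemma IsBody.eq_bentBody {h c a b H a' b' H' : ℝ} {K : Set (ℝ × ℝ)} (hK : IsBody h K)
    (hl : ∀ x ∈ Icc (0 : ℝ) 1, lowerBoundary K x = c - H' + bentProfile a' b' H' x)
    (hu : ∀ x ∈ Icc (0 : ℝ) 1, upperBoundary K x = c + H - bentProfile a b H x) :
    K = bentBody c a b H a' b' H' := by
  ext ⟨x, y⟩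
  rw [hK.mem_iff, mem_Icc, ← abs_le]
  refine and_congr_right fun hx => ?_
  have e1 : lowerBoundary K x = lowerBoundary K |x| := by
    rcases abs_choice x with h | h <;> rw [h]
    rw [hK.even_lower]
  have e2 : upperBoundary K x = upperBoundary K |x| := by
    rcases abs_choice x with h | h <;> rw [h]
    rw [hK.even_upper]
  rw [e1, e2, hl _ ⟨abs_nonneg x, hx⟩, hu _ ⟨abs_nonneg x, hx⟩]

/-- The profile is a maximum of two lines. Whichever is attained at `t` lies below `f` and touches
it there, so a derivative of `f` at `t` must be its slope. -/
lemma IsProfile.ae_slope_of_bent {f : ℝ → ℝ} (hf : IsProfile f) {a b H k : ℝ}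
    (h : ∀ x ∈ Icc (0 : ℝ) 1, f x = k + bentProfile a b H x) :
    ∀ᵐ t ∂(volume.restrict (Ioo (0 : ℝ) 1)), deriv f t = a ∨ deriv f t = b := by
  filter_upwards [hf.ae_hasDerivAt, ae_restrict_mem measurableSet_Ioo] with t ht ht1
  have hev : ∀ᶠ x in 𝓝 t, f x = k + bentProfile a b H x := by
    filter_upwards [Icc_mem_nhds ht1.1 ht1.2] with x hx using h x hx
  have key : ∀ A s : ℝ, (∀ x, A + s * x ≤ k + bentProfile a b H x) → f t = A + s * t →
      deriv f t = s := fun A s hA he => by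
    have hline : HasDerivAt (fun u => A + s * u) s t := by
      simpa using ((hasDerivAt_id t).const_mul s).const_add A
    have hmin : IsLocalMin (fun u => f u - (A + s * u)) t := by
      filter_upwards [hev] with u hu
      have := hA u
      simp only [he, hu]
      linarith
    have := hmin.hasDerivAt_eq_zero (ht.sub hline)
    linarith
  have ht2 := h t (Ioo_subset_Icc_self ht1)
  rcases max_choice (a * t) (H - b * (1 - t)) with hc | hc
  · exact .inl (key k a (fun x => by
      unfold bentProfile; linarith [le_max_left (a * x) (H - b * (1 - x))]) (by rw [ht2, bentProfile, hc]))
  · exact .inr (key (k + H - b) b (fun x => by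
      unfold bentProfile; linarith [le_max_right (a * x) (H - b * (1 - x))]) (by rw [ht2, bentProfile, hc]; ring))

lemma isCalibrated_bentBody {σ : ℝ → ℝ} {V A B s : ℝ} (c : ℝ) {a b H a' b' H' : ℝ} (h0 : 0 ≤ a)
    (ha : a ≤ H) (hb : H ≤ b) (h0' : 0 ≤ a') (ha' : a' ≤ H') (hb' : H' ≤ b')
    (pa : pPlus σ V a = A + s * a) (pb : pPlus σ V b = A + s * b)
    (qa : pMinus σ V a' = B + s * a') (qb : pMinus σ V b' = B + s * b') :
    IsCalibrated σ V A B s (bentBody c a b H a' b' H') := by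
  have hK := isBody_bentBody c h0 ha hb h0' ha' hb'
  have hbd := fun x (hx : |x| ≤ 1) => boundary_bentBody c h0 ha hb h0' ha' hb' (x := x) hx
  have habs : ∀ x ∈ Icc (0 : ℝ) 1, |x| = x := fun x hx => abs_of_nonneg hx.1
  refine ⟨?_, ?_, ?_⟩
  · obtain ⟨e1, e2⟩ := hbd 1 (by simp)
    rw [e1, e2, abs_one, bentProfile_one ha, bentProfile_one ha']
    ring
  · have := hK.isProfile_upper.ae_slope_of_bent (a := a) (b := b) (H := H) (k := -(c + H))
      fun x hx => by
        rw [(hbd x (by rw [habs x hx]; exact hx.2)).2, habs x hx]; ring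
    filter_upwards [this] with t ht
    rcases ht with ht | ht <;> rw [ht] <;> assumption
  · have := hK.isProfile_lower.ae_slope_of_bent (a := a') (b := b') (H := H') (k := c - H')
      fun x hx => by
        rw [(hbd x (by rw [habs x hx]; exact hx.2)).1, habs x hx]
    filter_upwards [this] with t ht
    rcases ht with ht | ht <;> rw [ht] <;> assumption

/-! ### Triangles and trapezia -/

/-- The parameter `t` is the relative height between the parallel sides. The horizontal slice there
is an interval whose ends lie on the lateral sides. -/
lemma mem_isoTrapezium {c w c' w' : ℝ} (hw : 0 ≤ w) (hw' : 0 ≤ w') {q : ℝ × ℝ} :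
    q ∈ isoTrapezium c w c' w' ↔
      ∃ t ∈ Icc (0 : ℝ) 1, q.2 = c + (c' - c) * t ∧ |q.1| ≤ w + (w' - w) * t := by
  constructor
  · refine fun hq => convexHull_min (t := {q : ℝ × ℝ | ∃ t ∈ Icc (0 : ℝ) 1, q.2 = c + (c' - c) * t ∧
      |q.1| ≤ w + (w' - w) * t}) ?_ ?_ hq
    · rintro _ (rfl | rfl | rfl | rfl)
      · exact ⟨0, by simp, by simp, by simp [abs_of_nonneg hw]⟩
      · exact ⟨0, by simp, by simp, by simp [abs_of_nonneg hw]⟩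
      · exact ⟨1, by simp, by simp, by simp [abs_of_nonneg hw']⟩
      · exact ⟨1, by simp, by simp, by simp [abs_of_nonneg hw']⟩
    · rintro p ⟨s, ⟨hs0, hs1⟩, hs2, hs3⟩ q ⟨t, ⟨ht0, ht1⟩, ht2, ht3⟩ α β hα hβ hαβ
      refine ⟨α * s + β * t, ⟨by positivity, by nlinarith⟩, ?_, ?_⟩
      · simp only [Prod.snd_add, Prod.smul_snd, smul_eq_mul, hs2, ht2]
        linear_combination c * hαβ
      · refine (abs_add_le _ _).trans ?_
        simp only [Prod.smul_fst, smul_eq_mul, abs_mul, abs_of_nonneg hα, abs_of_nonneg hβ]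
        have h1 := mul_le_mul_of_nonneg_left hs3 hα
        have h2 := mul_le_mul_of_nonneg_left ht3 hβ
        obtain rfl : β = 1 - α := by linarith
        linarith
  · rintro ⟨t, ⟨ht0, ht1⟩, hy, hx⟩
    have hc : Convex ℝ (isoTrapezium c w c' w') := convex_convexHull ℝ _
    have hv : ∀ v ∈ ({((-w, c) : ℝ × ℝ), (w, c), (-w', c'), (w', c')} : Set (ℝ × ℝ)),
        v ∈ isoTrapezium c w c' w' := fun v hv => subset_convexHull ℝ _ hv
    set X := w + (w' - w) * t with hX
    have hl : (-X, q.2) ∈ isoTrapezium c w c' w' := by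
      have := hc (hv (-w, c) (by simp)) (hv (-w', c') (by simp)) (sub_nonneg.2 ht1) ht0 (by ring)
      convert this using 1
      ext
      · simp only [hX, Prod.fst_add, Prod.smul_fst, smul_eq_mul]; ring
      · simp only [hy, Prod.snd_add, Prod.smul_snd, smul_eq_mul]; ring
    have hr : (X, q.2) ∈ isoTrapezium c w c' w' := by
      have := hc (hv (w, c) (by simp)) (hv (w', c') (by simp)) (sub_nonneg.2 ht1) ht0 (by ring)
      convert this using 1
      ext
      · simp only [hX, Prod.fst_add, Prod.smul_fst, smul_eq_mul]; ring
      · simp only [hy, Prod.snd_add, Prod.smul_snd, smul_eq_mul]; ring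
    have hsec : Convex ℝ {x : ℝ | (x, q.2) ∈ isoTrapezium c w c' w'} := by
      intro x1 h1 x2 h2 α β hα hβ hαβ
      have := hc h1 h2 hα hβ hαβ
      simp only [Prod.smul_mk, Prod.mk_add_mk, smul_eq_mul, ← add_mul, hαβ, one_mul] at this
      exact this
    exact hsec.ordConnected.out hl hr (abs_le.1 hx)

lemma isoTriangle_eq_isoTrapezium (c w a : ℝ) : isoTriangle c w a = isoTrapezium c w (c + a) 0 := by
  simp [isoTriangle, isoTrapezium]

/-- A trapezium above its longer side, given by the slope of its lateral sides. -/
lemma mem_isoTrapezium_up {c w w' b : ℝ} (hb : 0 < b) (hw' : 0 ≤ w') (hww : w' ≤ w) {q : ℝ × ℝ} :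
    q ∈ isoTrapezium c w (c + b * (w - w')) w' ↔
      c ≤ q.2 ∧ q.2 ≤ c + b * (w - w') ∧ q.2 - c ≤ b * (w - |q.1|) := by
  rw [mem_isoTrapezium (hw'.trans hww) hw']
  constructor
  · rintro ⟨t, ⟨ht0, ht1⟩, h1, h2⟩
    have h3 : 0 ≤ b * (w - w') := mul_nonneg hb.le (sub_nonneg.2 hww)
    have h4 := mul_le_mul_of_nonneg_left h2 hb.le
    refine ⟨?_, ?_, ?_⟩ <;> nlinarith
  · rintro ⟨h1, h2, h3⟩
    rcases hww.eq_or_lt with rfl | hlt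
    · refine ⟨0, by simp, by linarith, ?_⟩
      have : 0 ≤ b * (w' - |q.1|) := by linarith
      have := nonneg_of_mul_nonneg_right this hb
      linarith
    · have h4 : 0 < b * (w - w') := mul_pos hb (sub_pos.2 hlt)
      have e : b * (w - w') * ((q.2 - c) / (b * (w - w'))) = q.2 - c := by field_simp
      refine ⟨(q.2 - c) / (b * (w - w')), ⟨div_nonneg (by linarith) h4.le,
        (div_le_one h4).2 (by linarith)⟩, by linear_combination -e, ?_⟩
      refine le_of_mul_le_mul_left ?_ hb
      linarith

/-- A trapezium below its longer side, given by the slope of its lateral sides. -/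
lemma mem_isoTrapezium_down {c w w' b : ℝ} (hb : 0 < b) (hw' : 0 ≤ w') (hww : w' ≤ w)
    {q : ℝ × ℝ} : q ∈ isoTrapezium c w (c - b * (w - w')) w' ↔
      c - b * (w - w') ≤ q.2 ∧ q.2 ≤ c ∧ c - q.2 ≤ b * (w - |q.1|) := by
  have h := mem_isoTrapezium_up (c := -c) hb hw' hww (q := (q.1, -q.2))
  have e : q ∈ isoTrapezium c w (c - b * (w - w')) w' ↔
      (q.1, -q.2) ∈ isoTrapezium (-c) w (-c + b * (w - w')) w' := by
    rw [mem_isoTrapezium (hw'.trans hww) hw', mem_isoTrapezium (hw'.trans hww) hw']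
    refine exists_congr fun t => and_congr_right fun _ => and_congr_left fun _ => ?_
    simp only
    constructor <;> intro <;> linarith
  rw [e, h]
  simp only
  constructor
  · rintro ⟨h1, h2, h3⟩
    refine ⟨?_, ?_, ?_⟩ <;> linarith
  · rintro ⟨h1, h2, h3⟩
    refine ⟨?_, ?_, ?_⟩ <;> linarith

lemma mem_isoTriangle_up {c w b : ℝ} (hb : 0 < b) (hw : 0 ≤ w) {q : ℝ × ℝ} :
    q ∈ isoTriangle c w (b * w) ↔ c ≤ q.2 ∧ q.2 - c ≤ b * (w - |q.1|) := by
  have h := mem_isoTrapezium_up (c := c) hb le_rfl hw (q := q)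
  rw [sub_zero] at h
  rw [isoTriangle_eq_isoTrapezium, h]
  refine and_congr_right fun _ => and_iff_right_of_imp fun h => ?_
  nlinarith [abs_nonneg q.1]

lemma mem_isoTriangle_down {c w b : ℝ} (hb : 0 < b) (hw : 0 ≤ w) {q : ℝ × ℝ} :
    q ∈ isoTriangle c w (-(b * w)) ↔ q.2 ≤ c ∧ c - q.2 ≤ b * (w - |q.1|) := by
  have h := mem_isoTrapezium_down (c := c) hb le_rfl hw (q := q)
  rw [sub_zero] at h
  rw [isoTriangle_eq_isoTrapezium, ← sub_eq_add_neg, h]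
  refine and_iff_right_of_imp fun h => ?_
  nlinarith [abs_nonneg q.1, h.1]

lemma isoTrapezium_eq_bentBody (c : ℝ) {h u : ℝ} (hh : 0 < h) (hu : h ≤ u) :
    isoTrapezium c 1 (c + h) (1 - h / u) = bentBody c 0 u h 0 0 0 := by
  have hu0 : 0 < u := hh.trans_le hu
  ext q
  have e : u * (1 - (1 - h / u)) = h := by field_simp; ring
  have := mem_isoTrapezium_up (c := c) (w := 1) (w' := 1 - h / u) (q := q) hu0
    (sub_nonneg.2 ((div_le_one hu0).2 hu)) (by have : 0 ≤ h / u := by positivity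
                                               linarith)
  rw [e] at this
  rw [this, mem_bentBody]
  constructor
  · rintro ⟨h1, h2, h3⟩
    refine ⟨?_, ⟨?_, ?_⟩, ?_, ?_⟩ <;> nlinarith
  · rintro ⟨h1, ⟨h2, h3⟩, h4, h5⟩
    refine ⟨?_, ?_, ?_⟩ <;> linarith

lemma isoTriangle_eq_bentBody (c : ℝ) {h : ℝ} (hh : 0 < h) :
    isoTriangle c 1 h = bentBody c h h h 0 0 0 := by
  ext q
  have := mem_isoTriangle_up (c := c) (w := 1) (q := q) hh zero_le_one
  rw [mul_one] at this
  rw [this, mem_bentBody]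
  constructor
  · rintro ⟨h1, h2⟩
    refine ⟨?_, ⟨?_, ?_⟩, ?_, ?_⟩ <;> nlinarith
  · rintro ⟨h1, ⟨h2, h3⟩, h4, h5⟩
    refine ⟨?_, ?_⟩ <;> linarith

lemma triangleTrapezium_eq_bentBody (c : ℝ) {h k u : ℝ} (hh : 0 < h) (hk : 0 < k) (hu : k ≤ u) :
    triangleTrapezium c h k u = bentBody c h h h 0 u k := by
  have hu0 : 0 < u := hk.trans_le hu
  ext q
  have e : u * (1 - (1 - k / u)) = k := by field_simp; ring
  have h1 := mem_isoTrapezium_down (c := c) (w := 1) (w' := 1 - k / u) (q := q) hu0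
    (sub_nonneg.2 ((div_le_one hu0).2 hu)) (by have : 0 ≤ k / u := by positivity
                                               linarith)
  rw [e] at h1
  have h2 := mem_isoTriangle_up (c := c) (w := 1) (q := q) hh zero_le_one
  rw [mul_one] at h2
  rw [triangleTrapezium, mem_union, h1, h2, mem_bentBody]
  constructor
  · rintro (⟨h1, h2⟩ | ⟨h1, h2, h3⟩)
    all_goals
      have h4 : |q.1| ≤ 1 := by nlinarith
      have h0 := abs_nonneg q.1
      refine ⟨h4, ⟨?_, ?_⟩, ?_, ?_⟩ <;> nlinarith
  · rintro ⟨h1, ⟨h2, h3⟩, h4, h5⟩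
    rcases le_total c q.2 with h | h
    · exact .inl ⟨h, by linarith⟩
    · refine .inr ⟨?_, ?_, ?_⟩ <;> linarith

lemma twoTriangles_eq_bentBody (c : ℝ) {h k : ℝ} (hh : 0 < h) (hk : 0 < k) :
    twoTriangles c h k = bentBody c h h h k k k := by
  ext q
  have h1 := mem_isoTriangle_down (c := c) (w := 1) (q := q) hk zero_le_one
  have h2 := mem_isoTriangle_up (c := c) (w := 1) (q := q) hh zero_le_one
  rw [mul_one] at h1 h2
  rw [twoTriangles, mem_union, h1, h2, mem_bentBody]
  constructor
  · rintro (⟨h1, h2⟩ | ⟨h1, h2⟩)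
    all_goals
      have h4 : |q.1| ≤ 1 := by nlinarith
      have h0 := abs_nonneg q.1
      refine ⟨h4, ⟨?_, ?_⟩, ?_, ?_⟩ <;> nlinarith
  · rintro ⟨h1, ⟨h2, h3⟩, h4, h5⟩
    rcases le_total c q.2 with h | h
    · exact .inl ⟨h, by linarith⟩
    · refine .inr ⟨?_, ?_⟩ <;> linarith

lemma twoTrianglesTrapezium_eq_bentBody (c : ℝ) {h k a b : ℝ} (hh : 0 < h) (ha : 0 < a)
    (hak : a < k) (hkb : k < b) : twoTrianglesTrapezium c h k a b = bentBody c h h h a b k := by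
  have hab : 0 < b - a := by linarith
  set t := (b - k) / (b - a) with ht
  have htk : (b - a) * t = b - k := by rw [ht]; field_simp
  have ht0 : 0 ≤ t := div_nonneg (by linarith) hab.le
  have ht1 : t ≤ 1 := (div_le_one hab).2 (by linarith)
  ext q
  have e : c - k + a * t = c - b * (1 - t) := by linear_combination -htk
  have h1 := mem_isoTrapezium_down (c := c) (w := 1) (w' := t) (q := q) (ha.trans (hak.trans hkb))
    ht0 ht1
  have h2 := mem_isoTriangle_up (c := c) (w := 1) (q := q) hh zero_le_one
  have h3 := mem_isoTriangle_down (c := c - k + a * t) (w := t) (q := q) ha ht0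
  rw [mul_one] at h2
  rw [twoTrianglesTrapezium, ← ht, mem_union, mem_union, h2, h3, e, h1, mem_bentBody]
  have hx0 := abs_nonneg q.1
  -- The two lines of the lower profile cross at `x = t`, the half-width of the side shared by the
  -- trapezium and the lower triangle.
  have hcmp : ∀ x : ℝ, (x ≤ t → c - b * (1 - x) ≤ c - k + a * x) ∧
      (t ≤ x → c - k + a * x ≤ c - b * (1 - x)) := fun x =>
    ⟨fun hx => by nlinarith, fun hx => by nlinarith⟩
  have hb0 : 0 < b := by linarith
  constructor
  · rintro ((⟨h1, h2⟩ | ⟨h1, h2, h3⟩) | ⟨h1, h2⟩)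
    · have h4 : |q.1| ≤ 1 := by nlinarith
      refine ⟨h4, ⟨?_, ?_⟩, ?_, ?_⟩ <;> nlinarith
    · have h4 : |q.1| ≤ 1 := by nlinarith
      refine ⟨h4, ⟨?_, by linarith⟩, by nlinarith, by nlinarith⟩
      rcases le_total |q.1| t with h | h
      · nlinarith
      · linarith [(hcmp _).2 h]
    · have h4 : |q.1| ≤ t := by nlinarith
      have h5 := (hcmp _).1 h4
      have h6 : q.2 ≤ c := by nlinarith
      refine ⟨h4.trans ht1, ⟨by linarith, by linarith⟩, by nlinarith, by nlinarith⟩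
  · rintro ⟨h1, ⟨h2, h3⟩, h4, h5⟩
    rcases le_total c q.2 with h | h
    · exact .inl (.inl ⟨h, by linarith⟩)
    rcases le_total (c - b * (1 - t)) q.2 with h' | h'
    · exact .inl (.inr ⟨h', h, by linarith⟩)
    · exact .inr ⟨h', by linarith⟩

/-! ### Optimal bodies -/

lemma IsProfile.eq_bent {f : ℝ → ℝ} (hf : IsProfile f) {a b : ℝ} (hab : a ≤ b)
    (h : ∀ᵐ t ∂(volume.restrict (Ioo (0 : ℝ) 1)), deriv f t = a ∨ deriv f t = b) :
    a ≤ f 1 - f 0 ∧ f 1 - f 0 ≤ b ∧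
      ∀ x ∈ Icc (0 : ℝ) 1, f x = f 0 + bentProfile a b (f 1 - f 0) x := by
  have key := hf.eq_of_two_slopes hab h
  refine ⟨?_, ?_, key⟩
  · have := key 1 (by simp)
    linarith [le_max_left (a * 1) (f 1 - f 0 - b * (1 - 1))]
  · have := key 0 (by simp)
    linarith [le_max_right (a * 0) (f 1 - f 0 - b * (1 - 0))]

lemma bentProfile_self {a : ℝ} (t : ℝ) : bentProfile a a a t = a * t := by
  rw [bentProfile, max_eq_left]; linarith

section

variable {σ : ℝ → ℝ} {V h A B s : ℝ} {K : Set (ℝ × ℝ)}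

lemma IsCalibrated.upper_contact (hK : IsBody h K) (hc : IsCalibrated σ V A B s K) {S : Set ℝ}
    (hS : ∀ u, 0 ≤ u → pPlus σ V u = A + s * u → u ∈ S) :
    ∀ᵐ t ∂(volume.restrict (Ioo (0 : ℝ) 1)), deriv (fun x => -upperBoundary K x) t ∈ S := by
  filter_upwards [hc.upper, ae_restrict_mem measurableSet_Ioo] with t ht ht1
  exact hS _ (hK.isProfile_upper.deriv_nonneg ht1) ht

lemma IsCalibrated.lower_contact (hK : IsBody h K) (hc : IsCalibrated σ V A B s K) {S : Set ℝ}
    (hS : ∀ u, 0 ≤ u → pMinus σ V u = B + s * u → u ∈ S) :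
    ∀ᵐ t ∂(volume.restrict (Ioo (0 : ℝ) 1)), deriv (lowerBoundary K) t ∈ S := by
  filter_upwards [hc.lower, ae_restrict_mem measurableSet_Ioo] with t ht ht1
  exact hS _ (hK.isProfile_lower.deriv_nonneg ht1) ht

/-- Optimal bodies without a lower part. -/
theorem optimal_short {a b : ℝ} (hσ : ClassA2 σ) (hV : 0 < V) (hs : s < 0)
    (hA : ∀ u, 0 ≤ u → A + s * u ≤ pPlus σ V u)
    (hB : ∀ u, 0 ≤ u → pMinus σ V 0 + s * u ≤ pMinus σ V u)
    (ha0 : 0 ≤ a) (ha : a ≤ h) (hb : h ≤ b)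
    (pa : pPlus σ V a = A + s * a) (pb : pPlus σ V b = A + s * b)
    (hc : ∀ u, 0 ≤ u → pPlus σ V u = A + s * u → u = a ∨ u = b)
    (hlow : (∀ u, 0 ≤ u → pMinus σ V u = pMinus σ V 0 + s * u → u = 0) ∨ a = b) :
    IsMinResistance σ V h (A + pMinus σ V 0 + s * h) ∧
      ∀ K, IsOptimal σ V h K ↔ ∃ c, K = bentBody c a b h 0 0 0 := by
  have hbody : ∀ c, IsBody h (bentBody c a b h 0 0 0) := fun c => by
    simpa using isBody_bentBody c ha0 ha hb le_rfl le_rfl le_rfl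
  have hcal : ∀ c, IsCalibrated σ V A (pMinus σ V 0) s (bentBody c a b h 0 0 0) := fun c =>
    isCalibrated_bentBody c ha0 ha hb le_rfl le_rfl le_rfl pa pb (by simp) (by simp)
  obtain ⟨h1, h2⟩ := optimal_of_calibrated hσ hV hs hA hB (hbody 0) (hcal 0)
  refine ⟨h1, fun K => (h2 K).trans ⟨?_, ?_⟩⟩
  · rintro ⟨hK, hKc⟩
    have hup := hKc.upper_contact hK (S := {u | u = a ∨ u = b}) hc
    obtain ⟨u1, u2, u3⟩ := hK.isProfile_upper.eq_bent (ha.trans hb) hup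
    have hle := hK.isProfile_lower.monotoneOn (left_mem_Icc.2 zero_le_one)
      (right_mem_Icc.2 zero_le_one) zero_le_one
    have hlen := hK.upper_sub_lower
    have hclosed := hKc.closed
    -- The bottom is flat either because `0` is the only contact slope of `p₋`, or because `a = b =
    -- h` and the upper part already uses up the whole length. The second reason is needed at `h =
    -- u_*`, where `u₋⁰` is a contact slope too.
    have hrise : lowerBoundary K 1 = lowerBoundary K 0 := by
      rcases hlow with hl | rfl
      · have hlo := hKc.lower_contact hK (S := {u | u = 0 ∨ u = 0}) fun u hu he => .inl (hl u hu he)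
        obtain ⟨l1, l2, -⟩ := hK.isProfile_lower.eq_bent le_rfl hlo
        linarith
      · linarith
    refine ⟨lowerBoundary K 0, hK.eq_bentBody (fun x hx => ?_) fun x hx => ?_⟩
    · have e1 := hK.isProfile_lower.monotoneOn (left_mem_Icc.2 zero_le_one) hx hx.1
      have e2 := hK.isProfile_lower.monotoneOn hx (right_mem_Icc.2 zero_le_one) hx.2
      rw [bentProfile_self]
      linarith
    · have e1 := u3 x hx
      rw [show -upperBoundary K 1 - -upperBoundary K 0 = h by linarith] at e1
      linarith
  · rintro ⟨c, rfl⟩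
    exact ⟨hbody c, hcal c⟩

end

/-- The tangent of `p₊` at `hP` touches only there, so a calibrated upper boundary has slope `hP`
throughout and bounds a triangle. The lower contact condition is the same on both sides. -/
lemma isCalibrated_iff_hasOptimalParts {σ : ℝ → ℝ} {V hP hM : ℝ} {K : Set (ℝ × ℝ)}
    (hK : IsBody (hP + hM) K) (hP0 : 0 < hP)
    (htan : ∀ u, 0 ≤ u → u ≠ hP →
      pPlus σ V hP + deriv (pPlus σ V) hP * (u - hP) < pPlus σ V u) :
    IsCalibrated σ V (pPlus σ V hP - deriv (pPlus σ V) hP * hP)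
      (convexEnvelope (pMinus σ V) hM - deriv (pPlus σ V) hP * hM) (deriv (pPlus σ V) hP) K ↔
      HasOptimalParts σ V hP hM K := by
  have hlen := hK.upper_sub_lower
  have h01 : (0 : ℝ) ∈ Icc (0 : ℝ) 1 := left_mem_Icc.2 zero_le_one
  have h11 : (1 : ℝ) ∈ Icc (0 : ℝ) 1 := right_mem_Icc.2 zero_le_one
  have htri := fun (c : ℝ) (q : ℝ × ℝ) =>
    mem_isoTriangle_up (c := c) (w := 1) (q := q) hP0 zero_le_one
  simp only [mul_one] at htri
  constructor
  · intro hc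
    have hup := hc.upper_contact hK (S := {u | u = hP ∨ u = hP}) fun u hu he => by
      by_contra hne
      have hne' : u ≠ hP := fun h => hne (.inl h)
      linarith [htan u hu hne']
    obtain ⟨u1, u2, u3⟩ := hK.isProfile_upper.eq_bent le_rfl hup
    have hclosed := hc.closed
    rw [show -upperBoundary K 1 - -upperBoundary K 0 = hP by linarith] at u3
    simp only [bentProfile_self] at u3
    refine ⟨lowerBoundary K 1, ?_, rfl, by linarith, ?_⟩
    · ext ⟨x, y⟩
      rw [htri]
      constructor
      · rintro ⟨hxy, hy : _ ≤ y⟩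
        have hx := abs_le.2 (hK.section_subset y hxy)
        refine ⟨hy, ?_⟩
        have e := hK.le_upper hxy
        have e2 : upperBoundary K x = upperBoundary K |x| := by
          rcases abs_choice x with h | h <;> rw [h]
          rw [hK.even_upper]
        have := u3 |x| ⟨abs_nonneg x, hx⟩
        simp only
        linarith
      · rintro ⟨h1, h2⟩
        simp only at h1 h2
        have hx : |x| ≤ 1 := by nlinarith
        refine ⟨hK.mem_iff.2 ⟨abs_le.1 hx, ?_, ?_⟩, h1⟩
        · have e2 : lowerBoundary K x = lowerBoundary K |x| := by
            rcases abs_choice x with h | h <;> rw [h]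
            rw [hK.even_lower]
          rw [e2]
          exact (hK.isProfile_lower.monotoneOn ⟨abs_nonneg x, hx⟩ h11 hx).trans h1
        · have e2 : upperBoundary K x = upperBoundary K |x| := by
            rcases abs_choice x with h | h <;> rw [h]
            rw [hK.even_upper]
          have := u3 |x| ⟨abs_nonneg x, hx⟩
          linarith
    · filter_upwards [hc.lower, ae_restrict_mem measurableSet_Ioo] with t ht ht1
      exact ⟨hK.isProfile_lower.deriv_nonneg ht1, by rw [ht]; ring⟩
  · rintro ⟨c, hc1, hc2, hc3, hc4⟩
    have hmem : ∀ x ∈ Icc (0 : ℝ) 1, x ∈ Icc (-1 : ℝ) 1 := fun x hx => ⟨by linarith [hx.1], hx.2⟩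
    have hle : ∀ x ∈ Icc (0 : ℝ) 1, c ≤ upperBoundary K x → upperBoundary K x ≤ c + hP * (1 - x) :=
      fun x hx hcx => by
        have : (x, upperBoundary K x) ∈ isoTriangle c 1 hP := hc1 ▸ ⟨hK.upper_mem (hmem x hx), hcx⟩
        have := ((htri c _).1 this).2
        rw [abs_of_nonneg hx.1] at this
        linarith
    have hge : ∀ x ∈ Icc (0 : ℝ) 1, c + hP * (1 - x) ≤ upperBoundary K x := fun x hx => by
      have : (x, c + hP * (1 - x)) ∈ isoTriangle c 1 hP := (htri c _).2 ⟨by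
        have := mul_nonneg hP0.le (sub_nonneg.2 hx.2)
        simpa using this, by simp [abs_of_nonneg hx.1]⟩
      rw [← hc1] at this
      exact hK.le_upper this.1
    have hU : ∀ x ∈ Icc (0 : ℝ) 1, upperBoundary K x = c + hP * (1 - x) := fun x hx =>
      le_antisymm (hle x hx (le_trans (by nlinarith [mul_nonneg hP0.le (sub_nonneg.2 hx.2)])
        (hge x hx))) (hge x hx)
    refine ⟨by rw [hc2, hU 1 h11]; ring, ?_, ?_⟩
    · have := hK.isProfile_upper.ae_slope_of_bent (a := hP) (b := hP) (H := hP) (k := -(c + hP))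
        fun x hx => by rw [hU x hx, bentProfile_self]; ring
      filter_upwards [this] with t ht
      rw [or_self_iff.1 ht]
      ring
    · filter_upwards [hc4] with t ht
      rw [ht.2]; ring

/-- Optimal bodies with a triangular upper part of height `hP` and a lower part of height `hM`. -/
theorem optimal_long {σ : ℝ → ℝ} {V hP hM a b : ℝ} (hσ : ClassA2 σ) (hV : 0 < V) (hP0 : 0 < hP)
    (hs : deriv (pPlus σ V) hP < 0)
    (htan : ∀ u, 0 ≤ u → u ≠ hP →
      pPlus σ V hP + deriv (pPlus σ V) hP * (u - hP) < pPlus σ V u)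
    (hB : ∀ u, 0 ≤ u →
      convexEnvelope (pMinus σ V) hM + deriv (pPlus σ V) hP * (u - hM) ≤ pMinus σ V u)
    (ha : a ≤ hM) (hb : hM ≤ b) (qa : IsContact σ V hP hM a) (qb : IsContact σ V hP hM b) :
    IsMinResistance σ V (hP + hM) (pPlus σ V hP + convexEnvelope (pMinus σ V) hM) ∧
    (∀ K, IsOptimal σ V (hP + hM) K ↔ IsBody (hP + hM) K ∧ HasOptimalParts σ V hP hM K) ∧
    (∀ c, IsOptimal σ V (hP + hM) (bentBody c hP hP hP a b hM)) ∧
    ((∀ u, IsContact σ V hP hM u → u = a ∨ u = b) →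
      ∀ K, IsOptimal σ V (hP + hM) K → ∃ c, K = bentBody c hP hP hP a b hM) := by
  set s := deriv (pPlus σ V) hP with hsd
  have hA' : ∀ u, 0 ≤ u → pPlus σ V hP - s * hP + s * u ≤ pPlus σ V u := fun u hu => by
    rcases eq_or_ne u hP with rfl | hne
    · linarith
    · linarith [htan u hu hne]
  have hB' : ∀ u, 0 ≤ u → convexEnvelope (pMinus σ V) hM - s * hM + s * u ≤ pMinus σ V u :=
    fun u hu => by linarith [hB u hu]
  have hbody : ∀ c, IsBody (hP + hM) (bentBody c hP hP hP a b hM) := fun c =>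
    isBody_bentBody c hP0.le le_rfl le_rfl qa.1 ha hb
  have hcal : ∀ c, IsCalibrated σ V (pPlus σ V hP - s * hP)
      (convexEnvelope (pMinus σ V) hM - s * hM) s (bentBody c hP hP hP a b hM) := fun c =>
    isCalibrated_bentBody c hP0.le le_rfl le_rfl qa.1 ha hb (by ring) (by ring)
      (by rw [qa.2]; ring) (by rw [qb.2]; ring)
  obtain ⟨h1, h2⟩ := optimal_of_calibrated hσ hV hs hA' hB' (hbody 0) (hcal 0)
  have h3 : ∀ K, IsOptimal σ V (hP + hM) K ↔
      IsBody (hP + hM) K ∧ HasOptimalParts σ V hP hM K := fun K =>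
    (h2 K).trans (and_congr_right fun hK => isCalibrated_iff_hasOptimalParts hK hP0 htan)
  refine ⟨by convert h1 using 1; ring, h3, fun c => (h2 _).2 ⟨hbody c, hcal c⟩, fun hcon K hKo => ?_⟩
  obtain ⟨hK, hc⟩ := (h2 K).1 hKo
  have hclosed := hc.closed
  have hlen := hK.upper_sub_lower
  have hup := hc.upper_contact hK (S := {u | u = hP ∨ u = hP}) fun u hu he => by
    by_contra hne
    have hne' : u ≠ hP := fun h => hne (.inl h)
    linarith [htan u hu hne']
  obtain ⟨u1, u2, u3⟩ := hK.isProfile_upper.eq_bent le_rfl hup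
  have hlo := hc.lower_contact hK (S := {u | u = a ∨ u = b}) fun u hu he =>
    hcon u ⟨hu, by rw [he]; ring⟩
  obtain ⟨l1, l2, l3⟩ := hK.isProfile_lower.eq_bent (ha.trans hb) hlo
  refine ⟨lowerBoundary K 1, hK.eq_bentBody (fun x hx => ?_) fun x hx => ?_⟩
  · rw [l3 x hx, show lowerBoundary K 1 - lowerBoundary K 0 = hM by linarith]
    linarith
  · have := u3 x hx
    rw [show -upperBoundary K 1 - -upperBoundary K 0 = hP by linarith] at this
    linarith

/-! ### Splitting a long body into its two parts -/

namespace ClassA2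

variable {σ : ℝ → ℝ} {V : ℝ}

lemma pMinus_bound (hσ : ClassA2 σ) (hV : 0 < V) :
    ∀ u, 0 ≤ u → -fluxPotential (radialMarginal σ) 0 ≤ pMinus σ V u :=
  fun u _ => (hσ.lt_pMinus hV u).le

lemma convexOn_envelope_minus (hσ : ClassA2 σ) (hV : 0 < V) :
    ConvexOn ℝ (Ici 0) (convexEnvelope (pMinus σ V)) :=
  convexOn_convexEnvelope (hσ.pMinus_bound hV)

lemma envelope_minus_le (hσ : ClassA2 σ) (hV : 0 < V) {u : ℝ} (hu : 0 ≤ u) :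
    convexEnvelope (pMinus σ V) u ≤ pMinus σ V u := convexEnvelope_le (hσ.pMinus_bound hV) hu

lemma exists_hasDerivAt_envelope_minus (hσ : ClassA2 σ) (hV : 0 < V) {x : ℝ} (hx : 0 < x) :
    ∃ s, s < 0 ∧ HasDerivAt (convexEnvelope (pMinus σ V)) s x ∧
      ∀ u, 0 ≤ u → convexEnvelope (pMinus σ V) x + s * (u - x) ≤ pMinus σ V u :=
  exists_hasDerivAt_convexEnvelope (hσ.differentiable_pMinus V)
    (fun u _ => hσ.lt_pMinus hV u) (hσ.tendsto_pMinus V) hx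

/-- On a gap the envelope of `p₋` is a line that touches `p₋` at the ends. -/
lemma exists_gap_line (hσ : ClassA2 σ) (hV : 0 < V) {x : ℝ} (hx : 0 < x)
    (hg : x ∈ gapSet (pMinus σ V)) : ∃ a b s, IsGap (pMinus σ V) a b ∧ x ∈ Ioo a b ∧
      (∀ y ∈ Ioo a b, HasDerivAt (convexEnvelope (pMinus σ V)) s y) ∧
      pMinus σ V a = convexEnvelope (pMinus σ V) x + s * (a - x) ∧
      pMinus σ V b = convexEnvelope (pMinus σ V) x + s * (b - x) := by
  obtain ⟨s, hs, hd, hl⟩ := hσ.exists_hasDerivAt_envelope_minus hV hx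
  obtain ⟨a, b, hab, hxab, hca, hcb⟩ := exists_isGap
    (A := convexEnvelope (pMinus σ V) x - s * x) (hσ.differentiable_pMinus V).continuous
    (hσ.pMinus_bound hV) hx hs (fun u hu => by linarith [hl u hu]) (by ring) hg
  refine ⟨a, b, s, hab, hxab, fun y hy => ?_, by rw [hca]; ring, by rw [hcb]; ring⟩
  have hline : HasDerivAt (fun u => convexEnvelope (pMinus σ V) x - s * x + s * u) s y := by
    simpa using ((hasDerivAt_id y).const_mul s).const_add
      (convexEnvelope (pMinus σ V) x - s * x)
  refine hline.congr_of_eventuallyEq ?_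
  filter_upwards [Ioo_mem_nhds hy.1 hy.2] with u hu
  exact convexEnvelope_eq_line (hσ.pMinus_bound hV) hab.1
    (fun u hu => by linarith [hl u hu]) hca hcb ⟨hu.1.le, hu.2.le⟩

end ClassA2

namespace ThresholdFacts

variable {σ : ℝ → ℝ} {V uP BP uM BM uS : ℝ}

lemma uM_pos (T : ThresholdFacts σ V uP BP uM BM uS) : 0 < uM := T.isThresholds.gap_minus.2.1

lemma uM_notMem (T : ThresholdFacts σ V uP BP uM BM uS) : uM ∉ gapSet (pMinus σ V) :=
  T.isThresholds.gap_minus.2.2.2.2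

lemma deriv_uP (T : ThresholdFacts σ V uP BP uM BM uS) : deriv (pPlus σ V) uP = -BP :=
  T.isThresholds.tangent_plus.deriv

lemma deriv_uS (T : ThresholdFacts σ V uP BP uM BM uS) : deriv (pPlus σ V) uS = -BM :=
  T.isThresholds.tangent_star.deriv

lemma uS_pos (T : ThresholdFacts σ V uP BP uM BM uS) : 0 < uS :=
  T.isThresholds.uP_pos.trans T.isThresholds.uP_lt_uS

lemma pPlus_uP (T : ThresholdFacts σ V uP BP uM BM uS) :
    pPlus σ V uP = pPlus σ V 0 + -BP * uP := by
  have h := T.isThresholds.chord_plus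
  rw [div_eq_iff T.isThresholds.uP_pos.ne'] at h
  linarith

lemma pMinus_uM (T : ThresholdFacts σ V uP BP uM BM uS) :
    pMinus σ V uM = pMinus σ V 0 + -BM * uM := by
  rw [T.isThresholds.chord_minus]; ring

lemma envelope_minus (T : ThresholdFacts σ V uP BP uM BM uS) (hσ : ClassA2 σ) (hV : 0 < V) {u : ℝ}
    (hu : u ∈ Icc 0 uM) : convexEnvelope (pMinus σ V) u = pMinus σ V 0 + -BM * u :=
  convexEnvelope_eq_line (hσ.pMinus_bound hV) le_rfl T.minus_line (by simp) T.pMinus_uM hu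

lemma neg_BM_le (T : ThresholdFacts σ V uP BP uM BM uS) (hσ : ClassA2 σ) (hV : 0 < V) {x s : ℝ}
    (hx : 0 < x) (hd : HasDerivWithinAt (convexEnvelope (pMinus σ V)) s (Ici 0) x) : -BM ≤ s :=
  subgradient_mono le_rfl hx
    (fun _ hu => subgradient_of_hasDerivWithinAt (hσ.convexOn_envelope_minus hV) le_rfl
      T.isThresholds.slope_minus hu)
    fun _ hu => subgradient_of_hasDerivWithinAt (hσ.convexOn_envelope_minus hV) hx.le hd hu

/-- The envelope of `p₋` has no slope below its initial one, `-BM`. The slope of `p₊` at `hP` is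
thus at least its slope at `uS`. -/
lemma split_facts (T : ThresholdFacts σ V uP BP uM BM uS) (hσ : ClassA2 σ) (hV : 0 < V)
    {h hP hM : ℝ} (hs : IsSplit σ V uP uM h hP hM) :
    uS ≤ hP ∧ deriv (pPlus σ V) hP < 0 ∧
      HasDerivWithinAt (convexEnvelope (pMinus σ V)) (deriv (pPlus σ V) hP) (Ici 0) hM ∧
      ∀ u, 0 ≤ u →
        convexEnvelope (pMinus σ V) hM + deriv (pPlus σ V) hP * (u - hM) ≤ pMinus σ V u := by
  obtain ⟨-, h1, h2, s, h3, h4⟩ := hs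
  have hM0 : 0 < hM := T.uM_pos.trans_le h2
  obtain rfl := h3.deriv
  have hsub : ∀ u, 0 ≤ u →
      convexEnvelope (pMinus σ V) hM + deriv (pPlus σ V) hP * (u - hM) ≤ pMinus σ V u :=
    fun u hu => (subgradient_of_hasDerivWithinAt (hσ.convexOn_envelope_minus hV) hM0.le h4
      hu).trans (hσ.envelope_minus_le hV hu)
  refine ⟨?_, subgradient_neg (hσ.differentiable_pMinus V).continuous
    (fun u _ => hσ.lt_pMinus hV u) (hσ.tendsto_pMinus V) hM0.le hsub, h4, hsub⟩
  by_contra! hlt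
  have h5 := T.plus_mono h1 (T.isThresholds.uP_lt_uS.le : uP ≤ uS) hlt
  rw [T.deriv_uS] at h5
  exact absurd (T.neg_BM_le hσ hV hM0 h4) (not_le.2 h5)

/-- If `hP` grows, the slope of `p₊` grows strictly, while `hM` shrinks and the slope of the
envelope cannot grow. -/
lemma split_unique (T : ThresholdFacts σ V uP BP uM BM uS) (hσ : ClassA2 σ) (hV : 0 < V)
    {h hP hM hP' hM' : ℝ} (hs : IsSplit σ V uP uM h hP hM) (hs' : IsSplit σ V uP uM h hP' hM') :
    hP' = hP ∧ hM' = hM := by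
  have key : ∀ {hP hM hP' hM' : ℝ}, IsSplit σ V uP uM h hP hM → IsSplit σ V uP uM h hP' hM' →
      ¬ hP < hP' := fun {hP hM hP' hM'} hs hs' hlt => by
    obtain ⟨-, -, hd, -⟩ := T.split_facts hσ hV hs
    obtain ⟨-, -, hd', -⟩ := T.split_facts hσ hV hs'
    have h1 := T.plus_mono hs.2.1 hs'.2.1 hlt
    have hM0 : 0 ≤ hM := T.uM_pos.le.trans hs.2.2.1
    have hM0' : 0 ≤ hM' := T.uM_pos.le.trans hs'.2.2.1
    have hlt' : hM' < hM := by linarith [hs.1, hs'.1]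
    have h2 := subgradient_mono hM0' hlt'
      (fun _ hu => subgradient_of_hasDerivWithinAt (hσ.convexOn_envelope_minus hV) hM0' hd' hu)
      fun _ hu => subgradient_of_hasDerivWithinAt (hσ.convexOn_envelope_minus hV) hM0 hd hu
    exact absurd h1 (not_lt.2 h2)
  have e : hP' = hP := le_antisymm (not_lt.1 (key hs hs')) (not_lt.1 (key hs' hs))
  exact ⟨e, by linarith [hs.1, hs'.1]⟩

lemma exists_split (T : ThresholdFacts σ V uP BP uM BM uS) (hσ : ClassA2 σ) (hV : 0 < V)
    {h : ℝ} (hh : uS + uM ≤ h) : ∃ hP hM, IsSplit σ V uP uM h hP hM := by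
  set e := convexEnvelope (pMinus σ V) with he
  have hde : ∀ x, 0 < x → HasDerivAt e (deriv e x) x := fun x hx => by
    obtain ⟨s, -, hd, -⟩ := hσ.exists_hasDerivAt_envelope_minus hV hx
    exact hd.differentiableAt.hasDerivAt
  have hu := T.isThresholds.uP_lt_uS
  have huM := T.uM_pos
  suffices ∃ x ∈ Icc uM (h - uP), deriv (pPlus σ V) (h - x) - deriv e x = 0 by
    obtain ⟨x, hx, hx0⟩ := this
    refine ⟨h - x, x, by ring, by linarith [hx.2], hx.1, deriv (pPlus σ V) (h - x),
      hσ.hasDerivAt_pPlus V _, ?_⟩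
    rw [sub_eq_zero.1 hx0]
    exact (hde x (huM.trans_le hx.1)).hasDerivWithinAt
  -- The first chord touches the envelope at `uM` from below, and the envelope is differentiable
  -- there.
  have h1 : deriv e uM = -BM := deriv_eq_of_contact huM (hde uM huM)
    (fun u hu => affine_le_convexEnvelope T.minus_line hu)
    (T.envelope_minus hσ hV (right_mem_Icc.2 huM.le))
  have h2 : -BM ≤ deriv (pPlus σ V) (h - uM) := by
    rw [← T.deriv_uS]
    exact T.plus_mono.monotoneOn hu.le (by rw [mem_Ici]; linarith) (by linarith)
  rcases h2.eq_or_lt with h2 | h2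
  · exact ⟨uM, ⟨le_rfl, by linarith⟩, by rw [h1, ← h2]; ring⟩
  have h3 : deriv (pPlus σ V) (h - (h - uP)) - deriv e (h - uP) < 0 := by
    rw [sub_sub_cancel, T.deriv_uP]
    have := T.neg_BM_le hσ hV (x := h - uP) (by linarith)
      (hde (h - uP) (by linarith)).hasDerivWithinAt
    linarith [T.BM_lt]
  -- Darboux's theorem: the slope difference is itself a derivative, so continuity of the slope of
  -- the envelope is not required.
  obtain ⟨x, hx, hx0⟩ := exists_hasDerivWithinAt_eq_of_lt_of_gt (a := uM) (b := h - uP) (m := 0)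
    (f := fun x => -pPlus σ V (h - x) - e x)
    (f' := fun x => deriv (pPlus σ V) (h - x) - deriv e x) (by linarith) (fun x hx => by
      have a1 := ((hσ.hasDerivAt_pPlus V (h - x)).comp x ((hasDerivAt_id x).const_sub h)).fun_neg
      have a2 := a1.sub (hde x (huM.trans_le hx.1))
      refine (a2.congr_deriv ?_).hasDerivWithinAt
      ring) (by simp only [h1]; linarith) h3
  exact ⟨x, Ioo_subset_Icc_self hx, hx0⟩

/-- Every `x ≥ uM` is the lower height for some length, since the slope of `p₊` takes all values in
`(-BP, 0)`. -/
lemma split_of_slope (T : ThresholdFacts σ V uP BP uM BM uS) (hσ : ClassA2 σ) (hV : 0 < V)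
    {x s : ℝ} (hx : uM ≤ x) (hs : s < 0) (hd : HasDerivAt (convexEnvelope (pMinus σ V)) s x) :
    ∃ hP, uS ≤ hP ∧ IsSplit σ V uP uM (hP + x) hP x := by
  have h1 := T.neg_BM_le hσ hV (T.uM_pos.trans_le hx) hd.hasDerivWithinAt
  obtain ⟨v, hv, hvs⟩ := T.plus_surj s (by linarith [T.BM_lt]) hs
  have hsp : IsSplit σ V uP uM (v + x) v x :=
    ⟨rfl, hv.le, hx, s, hvs ▸ hσ.hasDerivAt_pPlus V v, hd.hasDerivWithinAt⟩
  exact ⟨v, (T.split_facts hσ hV hsp).1, hsp⟩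

lemma gap_right (T : ThresholdFacts σ V uP BP uM BM uS) {a b x : ℝ}
    (hg : IsGap (pMinus σ V) a b) (hx : x ∈ Ioo a b) (hux : uM ≤ x) : uM ≤ a := by
  by_contra! hlt
  exact T.uM_notMem (hg.2.2.1 ⟨hlt, hux.trans_lt hx.2⟩)

lemma fifthKind_nonempty (T : ThresholdFacts σ V uP BP uM BM uS) (hσ : ClassA2 σ) (hV : 0 < V)
    {x : ℝ} (hx : uM ≤ x) (hg : x ∈ gapSet (pMinus σ V)) :
    (fifthKindLengths σ V uP uM uS).Nonempty := by
  have hx0 := T.uM_pos.trans_le hx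
  obtain ⟨a, b, s, hab, hxab, -, -, -⟩ := hσ.exists_gap_line hV hx0 hg
  obtain ⟨s, hs, hd, -⟩ := hσ.exists_hasDerivAt_envelope_minus hV hx0
  obtain ⟨hP, h1, h2⟩ := T.split_of_slope hσ hV hx hs hd
  exact ⟨hP + x, by linarith, hP, x, a, b, h2, hab, T.gap_right hab hxab hx, hxab⟩

/-- Inside a gap the slope of the envelope is constant, so `hP` can be kept while `hM` absorbs a
small change of length. -/
lemma isOpen_fifthKind (T : ThresholdFacts σ V uP BP uM BM uS) (hσ : ClassA2 σ) (hV : 0 < V) :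
    IsOpen (fifthKindLengths σ V uP uM uS) := by
  rw [isOpen_iff_mem_nhds]
  rintro h ⟨hh, hP, hM, a, b, hsp, hab, hua, hM2⟩
  obtain ⟨hS, -, hd, -⟩ := T.split_facts hσ hV hsp
  have hM0 : 0 < hM := T.uM_pos.trans_le hsp.2.2.1
  obtain ⟨a', b', s, hab', hM2', hd', -, -⟩ := hσ.exists_gap_line hV hM0 (hab.2.2.1 hM2)
  obtain ⟨rfl, rfl⟩ := hab.unique hab' hM2 hM2'
  have es : s = deriv (pPlus σ V) hP :=
    (uniqueDiffOn_Ici (0 : ℝ) hM (mem_Ici.2 hM0.le)).eq_deriv _ (hd' hM hM2).hasDerivWithinAt hd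
  have hsum := hsp.1
  filter_upwards [Ioo_mem_nhds (show hP + a < h by linarith [hM2.1])
    (show h < hP + b by linarith [hM2.2])] with k hk
  have hk2 : k - hP ∈ Ioo a b := ⟨by linarith [hk.1], by linarith [hk.2]⟩
  exact ⟨by linarith [hk2.1], hP, k - hP, a, b, ⟨by ring, hsp.2.1, by linarith [hk2.1], s,
    es ▸ hσ.hasDerivAt_pPlus V hP, (hd' _ hk2).hasDerivWithinAt⟩, hab, hua, hk2⟩

lemma fifthKind_subset (T : ThresholdFacts σ V uP BP uM BM uS) (hσ : ClassA2 σ) (hV : 0 < V) :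
    fifthKindLengths σ V uP uM uS ⊆ Ioi (uS + uM) := by
  rintro h ⟨hh, hP, hM, a, b, hsp, hab, hua, hM2⟩
  have := (T.split_facts hσ hV hsp).1
  have := hsp.1
  rw [mem_Ioi]
  linarith [hM2.1]

/-- The right end of a gap is outside every gap. It is the lower height for some length, and by
uniqueness of the split that length is not of the last kind. -/
lemma nonempty_compl_fifthKind (T : ThresholdFacts σ V uP BP uM BM uS) (hσ : ClassA2 σ)
    (hV : 0 < V) : (Ioi (uS + uM) \ fifthKindLengths σ V uP uM uS).Nonempty := by
  obtain ⟨x, hx, hxg⟩ : ∃ x, uM < x ∧ x ∉ gapSet (pMinus σ V) := by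
    by_cases hg : uM + 1 ∈ gapSet (pMinus σ V)
    · obtain ⟨a, b, s, hab, hxab, -, -, -⟩ := hσ.exists_gap_line hV
        (by linarith [T.uM_pos]) hg
      exact ⟨b, by linarith [hxab.2], hab.2.2.2.2⟩
    · exact ⟨uM + 1, by linarith, hg⟩
  obtain ⟨s, hs, hd, -⟩ := hσ.exists_hasDerivAt_envelope_minus hV (T.uM_pos.trans hx)
  obtain ⟨hP, h1, h2⟩ := T.split_of_slope hσ hV hx.le hs hd
  refine ⟨hP + x, by rw [mem_Ioi]; linarith, ?_⟩
  rintro ⟨-, hP', hM', a, b, hsp, hab, -, hM2⟩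
  obtain ⟨-, rfl⟩ := T.split_unique hσ hV h2 hsp
  exact hxg (hab.2.2.1 hM2)

end ThresholdFacts

/-! ### The classification of optimal bodies -/

namespace ThresholdFacts

variable {σ : ℝ → ℝ} {V uP BP uM BM uS : ℝ}

/-- The calibrating slope is `-BP`. The line for `p₊` touches at `0` and `uP`; that for `p₋` is
steeper than its first chord and touches only at `0`. -/
lemma optimal_trapezium (T : ThresholdFacts σ V uP BP uM BM uS) (hσ : ClassA2 σ) (hV : 0 < V)
    {h : ℝ} (hh : 0 < h) (hu : h ≤ uP) :
    IsMinResistance σ V h (pPlus σ V 0 - BP * h + pMinus σ V 0) ∧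
      ∀ K : Set (ℝ × ℝ), IsOptimal σ V h K ↔
        ∃ c : ℝ, K = isoTrapezium c 1 (c + h) (1 - h / uP) := by
  have hBP := T.isThresholds.BP_pos
  have hlow : ∀ u, 0 ≤ u → pMinus σ V 0 + -BP * u ≤ pMinus σ V u := fun u hu => by
    nlinarith [T.minus_line u hu, T.BM_lt]
  obtain ⟨h1, h2⟩ := optimal_short (A := pPlus σ V 0) (s := -BP) (a := 0) (b := uP) hσ hV
    (by linarith) T.plus_line hlow le_rfl hh.le hu (by simp) T.pPlus_uP T.plus_contact
    (.inl fun u hu0 he => by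
      by_contra hne
      have : 0 < u := lt_of_le_of_ne hu0 (Ne.symm hne)
      nlinarith [T.minus_line u hu0, T.BM_lt])
  refine ⟨by convert h1 using 1; ring, fun K => ?_⟩
  simp only [isoTrapezium_eq_bentBody _ hh hu]
  exact h2 K

/-- The calibrating slope is that of `p₊` at `h`. It is at most `-BM`, so the line through `(0,
p₋(0))` stays below `p₋`. At `h = uP` the trapezium of the previous case has become a triangle. -/
lemma optimal_triangle (T : ThresholdFacts σ V uP BP uM BM uS) (hσ : ClassA2 σ) (hV : 0 < V)
    {h : ℝ} (hh : uP ≤ h) (hu : h ≤ uS) :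
    IsMinResistance σ V h (pPlus σ V h + pMinus σ V 0) ∧
      ∀ K : Set (ℝ × ℝ), IsOptimal σ V h K ↔ ∃ c : ℝ, K = isoTriangle c 1 h := by
  have huP := T.isThresholds.uP_pos
  rcases hh.eq_or_lt with rfl | hlt
  · obtain ⟨h1, h2⟩ := T.optimal_trapezium hσ hV huP le_rfl
    refine ⟨by rw [T.pPlus_uP]; convert h1 using 1; ring, fun K => ?_⟩
    simp only [isoTriangle_eq_isoTrapezium]
    rw [h2, div_self huP.ne', sub_self]
  · have hs : deriv (pPlus σ V) h ≤ -BM := by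
      rw [← T.deriv_uS]
      exact T.plus_mono.monotoneOn hh T.isThresholds.uP_lt_uS.le hu
    have hBM := T.isThresholds.BM_pos
    obtain ⟨h1, h2⟩ := optimal_short (A := pPlus σ V h - deriv (pPlus σ V) h * h)
      (s := deriv (pPlus σ V) h) (a := h) (b := h) hσ hV (by linarith)
      (fun u hu0 => by
        rcases eq_or_ne u h with rfl | hne
        · linarith
        · linarith [T.plus_tangent h u hlt hu0 hne])
      (fun u hu0 => by nlinarith [T.minus_line u hu0]) (by linarith) le_rfl le_rfl
      (by ring) (by ring) (fun u hu0 he => by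
        by_contra hne
        have hne' : u ≠ h := fun h => hne (.inl h)
        linarith [T.plus_tangent h u hlt hu0 hne']) (.inr rfl)
    refine ⟨by convert h1 using 1; ring, fun K => ?_⟩
    simp only [isoTriangle_eq_bentBody _ (huP.trans hlt)]
    exact h2 K

/-- The calibrating slope is `-BM` for all these lengths: the upper slope is fixed at `uS`, and the
lower boundary mixes the slopes `0` and `uM` to reach the remaining length. -/
lemma optimal_triangleTrapezium (T : ThresholdFacts σ V uP BP uM BM uS) (hσ : ClassA2 σ)
    (hV : 0 < V) {h : ℝ} (hh : uS < h) (hu : h < uS + uM) :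
    IsMinResistance σ V h (pPlus σ V uS + pMinus σ V 0 - BM * (h - uS)) ∧
      (∀ K : Set (ℝ × ℝ), IsOptimal σ V h K ↔
        IsBody h K ∧ HasOptimalParts σ V uS (h - uS) K) ∧
      (∀ c : ℝ, IsOptimal σ V h (triangleTrapezium c uS (h - uS) uM)) ∧
      ((∀ u : ℝ, IsContact σ V uS (h - uS) u → u = 0 ∨ u = uM) →
        ∀ K : Set (ℝ × ℝ), IsOptimal σ V h K →
          ∃ c : ℝ, K = triangleTrapezium c uS (h - uS) uM) := by
  have hM0 : 0 < h - uS := by linarith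
  have hM1 : h - uS < uM := by linarith
  have he := T.envelope_minus hσ hV ⟨hM0.le, hM1.le⟩
  have hBM := T.isThresholds.BM_pos
  have hS := T.uS_pos
  obtain ⟨h1, h2, h3, h4⟩ := optimal_long (hP := uS) (hM := h - uS) (a := 0) (b := uM) hσ hV hS
    (by rw [T.deriv_uS]; linarith)
    (fun u hu0 hne => T.plus_tangent uS u T.isThresholds.uP_lt_uS hu0 hne)
    (fun u hu0 => by rw [he, T.deriv_uS]; linarith [T.minus_line u hu0]) hM0.le hM1.le
    ⟨le_rfl, by rw [he, T.deriv_uS]; ring⟩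
    ⟨T.uM_pos.le, by rw [he, T.deriv_uS, T.pMinus_uM]; ring⟩
  rw [add_sub_cancel] at h1 h2 h3 h4
  simp only [triangleTrapezium_eq_bentBody _ hS hM0 hM1.le]
  refine ⟨?_, h2, h3, h4⟩
  convert h1 using 1
  rw [he]
  ring

/-- The common slope at the split calibrates. Outside the gaps `hM` itself is a contact slope; in a
gap the envelope at `hM` is reached only by mixing the slopes at both ends. -/
lemma optimal_two_parts (T : ThresholdFacts σ V uP BP uM BM uS) (hσ : ClassA2 σ)
    (hV : 0 < V) {h : ℝ} (hh : uS + uM ≤ h) :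
    ∃ hP hM : ℝ, IsSplit σ V uP uM h hP hM ∧
      (∀ hP' hM' : ℝ, IsSplit σ V uP uM h hP' hM' → hP' = hP ∧ hM' = hM) ∧
      IsMinResistance σ V h (pPlus σ V hP + convexEnvelope (pMinus σ V) hM) ∧
      (∀ K : Set (ℝ × ℝ), IsOptimal σ V h K ↔
        IsBody h K ∧ HasOptimalParts σ V hP hM K) ∧
      ((hM ∉ gapSet (pMinus σ V) ∧
          (∀ c : ℝ, IsOptimal σ V h (twoTriangles c hP hM)) ∧
          ((∀ u : ℝ, IsContact σ V hP hM u → u = hM) →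
            ∀ K : Set (ℝ × ℝ), IsOptimal σ V h K →
              ∃ c : ℝ, K = twoTriangles c hP hM)) ∨
        (∃ a b : ℝ, IsGap (pMinus σ V) a b ∧ uM ≤ a ∧ hM ∈ Ioo a b ∧
          (∀ c : ℝ, IsOptimal σ V h (twoTrianglesTrapezium c hP hM a b)) ∧
          ((∀ u : ℝ, IsContact σ V hP hM u → u = a ∨ u = b) →
            ∀ K : Set (ℝ × ℝ), IsOptimal σ V h K →
              ∃ c : ℝ, K = twoTrianglesTrapezium c hP hM a b))) := by
  obtain ⟨hP, hM, hsp⟩ := T.exists_split hσ hV hh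
  obtain ⟨hS, hs, hd, hB⟩ := T.split_facts hσ hV hsp
  have hP0 : 0 < hP := T.uS_pos.trans_le hS
  have hM0 : 0 < hM := T.uM_pos.trans_le hsp.2.2.1
  obtain rfl : hP + hM = h := hsp.1
  have htan : ∀ u, 0 ≤ u → u ≠ hP →
      pPlus σ V hP + deriv (pPlus σ V) hP * (u - hP) < pPlus σ V u := fun u hu hne =>
    T.plus_tangent hP u (T.isThresholds.uP_lt_uS.trans_le hS) hu hne
  refine ⟨hP, hM, hsp, fun _ _ h' => T.split_unique hσ hV hsp h', ?_⟩
  by_cases hg : hM ∈ gapSet (pMinus σ V)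
  · obtain ⟨a, b, s, hab, hM2, hd', hca, hcb⟩ := hσ.exists_gap_line hV hM0 hg
    have hua := T.gap_right hab hM2 hsp.2.2.1
    have ha0 : 0 < a := T.uM_pos.trans_le hua
    have es : s = deriv (pPlus σ V) hP :=
      (uniqueDiffOn_Ici (0 : ℝ) hM (mem_Ici.2 hM0.le)).eq_deriv _ (hd' hM hM2).hasDerivWithinAt hd
    rw [es] at hca hcb
    obtain ⟨h1, h2, h3, h4⟩ := optimal_long hσ hV hP0 hs htan hB hM2.1.le hM2.2.le
      ⟨ha0.le, hca⟩ ⟨(hM0.trans hM2.2).le, hcb⟩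
    refine ⟨h1, h2, .inr ⟨a, b, hab, hua, hM2, ?_⟩⟩
    simp only [twoTrianglesTrapezium_eq_bentBody _ hP0 ha0 hM2.1 hM2.2]
    exact ⟨h3, h4⟩
  · have he : pMinus σ V hM = convexEnvelope (pMinus σ V) hM := by
      by_contra hne
      exact hg ⟨hM0.le, lt_of_le_of_ne (hσ.envelope_minus_le hV hM0.le) (Ne.symm hne)⟩
    have hc : IsContact σ V hP hM hM := ⟨hM0.le, by rw [he]; ring⟩
    obtain ⟨h1, h2, h3, h4⟩ := optimal_long hσ hV hP0 hs htan hB le_rfl le_rfl hc hc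
    refine ⟨h1, h2, .inl ⟨hg, ?_⟩⟩
    simp only [twoTriangles_eq_bentBody _ hP0 hM0]
    exact ⟨h3, fun h => h4 fun u hu => .inl (h u hu)⟩

end ThresholdFacts

/-! ### Mixtures of two profiles -/

lemma euclLength_smul {β : ℝ} (hβ : 0 < β) (x y : ℝ) :
    euclLength (β * x, β * y) = β * euclLength (x, y) := by
  rw [euclLength, euclLength, show (β * x, β * y).1 ^ 2 + (β * x, β * y).2 ^ 2 =
    β ^ 2 * ((x, y).1 ^ 2 + (x, y).2 ^ 2) by simp only; ring, Real.sqrt_mul (sq_nonneg β),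
    Real.sqrt_sq hβ.le]

lemma radialMarginal_comp_mul (σ : ℝ → ℝ) {β : ℝ} (hβ : 0 < β) (y : ℝ) :
    radialMarginal (fun r => σ (β * r)) y = β⁻¹ * radialMarginal σ (β * y) := by
  have h := Measure.integral_comp_mul_left (fun x => σ (euclLength (x, β * y))) β
  rw [abs_of_pos (inv_pos.2 hβ), smul_eq_mul] at h
  rw [radialMarginal, radialMarginal, ← h]
  simp only [euclLength_smul hβ]

/-- The factor `β⁻¹ ^ 4` combines two dimensions of velocity space with the squared velocity. -/
lemma fluxPotential_comp_mul (m : ℝ → ℝ) {β : ℝ} (hβ : 0 < β) (s : ℝ) :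
    fluxPotential (fun y => β⁻¹ * m (β * y)) s = β⁻¹ ^ 4 * fluxPotential m (β * s) := by
  have h := Measure.integral_comp_mul_left (fun y => max (β * s - y) 0 ^ 2 * m y) β
  rw [abs_of_pos (inv_pos.2 hβ), smul_eq_mul] at h
  have e : ∀ y, max (s - y) 0 ^ 2 * (β⁻¹ * m (β * y)) =
      β⁻¹ ^ 3 * (max (β * s - β * y) 0 ^ 2 * m (β * y)) := fun y => by
    rw [← mul_sub, show max (β * (s - y)) 0 = β * max (s - y) 0 by
      rw [mul_max_of_nonneg _ _ hβ.le, mul_zero]]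
    field_simp
  rw [fluxPotential, fluxPotential]
  simp only [e]
  rw [integral_const_mul, h]
  ring

namespace ClassA2

variable {σ : ℝ → ℝ}

lemma differentiableAt (hσ : ClassA2 σ) {r : ℝ} (hr : 0 < r) : DifferentiableAt ℝ σ r :=
  (hσ.contDiffOn.differentiableOn one_ne_zero).differentiableAt (Ici_mem_nhds hr)

lemma mixture (hσ : ClassA2 σ) {α β : ℝ} (hα : 0 ≤ α) (hβ : 0 < β) :
    ClassA2 fun r => σ r + α * σ (β * r) := by
  have hd : ∀ r : ℝ, 0 < r → deriv (fun r => σ r + α * σ (β * r)) r / r =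
      deriv σ r / r + α * β ^ 2 * (deriv σ (β * r) / (β * r)) := fun r hr => by
    have h1 : HasDerivAt (fun r => σ (β * r)) (deriv σ (β * r) * β) r := by
      have := (hσ.differentiableAt (mul_pos hβ hr)).hasDerivAt.comp r
        ((hasDerivAt_id r).const_mul β)
      simpa [Function.comp_def] using this
    rw [((hσ.differentiableAt hr).hasDerivAt.fun_add (h1.const_mul α)).deriv]
    field_simp
  refine ⟨?_, fun r hr => ?_, ?_, ?_, ?_⟩
  · refine hσ.contDiffOn.add (contDiffOn_const.mul ?_)
    refine hσ.contDiffOn.comp (g := σ) (f := fun r => β * r) (by fun_prop) fun r hr => ?_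
    exact mul_nonneg hβ.le hr
  · rw [hd r hr]
    have h1 := hσ.neg r hr
    have h2 := hσ.neg (β * r) (mul_pos hβ hr)
    nlinarith [mul_nonneg hα (sq_nonneg β)]
  · obtain ⟨b, hb⟩ := hσ.bddBelow
    refine ⟨b + α * β ^ 2 * b, ?_⟩
    rintro _ ⟨r, hr, rfl⟩
    simp only
    rw [hd r hr]
    have h1 := hb ⟨r, hr, rfl⟩
    have h2 := hb ⟨β * r, mul_pos hβ hr, rfl⟩
    simp only at h1 h2
    gcongr
  · intro r hr t ht hrt
    simp only
    rw [hd r hr, hd t ht]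
    have h1 := hσ.monotoneOn hr ht hrt
    have h2 := hσ.monotoneOn (mem_Ioi.2 (mul_pos hβ hr)) (mem_Ioi.2 (mul_pos hβ ht))
      (mul_le_mul_of_nonneg_left hrt hβ.le)
    simp only at h1 h2
    gcongr
  · have h := (integrableOn_Ioi_comp_mul_left_iff (fun r : ℝ => r ^ 2 * σ r * (2 * r)) 0 hβ).2
      (by simpa using hσ.integrableOn)
    refine (hσ.integrableOn.add (h.const_mul (α * β⁻¹ ^ 3))).congr (.of_forall fun r => ?_)
    simp only [Pi.add_apply]
    field_simp

lemma fluxPotential_mixture (hσ : ClassA2 σ) (α : ℝ) {β : ℝ} (hβ : 0 < β) (s : ℝ) :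
    fluxPotential (radialMarginal fun r => σ r + α * σ (β * r)) s =
      fluxPotential (radialMarginal σ) s +
        α * β⁻¹ ^ 4 * fluxPotential (radialMarginal σ) (β * s) := by
  have hm := hσ.isMarginal
  have e : radialMarginal (fun r => σ r + α * σ (β * r)) =
      fun y => radialMarginal σ y + α * (β⁻¹ * radialMarginal σ (β * y)) := by
    ext y
    have hi : Integrable fun x => σ (β * euclLength (x, y)) := by
      have := (integrable_comp_mul_left_iff (fun x => σ (euclLength (x, β * y))) hβ.ne').2
        (hσ.integrable_section (β * y))
      simpa only [euclLength_smul hβ] using this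
    rw [← radialMarginal_comp_mul σ hβ, radialMarginal, radialMarginal, radialMarginal,
      integral_add (hσ.integrable_section y) (hi.const_mul α), integral_const_mul]
  have hi : Integrable fun y => max (s - y) 0 ^ 2 * (β⁻¹ * radialMarginal σ (β * y)) := by
    have := ((integrable_comp_mul_left_iff
      (fun y => max (β * s - y) 0 ^ 2 * radialMarginal σ y) hβ.ne').2
      (hm.integrable_max_sq (β * s))).const_mul (β⁻¹ ^ 3)
    refine this.congr (.of_forall fun y => ?_)
    simp only
    rw [← mul_sub, show max (β * (s - y)) 0 = β * max (s - y) 0 by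
      rw [mul_max_of_nonneg _ _ hβ.le, mul_zero]]
    field_simp
  rw [mul_assoc, ← fluxPotential_comp_mul _ hβ, e, fluxPotential, fluxPotential, fluxPotential]
  simp only [mul_add, mul_left_comm _ α]
  rw [integral_add (hm.integrable_max_sq s) (hi.const_mul α), integral_const_mul]
  ring

/-- Rapidly decreasing profiles have rapidly decreasing potentials. -/
lemma exists_fluxPotential_le (hσ : ClassA2 σ)
    (hdec : ∃ r₀ : ℝ, AntitoneOn (fun r : ℝ => r ^ 7 * σ r) (Ici r₀)) :
    ∃ C, ∀ x, 0 < x → x ^ 2 * fluxPotential (radialMarginal σ) (-x) ≤ C := by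
  have hint : IntegrableOn (fun r => r * (r ^ 4 * σ r)) (Ioi 0) := by
    obtain ⟨r₀, hr₀⟩ := hdec
    set R := max r₀ 1 with hR
    have hR1 : 1 ≤ R := le_max_right _ _
    have hR0 : 0 < R := by linarith
    have hc : ContinuousOn (fun r => r * (r ^ 4 * σ r)) (Ici 0) :=
      continuousOn_id.mul ((continuous_pow 4).continuousOn.mul hσ.continuousOn)
    rw [← Ioc_union_Ioi_eq_Ioi hR0.le]
    refine IntegrableOn.union ?_ ?_
    · exact ((hc.mono Icc_subset_Ici_self).integrableOn_compact isCompact_Icc).mono_set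
        Ioc_subset_Icc_self
    -- The exponent `7` enters here: `r⁵ σ(r)` is `r⁻²` times the decreasing `r⁷ σ(r)`. This gives a
    -- finite fourth moment.
    · have hI := (integrableOn_Ioi_rpow_of_lt (a := -2) (by norm_num) hR0).const_mul (R ^ 7 * σ R)
      refine Integrable.mono' hI ((hc.mono fun x (hx : R < x) => mem_Ici.2
        (by linarith)).aestronglyMeasurable measurableSet_Ioi) ?_
      filter_upwards [ae_restrict_mem measurableSet_Ioi] with x (hx : R < x)
      have hx0 : 0 < x := by linarith
      have hs := hσ.pos hx0.le
      have h1 : x ^ 7 * σ x ≤ R ^ 7 * σ R :=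
        hr₀ (mem_Ici.2 (le_max_left _ _)) (mem_Ici.2 ((le_max_left r₀ 1).trans hx.le)) hx.le
      rw [Real.norm_of_nonneg (by positivity), Real.rpow_neg hx0.le, ← div_eq_mul_inv,
        le_div_iff₀ (by positivity)]
      norm_cast
      calc x * (x ^ 4 * σ x) * x ^ 2 = x ^ 7 * σ x := by ring
        _ ≤ _ := h1
  have hi : Integrable fun y => y ^ 4 * radialMarginal σ y := by
    have h := integrable_comp_euclLength hint
    have h2 : Integrable fun q : ℝ × ℝ => q.2 ^ 4 * σ (euclLength q) := by
      refine h.mono' ((by fun_prop : Continuous fun q : ℝ × ℝ => q.2 ^ 4).mul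
        (hσ.continuous_comp continuous_euclLength euclLength_nonneg)).aestronglyMeasurable
        (.of_forall fun q => ?_)
      have hs := hσ.pos (euclLength_nonneg q)
      rw [Real.norm_of_nonneg (by positivity)]
      refine mul_le_mul_of_nonneg_right ?_ hs.le
      calc q.2 ^ 4 = (q.2 ^ 2) ^ 2 := by ring
        _ ≤ (euclLength q ^ 2) ^ 2 := pow_le_pow_left₀ (sq_nonneg _)
          (by rw [euclLength_sq]; nlinarith [sq_nonneg q.1]) 2
        _ = euclLength q ^ 4 := by ring
    rw [Measure.volume_eq_prod] at h2
    refine h2.integral_prod_right.congr (.of_forall fun y => ?_)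
    simp only [integral_const_mul, radialMarginal]
  refine ⟨2 * ∫ y, y ^ 4 * radialMarginal σ y, fun x hx => ?_⟩
  rw [fluxPotential, mul_left_comm, ← integral_const_mul]
  refine mul_le_mul_of_nonneg_left (integral_mono
    ((hσ.isMarginal.integrable_max_sq (-x)).const_mul _) hi fun y => ?_) two_pos.le
  have hm := hσ.isMarginal.pos y
  simp only
  rw [← mul_assoc]
  gcongr
  rcases le_total (-x - y) 0 with h | h
  · rw [max_eq_right h, zero_pow two_ne_zero, mul_zero]; positivity
  -- Here `y ≤ -x`, so both `x` and `-x - y` are at most `|y|`.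
  · rw [max_eq_left h]
    calc x ^ 2 * (-x - y) ^ 2 = (x * (-x - y)) ^ 2 := by ring
      _ ≤ (y ^ 2) ^ 2 := by
        refine pow_le_pow_left₀ (mul_nonneg hx.le h) ?_ 2
        nlinarith
      _ = y ^ 4 := by ring

end ClassA2

lemma tendsto_mul_cosSlope {w : ℝ} (hw : 0 < w) :
    Tendsto (fun t => t * cosSlope (t * w)) atTop (𝓝 (1 / w)) := by
  have h1 : Tendsto (fun t : ℝ => 1 / Real.sqrt (w ^ 2 + t⁻¹ ^ 2)) atTop (𝓝 (1 / w)) := by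
    have h2 : ContinuousAt (fun y : ℝ => 1 / Real.sqrt (w ^ 2 + y ^ 2)) 0 := by
      refine ContinuousAt.div continuousAt_const (by fun_prop) ?_
      positivity
    have h3 := h2.tendsto.comp tendsto_inv_atTop_zero
    simpa [Real.sqrt_sq hw.le, Function.comp_def] using h3
  refine h1.congr' ?_
  filter_upwards [eventually_gt_atTop 0] with t ht
  rw [cosSlope, mul_one_div, div_eq_div_iff (by positivity) (by positivity), one_mul,
    show (t * w) ^ 2 + 1 = t ^ 2 * (w ^ 2 + t⁻¹ ^ 2) by field_simp, Real.sqrt_mul (by positivity),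
    Real.sqrt_sq ht.le]

/-! ### Gaps far from the origin -/

/-- A positive function that is `O(w²)` at `0` cannot be concave: for small `w` the value at `w` is
far below the chord from `w / 4` to `1`, whose height is at least of order `w`. -/
lemma exists_strict_chord {g : ℝ → ℝ} {C : ℝ} (h0 : ∀ w, 0 < w → 0 ≤ g w) (h1 : 0 < g 1)
    (hC : ∀ w, 0 < w → g w ≤ C * w ^ 2) :
    ∃ w₁ w₂ θ : ℝ, 0 < w₁ ∧ 0 < w₂ ∧ 0 < θ ∧ θ < 1 ∧ w₂ = (1 - θ) * w₁ + θ ∧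
      g w₂ < (1 - θ) * g w₁ + θ * g 1 := by
  have hC0 : 0 < C := by have := hC 1 one_pos; linarith
  obtain ⟨w, hw0, hw⟩ := exists_between (show (0 : ℝ) < min (1 / 2) (g 1 / (4 * C)) by positivity)
  have hw2 : w < 1 / 2 := hw.trans_le (min_le_left _ _)
  have hw3 : w * (4 * C) < g 1 :=
    (lt_div_iff₀ (by positivity)).1 (hw.trans_le (min_le_right _ _))
  have hd : 0 < 1 - w / 4 := by linarith
  have hθ : (w - w / 4) / (1 - w / 4) * (1 - w / 4) = w - w / 4 := div_mul_cancel₀ _ hd.ne'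
  set θ := (w - w / 4) / (1 - w / 4) with hθd
  have hθ0 : 0 < θ := div_pos (by linarith) hd
  have hθ1 : θ < 1 := (div_lt_one hd).2 (by linarith)
  have hθ2 : 3 / 4 * w ≤ θ := by nlinarith
  refine ⟨w / 4, w, θ, by positivity, hw0, hθ0, hθ1, by linarith, ?_⟩
  calc g w ≤ C * w ^ 2 := hC w hw0
    _ < θ * g 1 := by nlinarith
    _ ≤ _ := le_add_of_nonneg_left (mul_nonneg (by linarith) (h0 _ (by positivity)))

namespace ClassA2

variable {σ : ℝ → ℝ} {V : ℝ}

lemma pMinus_mixture (hσ : ClassA2 σ) (V : ℝ) {κ β : ℝ} (hκ : 0 ≤ κ) (hβ : 0 < β) (u : ℝ) :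
    pMinus (fun r => σ r + κ * β ^ 3 * σ (β * r)) V u =
      -(fluxPotential (radialMarginal σ) (-(V * cosSlope u)) +
        κ / β * fluxPotential (radialMarginal σ) (-(β * V * cosSlope u))) := by
  rw [(hσ.mixture (by positivity) hβ).pMinus_eq]
  simp only
  rw [hσ.fluxPotential_mixture _ hβ, show κ * β ^ 3 * β⁻¹ ^ 4 = κ / β by field_simp]
  ring_nf

/-- The graphs of `p₋` for mixtures, rescaled, have a limit. -/
lemma tendsto_pMinus_mixture (hσ : ClassA2 σ) (hV : 0 < V) {κ w : ℝ} (hκ : 0 ≤ κ) (hw : 0 < w) :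
    Tendsto (fun β : ℝ => β * (pMinus (fun r => σ r + κ * β ^ 3 * σ (β * r)) V (β * V * w) +
      fluxPotential (radialMarginal σ) 0)) atTop
      (𝓝 (fluxSlope (radialMarginal σ) 0 / w -
        κ * fluxPotential (radialMarginal σ) (-(1 / w)))) := by
  have hm := hσ.isMarginal
  have hβV : Tendsto (fun β : ℝ => β * V) atTop atTop := tendsto_id.atTop_mul_const hV
  have hz : Tendsto (fun β : ℝ => β * V * cosSlope (β * V * w)) atTop (𝓝 (1 / w)) :=
    (tendsto_mul_cosSlope hw).comp hβV
  have hy : Tendsto (fun β : ℝ => -(V * cosSlope (β * V * w))) atTop (𝓝[≠] 0) := by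
    refine tendsto_nhdsWithin_iff.2 ⟨?_, .of_forall fun β => ?_⟩
    · have h := (tendsto_cosSlope.comp (hβV.atTop_mul_const hw)).const_mul V
      simpa using h.neg
    · exact (neg_neg_of_pos (mul_pos hV (cosSlope_pos _))).ne
  -- The part from `σ` itself is a difference quotient of `Φ` at `0`, multiplied by `β V z → 1 / w`.
  have h1 := ((hm.hasDerivAt_fluxPotential 0).tendsto_slope_zero.comp hy).mul hz
  have h2 := (((hm.hasDerivAt_fluxPotential (-(1 / w))).continuousAt.tendsto.comp hz.neg)).const_mul κ
  refine ((h1.sub h2).congr' ?_).trans_eq (by rw [mul_one_div])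
  filter_upwards [eventually_gt_atTop 0] with β hβ
  have hc := cosSlope_pos (β * V * w)
  simp only [Function.comp_apply, smul_eq_mul, zero_add]
  rw [hσ.pMinus_mixture V hκ hβ]
  generalize fluxPotential (radialMarginal σ) (-(V * cosSlope (β * V * w))) = a
  generalize cosSlope (β * V * w) = z at hc ⊢
  field_simp
  ring

/-- The first chord falls by `BM * uM` from a nonpositive value to one not below `-Φ(0) (1 + κ)`.
Its steepness `BM` is at least the drop of `p₋` on `[0, 1]`, hence that of the unmixed part. The
bound does not depend on `β`. -/
lemma uM_mixture_le (hσ : ClassA2 σ) (hV : 0 < V) {κ β : ℝ} (hκ : 0 ≤ κ) (hβ : 1 ≤ β)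
    {uP BP uM BM uS : ℝ}
    (T : ThresholdFacts (fun r => σ r + κ * β ^ 3 * σ (β * r)) V uP BP uM BM uS) :
    (fluxPotential (radialMarginal σ) (-(V * cosSlope 1)) -
      fluxPotential (radialMarginal σ) (-V)) * uM ≤
        fluxPotential (radialMarginal σ) 0 * (1 + κ) := by
  have hm := hσ.isMarginal
  have hβ0 : 0 < β := by linarith
  have hmono := hm.strictMono_fluxPotential.monotone
  have h0 := hσ.pMinus_mixture V hκ hβ0 0
  have h1 := hσ.pMinus_mixture V hκ hβ0 1
  have hu := hσ.pMinus_mixture V hκ hβ0 uM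
  have hl := T.minus_line 1 zero_le_one
  have hc := T.pMinus_uM
  rw [cosSlope_zero, mul_one, mul_one] at h0
  have hk : 0 ≤ κ / β := by positivity
  have hk1 : κ / β ≤ κ := div_le_self hκ hβ
  have hz := cosSlope_pos uM
  have i1 : κ / β * fluxPotential (radialMarginal σ) (-(β * V)) ≤
      κ / β * fluxPotential (radialMarginal σ) (-(β * V * cosSlope 1)) :=
    mul_le_mul_of_nonneg_left (hmono (neg_le_neg
      (mul_le_of_le_one_right (by positivity) (cosSlope_le_one 1)))) hk
  have i2 : fluxPotential (radialMarginal σ) (-(V * cosSlope uM)) ≤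
      fluxPotential (radialMarginal σ) 0 := hmono (neg_nonpos.2 (by positivity))
  have i3 : κ / β * fluxPotential (radialMarginal σ) (-(β * V * cosSlope uM)) ≤
      κ * fluxPotential (radialMarginal σ) 0 :=
    mul_le_mul hk1 (hmono (neg_nonpos.2 (by positivity))) (hm.fluxPotential_nonneg _) hκ
  have i4 := hm.fluxPotential_nonneg (-V)
  have i5 := mul_nonneg hk (hm.fluxPotential_nonneg (-(β * V)))
  have hB : fluxPotential (radialMarginal σ) (-(V * cosSlope 1)) -
      fluxPotential (radialMarginal σ) (-V) ≤ BM := by linarith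
  have := mul_le_mul_of_nonneg_right hB T.uM_pos.le
  linarith

/-- Rapidly decreasing profiles have mixtures for which the lower envelope has a second gap that
some optimal bodies meet. -/
theorem exists_mixture (hσ : ClassA2 σ) (hV : 0 < V)
    (hdec : ∃ r₀ : ℝ, AntitoneOn (fun r : ℝ => r ^ 7 * σ r) (Ici r₀)) :
    ∃ α β : ℝ, 0 ≤ α ∧ 0 < β ∧ ClassA2 (fun r => σ r + α * σ (β * r)) ∧
      ∃ uP BP uM BM uS : ℝ,
        IsThresholds (fun r => σ r + α * σ (β * r)) V uP BP uM BM uS ∧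
        (fifthKindLengths (fun r => σ r + α * σ (β * r)) V uP uM uS).Nonempty := by
  have hm := hσ.isMarginal
  obtain ⟨C, hC⟩ := hσ.exists_fluxPotential_le hdec
  set Φ := fluxPotential (radialMarginal σ) with hΦ
  obtain ⟨w₁, w₂, θ, hw₁, hw₂, hθ0, hθ1, hw, hg⟩ := exists_strict_chord (g := fun w => Φ (-(1 / w)))
    (C := C) (fun w _ => hm.fluxPotential_nonneg _) (hm.fluxPotential_pos _) fun w hw => by
      have := hC (1 / w) (by positivity)
      rwa [div_pow, one_pow, one_div_mul_eq_div, div_le_iff₀ (by positivity)] at this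
  set D := (1 - θ) * Φ (-(1 / w₁)) + θ * Φ (-(1 / 1)) - Φ (-(1 / w₂)) with hD
  have hD0 : 0 < D := by linarith
  set Ψ := fluxSlope (radialMarginal σ) 0
  set E := (1 - θ) * (Ψ / w₁) + θ * (Ψ / 1) - Ψ / w₂ with hE
  -- The difference between chord and limit function at `w₂` is `E - κ D`: the convex term `Ψ / w`
  -- contributes `E`, and a large `κ` outweighs it.
  obtain ⟨κ, hκ0, hκ⟩ : ∃ κ, 0 ≤ κ ∧ E - κ * D < 0 := by
    refine ⟨(|E| + 1) / D, by positivity, ?_⟩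
    rw [div_mul_cancel₀ _ hD0.ne']
    linarith [le_abs_self E]
  have hlim := (((hσ.tendsto_pMinus_mixture hV hκ0 hw₁).const_mul (1 - θ)).add
    ((hσ.tendsto_pMinus_mixture hV hκ0 one_pos).const_mul θ)).sub
    (hσ.tendsto_pMinus_mixture hV hκ0 hw₂)
  rw [← hΦ] at hlim
  have hev := hlim.eventually_lt_const (u := 0) (by rw [hE, hD] at hκ; linarith)
  set d := Φ (-(V * cosSlope 1)) - Φ (-V) with hd
  have hd0 : 0 < d := by
    have h1 : cosSlope 1 < 1 := by
      have := cosSlope_lt (u := 0) (v := 1) le_rfl one_pos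
      rwa [cosSlope_zero] at this
    exact sub_pos.2 (hm.strictMono_fluxPotential (neg_lt_neg (mul_lt_of_lt_one_right hV h1)))
  -- This puts the point `β V w₂` of the new gap beyond `uM`.
  have hlarge : ∀ᶠ β in atTop, Φ 0 * (1 + κ) / d ≤ β * V * w₂ :=
    ((tendsto_id.atTop_mul_const hV).atTop_mul_const hw₂).eventually_ge_atTop _
  obtain ⟨β, hβev, hβl, hβ1⟩ := (hev.and (hlarge.and (eventually_ge_atTop 1))).exists
  have hβ0 : 0 < β := by linarith
  have hmix : ClassA2 fun r => σ r + κ * β ^ 3 * σ (β * r) := hσ.mixture (by positivity) hβ0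
  obtain ⟨uP, BP, uM, BM, uS, T⟩ := exists_thresholdFacts hmix hV
  refine ⟨κ * β ^ 3, β, by positivity, hβ0, hmix, uP, BP, uM, BM, uS, T.isThresholds,
    T.fifthKind_nonempty hmix hV (x := β * V * w₂) ?_ ⟨by positivity, ?_⟩⟩
  · refine le_trans ?_ hβl
    rw [le_div_iff₀ hd0, mul_comm]
    exact hσ.uM_mixture_le hV hκ0 hβ1 T
  · set q := pMinus (fun r => σ r + κ * β ^ 3 * σ (β * r)) V
    have hconv := (hmix.convexOn_envelope_minus hV).2 (x := β * V * w₁) (y := β * V * 1)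
      (mem_Ici.2 (by positivity)) (mem_Ici.2 (by positivity)) (sub_nonneg.2 hθ1.le) hθ0.le (by ring)
    simp only [smul_eq_mul] at hconv
    rw [show (1 - θ) * (β * V * w₁) + θ * (β * V * 1) = β * V * w₂ by rw [hw]; ring] at hconv
    have e1 := hmix.envelope_minus_le hV (u := β * V * w₁) (by positivity)
    have e2 := hmix.envelope_minus_le hV (u := β * V * 1) (by positivity)
    have e3 : (1 - θ) * q (β * V * w₁) + θ * q (β * V * 1) < q (β * V * w₂) := by
      have : β * ((1 - θ) * q (β * V * w₁) + θ * q (β * V * 1) - q (β * V * w₂)) < 0 := by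
        linarith
      have := (pos_iff_neg_of_mul_neg this).1 hβ0
      linarith
    have e4 := mul_le_mul_of_nonneg_left e1 (sub_nonneg.2 hθ1.le)
    have e5 := mul_le_mul_of_nonneg_left e2 hθ0.le
    linarith

end ClassA2

/-! ### Gaussian profiles -/

lemma classA2_gaussian : ClassA2 fun r => Real.exp (-r ^ 2) := by
  have hd : ∀ r : ℝ, 0 < r → deriv (fun r => Real.exp (-r ^ 2)) r / r = -2 * Real.exp (-r ^ 2) :=
    fun r hr => by
      have h : HasDerivAt (fun r : ℝ => Real.exp (-r ^ 2)) (Real.exp (-r ^ 2) * -(2 * r)) r := by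
        simpa using ((hasDerivAt_pow 2 r).fun_neg).exp
      rw [h.deriv]
      field_simp
  refine ⟨by fun_prop, fun r hr => ?_, ⟨-2, ?_⟩, fun r hr t ht hrt => ?_, ?_⟩
  · rw [hd r hr]
    linarith [Real.exp_pos (-r ^ 2)]
  · rintro _ ⟨r, hr, rfl⟩
    simp only
    rw [hd r hr]
    have : Real.exp (-r ^ 2) ≤ 1 := Real.exp_le_one_iff.2 (by nlinarith)
    linarith
  · simp only
    rw [hd r hr, hd t ht]
    have : Real.exp (-t ^ 2) ≤ Real.exp (-r ^ 2) :=
      Real.exp_le_exp.2 (neg_le_neg (pow_le_pow_left₀ (le_of_lt hr) hrt 2))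
    linarith
  · have h := (integrableOn_rpow_mul_exp_neg_mul_sq (b := 1) one_pos (s := 3)
      (by norm_num)).const_mul 2
    refine IntegrableOn.congr_fun h (fun r _ => ?_) measurableSet_Ioi
    simp only [neg_one_mul]
    norm_cast
    ring

lemma antitoneOn_pow_mul_gaussian (n : ℕ) :
    AntitoneOn (fun r : ℝ => r ^ n * Real.exp (-r ^ 2)) (Ici n) := by
  have h : ∀ r : ℝ, HasDerivAt (fun r : ℝ => r ^ n * Real.exp (-r ^ 2))
      (n * r ^ (n - 1) * Real.exp (-r ^ 2) + r ^ n * (Real.exp (-r ^ 2) * -(2 * r))) r :=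
    fun r => by
      have h : HasDerivAt (fun r : ℝ => Real.exp (-r ^ 2)) (Real.exp (-r ^ 2) * -(2 * r)) r := by
        simpa using ((hasDerivAt_pow 2 r).fun_neg).exp
      exact (hasDerivAt_pow n r).mul h
  refine antitoneOn_of_deriv_nonpos (convex_Ici _) (by fun_prop)
    (fun r _ => (h r).differentiableAt.differentiableWithinAt) fun r hr => ?_
  rw [interior_Ici, mem_Ioi] at hr
  rw [(h r).deriv]
  rcases n with _ | n
  · simp only [Nat.cast_zero] at hr
    have := Real.exp_pos (-r ^ 2)
    simp only [Nat.cast_zero, zero_mul, pow_zero, one_mul, zero_add]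
    nlinarith
  · have hr1 : 1 ≤ r := by push_cast at hr; linarith [(Nat.cast_nonneg n : (0 : ℝ) ≤ n)]
    have : ((n + 1 : ℕ) : ℝ) * r ^ (n + 1 - 1) * Real.exp (-r ^ 2) +
        r ^ (n + 1) * (Real.exp (-r ^ 2) * -(2 * r)) =
        -(r ^ n * Real.exp (-r ^ 2) * (2 * r ^ 2 - (n + 1 : ℕ))) := by
      rw [Nat.add_sub_cancel]; ring
    rw [this, neg_nonpos]
    exact mul_nonneg (by positivity) (by nlinarith)

end

theorem mainTheorem1 :
    -- classification, for every density satisfying the standing condition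
    (∀ (σ : ℝ → ℝ) (V : ℝ), ClassA2 σ → 0 < V →
      ∃ uP BP uM BM uS : ℝ, IsThresholds σ V uP BP uM BM uS ∧
        0 < uP ∧ uP < uS ∧ uS < uS + uM ∧ BM < BP ∧
        -- a trapezium
        (∀ h : ℝ, 0 < h → h < uP →
          IsMinResistance σ V h (pPlus σ V 0 - BP * h + pMinus σ V 0) ∧
          ∀ K : Set (ℝ × ℝ), IsOptimal σ V h K ↔
            ∃ c : ℝ, K = isoTrapezium c 1 (c + h) (1 - h / uP)) ∧
        -- an isosceles triangle
        (∀ h : ℝ, uP ≤ h → h ≤ uS →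
          IsMinResistance σ V h (pPlus σ V h + pMinus σ V 0) ∧
          ∀ K : Set (ℝ × ℝ), IsOptimal σ V h K ↔ ∃ c : ℝ, K = isoTriangle c 1 h) ∧
        -- a triangle and a trapezium
        (∀ h : ℝ, uS < h → h < uS + uM →
          IsMinResistance σ V h (pPlus σ V uS + pMinus σ V 0 - BM * (h - uS)) ∧
          (∀ K : Set (ℝ × ℝ), IsOptimal σ V h K ↔
            IsBody h K ∧ HasOptimalParts σ V uS (h - uS) K) ∧
          (∀ c : ℝ, IsOptimal σ V h (triangleTrapezium c uS (h - uS) uM)) ∧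
          ((∀ u : ℝ, IsContact σ V uS (h - uS) u → u = 0 ∨ u = uM) →
            ∀ K : Set (ℝ × ℝ), IsOptimal σ V h K →
              ∃ c : ℝ, K = triangleTrapezium c uS (h - uS) uM)) ∧
        -- two triangles, or two triangles and a trapezium
        (∀ h : ℝ, uS + uM ≤ h →
          ∃ hP hM : ℝ, IsSplit σ V uP uM h hP hM ∧
            (∀ hP' hM' : ℝ, IsSplit σ V uP uM h hP' hM' → hP' = hP ∧ hM' = hM) ∧
            IsMinResistance σ V h (pPlus σ V hP + convexEnvelope (pMinus σ V) hM) ∧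
            (∀ K : Set (ℝ × ℝ), IsOptimal σ V h K ↔
              IsBody h K ∧ HasOptimalParts σ V hP hM K) ∧
            ((hM ∉ gapSet (pMinus σ V) ∧
                (∀ c : ℝ, IsOptimal σ V h (twoTriangles c hP hM)) ∧
                ((∀ u : ℝ, IsContact σ V hP hM u → u = hM) →
                  ∀ K : Set (ℝ × ℝ), IsOptimal σ V h K →
                    ∃ c : ℝ, K = twoTriangles c hP hM)) ∨
              (∃ a b : ℝ, IsGap (pMinus σ V) a b ∧ uM ≤ a ∧ hM ∈ Ioo a b ∧
                (∀ c : ℝ, IsOptimal σ V h (twoTrianglesTrapezium c hP hM a b)) ∧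
                ((∀ u : ℝ, IsContact σ V hP hM u → u = a ∨ u = b) →
                  ∀ K : Set (ℝ × ℝ), IsOptimal σ V h K →
                    ∃ c : ℝ, K = twoTrianglesTrapezium c hP hM a b)))) ∧
        -- the lengths of the last kind
        IsOpen (fifthKindLengths σ V uP uM uS) ∧
        fifthKindLengths σ V uP uM uS ⊆ Ioi (uS + uM) ∧
        (Ioi (uS + uM) \ fifthKindLengths σ V uP uM uS).Nonempty) ∧
    -- rapidly decreasing profiles have mixtures for which the last kind occurs
    (∀ (σ : ℝ → ℝ) (V : ℝ), ClassA2 σ → 0 < V →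
      (∀ n : ℕ, 0 < n → ∃ r₀ : ℝ, AntitoneOn (fun r : ℝ => r ^ n * σ r) (Ici r₀)) →
      ∃ α β : ℝ, 0 ≤ α ∧ 0 < β ∧ ClassA2 (fun r => σ r + α * σ (β * r)) ∧
        ∃ uP BP uM BM uS : ℝ,
          IsThresholds (fun r => σ r + α * σ (β * r)) V uP BP uM BM uS ∧
          (fifthKindLengths (fun r => σ r + α * σ (β * r)) V uP uM uS).Nonempty) ∧
    -- the last kind does occur
    (∃ (σ : ℝ → ℝ) (V : ℝ), ClassA2 σ ∧ 0 < V ∧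
      ∃ uP BP uM BM uS : ℝ, IsThresholds σ V uP BP uM BM uS ∧
        (fifthKindLengths σ V uP uM uS).Nonempty) := by
  refine ⟨fun σ V hσ hV => ?_, fun σ V hσ hV hdec => hσ.exists_mixture hV (hdec 7 (by norm_num)), ?_⟩
  · obtain ⟨uP, BP, uM, BM, uS, T⟩ := exists_thresholdFacts hσ hV
    have hT := T.isThresholds
    exact ⟨uP, BP, uM, BM, uS, hT, hT.uP_pos, hT.uP_lt_uS, by linarith [T.uM_pos], T.BM_lt,
      fun h hh hu => T.optimal_trapezium hσ hV hh hu.le,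
      fun h h1 h2 => T.optimal_triangle hσ hV h1 h2,
      fun h h1 h2 => T.optimal_triangleTrapezium hσ hV h1 h2,
      fun h h1 => T.optimal_two_parts hσ hV h1,
      T.isOpen_fifthKind hσ hV, T.fifthKind_subset hσ hV, T.nonempty_compl_fifthKind hσ hV⟩
  -- The example is a mixture of two Gaussians.
  · obtain ⟨α, β, -, -, hmix, h⟩ := classA2_gaussian.exists_mixture one_pos
      ⟨_, antitoneOn_pow_mul_gaussian 7⟩
    exact ⟨_, 1, hmix, one_pos, h⟩
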